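/- Let $n\ge 2$. Let $\mathrm{Tot}(\mathcal O_{\mathbb P^1}(2))$ be the total space of $\mathcal O(2)$ on $\mathbb P^1_{\mathbb C}$, glued from two affine planes with coordinates $(x,y)$ and $(z,v)$ by $z=x^{-1}$, $v=x^{-2}y$, and let $\mathcal A=\bigoplus_{i=2}^n H^0(\mathbb P^1,\mathcal O(2i))$ be the base of the Hitchin fibration $(E,\varphi)\mapsto\det(y-\varphi)$ for $SL_n$-Higgs bundles with values in $\mathcal O(2)$. For $\alpha\in\mathcal A$ the spectral curve is the closed subscheme $y^n+\alpha_2y^{n-2}+\dots+\alpha_n=0$ of $\mathrm{Tot}(\mathcal O(2))$. There are $a,b\in\mathcal A$ with $b\neq 0$ such that the family $\mathcal C\to\mathbb A^1$ of spectral curves $C_t$ over the line $t\mapsto a+tb$ in $\mathcal A$ has the following properties. $\mathcal C$ is a closed subscheme of $\mathrm{Tot}(\mathcal O(2))\times\mathbb A^1$, given in the chart with coordinates $x,y$ by $y^n=tx^n+x^{n+1}$. For every $t\in\mathbb C$: 1. $C_t$, the spectral curve of the point $a+tb$, is the scheme-theoretic fibre of $\mathcal C$ over $t$; it is a closed subscheme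 of $\mathrm{Tot}(\mathcal O(2))$, it is integral (in particular irreducible), and $a+tb$ lies in the image of the Hitchin map. 2. Let $p$ be the point $z=v=0$ and $q$ the point $x=y=0$ of $\mathrm{Tot}(\mathcal O(2))$. Both lie on $C_t$, for every $t$. If $n\ge 3$, the singular points of $C_t$ are exactly $p$ and $q$; if $n=2$, the only singular point is $q$. 3. At $p$ the curve $C_t$ has the local equation $y^n=z^{n-1}$, independently of $t$ (for $n=2$ this is a smooth point): the completed local ring is isomorphic to $\mathbb C[[z,y]]/(y^n-z^{n-1})$ as a $\mathbb C$-algebra. 4. At $q$ the curve $C_t$ has, in the same sense, the local equation $y^n=tx^n+x^{n+1}$. For $t\ne 0$ this singularity is isomorphic to $y^n=x^n$, and for $t=0$ it is $y^n=x^{n+1}$; so the family degenerates the singularity $y^n=x^n$ into $y^n=x^{n+1}$. -/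

import Mathlib

open CategoryTheory CategoryTheory.Limits AlgebraicGeometry
open scoped Polynomial LaurentPolynomial

namespace SpectralFamily

noncomputable section

/-! ### Gluing along standard open immersions -/

theorem isOpenImmersion_SpecMap {A B : Type} [CommRing A] [CommRing B] (f : A →+* B)
    (hf : f.IsStandardOpenImmersion) : IsOpenImmersion (Spec.map (CommRingCat.ofHom f)) := by
  let := f.toAlgebra
  obtain ⟨r, hr⟩ := hf.toAlgebra
  exact IsOpenImmersion.of_isLocalization (S := B) r

theorem quotientMap_isStandardOpenImmersion {A B : Type} [CommRing A] [CommRing B] (f : A →+* B)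
    (hf : f.IsStandardOpenImmersion) (I : Ideal A) (J : Ideal B) (h : I.map f = J) :
    (Ideal.quotientMap J f (Ideal.map_le_iff_le_comap.1 h.le)).IsStandardOpenImmersion := by
  let := f.toAlgebra
  obtain ⟨r, hr⟩ := hf.toAlgebra
  let := (Ideal.quotientMap J f (Ideal.map_le_iff_le_comap.1 h.le)).toAlgebra
  refine ⟨Ideal.Quotient.mk I r, ?_⟩
  simp only [IsLocalization.Away, ← Submonoid.map_powers]
  refine IsLocalization.of_surjective _ _ _ Ideal.Quotient.mk_surjective (Ideal.Quotient.mk J)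
    Ideal.Quotient.mk_surjective ?_ ?_
  · simp [RingHom.algebraMap_toAlgebra, Ideal.quotientMap_comp_mk]
  · simp only [Ideal.mk_ker, RingHom.algebraMap_toAlgebra, h, le_refl]

/-! ### The total space of `O(2)` on the projective line -/

section TotalSpace

variable (R : Type) [CommRing R]

/-- Restriction of functions from the chart `Spec R[x][u]` to the overlap
`Spec R[T;T⁻¹][u]`: `x ↦ T`, `u ↦ u`. -/
def chartHom₀ : R[X][X] →+* R[T;T⁻¹][X] :=
  Polynomial.mapRingHom Polynomial.toLaurent

/-- Restriction of functions from the chart `Spec R[z][v]` at infinity to the overlap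
`Spec R[T;T⁻¹][u]`: `z ↦ T⁻¹`, `v ↦ T⁻² u`. -/
def chartHom₁ : R[X][X] →+* R[T;T⁻¹][X] :=
  Polynomial.eval₂RingHom
    (Polynomial.C.comp ((LaurentPolynomial.invert (R := R) : R[T;T⁻¹] →+* R[T;T⁻¹]).comp
      Polynomial.toLaurent))
    (Polynomial.C (LaurentPolynomial.T (-2)) * Polynomial.X)

/-- The coordinate change `T ↦ T⁻¹`, `u ↦ T⁻² u` on the overlap. -/
def overlapHom : R[T;T⁻¹][X] →+* R[T;T⁻¹][X] :=
  Polynomial.eval₂RingHom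
    (Polynomial.C.comp (LaurentPolynomial.invert (R := R) : R[T;T⁻¹] →+* R[T;T⁻¹]))
    (Polynomial.C (LaurentPolynomial.T (-2)) * Polynomial.X)

theorem overlapHom_overlapHom (p : R[T;T⁻¹][X]) : overlapHom R (overlapHom R p) = p := by
  have : (overlapHom R).comp (overlapHom R) = RingHom.id _ := by
    apply Polynomial.ringHom_ext
    · intro a
      simp [overlapHom, LaurentPolynomial.involutive_invert a]
    · have h : (LaurentPolynomial.T 2 : R[T;T⁻¹]) * LaurentPolynomial.T (-2) = 1 := by
        rw [← LaurentPolynomial.T_add]; simp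
      have h' := congrArg (Polynomial.C (R := R[T;T⁻¹])) h
      rw [map_mul, map_one] at h'
      simp [overlapHom, ← mul_assoc, h']
  exact congr($this p)

theorem chartHom₁_eq : chartHom₁ R = (overlapHom R).comp (chartHom₀ R) := by
  apply Polynomial.ringHom_ext
  · intro a
    simp [overlapHom, chartHom₀, chartHom₁]
  · simp [overlapHom, chartHom₀, chartHom₁]

theorem chartHom₀_isStandardOpenImmersion : (chartHom₀ R).IsStandardOpenImmersion := by
  let : Algebra R[X][X] R[T;T⁻¹][X] := Polynomial.algebra R[X] R[T;T⁻¹]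
  have h := Polynomial.isLocalization (Submonoid.powers (Polynomial.X : R[X])) R[T;T⁻¹]
  rw [Submonoid.map_powers] at h
  exact ⟨_, h⟩

theorem chartHom₁_isStandardOpenImmersion : (chartHom₁ R).IsStandardOpenImmersion := by
  rw [chartHom₁_eq]
  refine (chartHom₀_isStandardOpenImmersion R).comp (.of_bijective ?_)
  exact (Function.Involutive.bijective (overlapHom_overlapHom R))

instance : IsOpenImmersion (Spec.map (CommRingCat.ofHom (chartHom₀ R))) :=
  isOpenImmersion_SpecMap _ (chartHom₀_isStandardOpenImmersion R)

instance : IsOpenImmersion (Spec.map (CommRingCat.ofHom (chartHom₁ R))) :=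
  isOpenImmersion_SpecMap _ (chartHom₁_isStandardOpenImmersion R)

/-- `Tot(O(2))` over the projective line over `R`: the gluing of two affine planes
`Spec R[x][u]` and `Spec R[z][v]` along `x ≠ 0`, `z ≠ 0` by `z = x⁻¹`, `v = x⁻² u`. -/
def Tot : Scheme.{0} :=
  pushout (Spec.map (CommRingCat.ofHom (chartHom₀ R))) (Spec.map (CommRingCat.ofHom (chartHom₁ R)))

/-- The standard chart with coordinates `x`, `u`. -/
def Tot.chart₀ : Spec (CommRingCat.of R[X][X]) ⟶ Tot R := pushout.inl _ _

/-- The standard chart at infinity, with coordinates `z = x⁻¹`, `v = x⁻² u`. -/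
def Tot.chart₁ : Spec (CommRingCat.of R[X][X]) ⟶ Tot R := pushout.inr _ _

theorem Tot.chart_condition :
    Spec.map (CommRingCat.ofHom (chartHom₀ R)) ≫ Tot.chart₀ R =
      Spec.map (CommRingCat.ofHom (chartHom₁ R)) ≫ Tot.chart₁ R := pushout.condition

instance : IsOpenImmersion (Tot.chart₀ R) :=
  inferInstanceAs (IsOpenImmersion (colimit.ι (span _ _) WalkingSpan.left))

instance : IsOpenImmersion (Tot.chart₁ R) :=
  inferInstanceAs (IsOpenImmersion (colimit.ι (span _ _) WalkingSpan.right))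

theorem chartHom₀_comp_C : (chartHom₀ R).comp (Polynomial.C.comp Polynomial.C) =
    (chartHom₁ R).comp (Polynomial.C.comp Polynomial.C) := by
  ext a; simp [chartHom₀, chartHom₁]

/-- The structure morphism of `Tot(O(2))`. -/
def Tot.toBase : Tot R ⟶ Spec (CommRingCat.of R) :=
  pushout.desc
    (Spec.map (CommRingCat.ofHom (Polynomial.C.comp Polynomial.C)))
    (Spec.map (CommRingCat.ofHom (Polynomial.C.comp Polynomial.C)))
    (by simp only [← Spec.map_comp, ← CommRingCat.ofHom_comp, chartHom₀_comp_C])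

variable {R}

/-- Base change of Laurent polynomials. -/
def laurentMap {S : Type} [CommRing S] (f : R →+* S) : R[T;T⁻¹] →+* S[T;T⁻¹] :=
  AddMonoidAlgebra.mapRingHom ℤ f

theorem laurentMap_C {S : Type} [CommRing S] (f : R →+* S) (a : R) :
    laurentMap f (LaurentPolynomial.C a) = LaurentPolynomial.C (f a) := by
  exact AddMonoidAlgebra.mapRingHom_single ..

theorem laurentMap_T {S : Type} [CommRing S] (f : R →+* S) (k : ℤ) :
    laurentMap f (LaurentPolynomial.T k) = LaurentPolynomial.T k := by
  exact (AddMonoidAlgebra.mapRingHom_single ..).trans (by rw [map_one]; rfl)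

theorem laurentMap_toLaurent {S : Type} [CommRing S] (f : R →+* S) (p : R[X]) :
    laurentMap f p.toLaurent = (p.map f).toLaurent := by
  induction p using Polynomial.induction_on' with
  | add p q hp hq => simp [hp, hq]
  | monomial k a =>
    simp [← Polynomial.C_mul_X_pow_eq_monomial, laurentMap_C, laurentMap_T,
      Polynomial.toLaurent_X_pow]

theorem laurentMap_invert {S : Type} [CommRing S] (f : R →+* S) (p : R[T;T⁻¹]) :
    laurentMap f (LaurentPolynomial.invert p) = LaurentPolynomial.invert (laurentMap f p) := by
  induction p using LaurentPolynomial.induction_on' with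
  | add p q hp hq => simp [hp, hq]
  | C_mul_T k a => simp [laurentMap_C, laurentMap_T]

theorem chartHom₀_map {S : Type} [CommRing S] (f : R →+* S) :
    (chartHom₀ S).comp (Polynomial.mapRingHom (Polynomial.mapRingHom f)) =
      (Polynomial.mapRingHom (laurentMap f)).comp (chartHom₀ R) := by
  apply Polynomial.ringHom_ext
  · intro a; simp [chartHom₀, laurentMap_toLaurent]
  · simp [chartHom₀]

theorem chartHom₁_map {S : Type} [CommRing S] (f : R →+* S) :
    (chartHom₁ S).comp (Polynomial.mapRingHom (Polynomial.mapRingHom f)) =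
      (Polynomial.mapRingHom (laurentMap f)).comp (chartHom₁ R) := by
  apply Polynomial.ringHom_ext
  · intro a; simp [chartHom₁, laurentMap_toLaurent, laurentMap_invert]
  · simp [chartHom₁, laurentMap_T]

/-- The morphism `Tot(O(2))_S ⟶ Tot(O(2))_R` induced by a ring homomorphism `R → S`. -/
def Tot.baseChange {S : Type} [CommRing S] (f : R →+* S) : Tot S ⟶ Tot R :=
  pushout.desc
    (Spec.map (CommRingCat.ofHom (Polynomial.mapRingHom (Polynomial.mapRingHom f))) ≫ Tot.chart₀ R)
    (Spec.map (CommRingCat.ofHom (Polynomial.mapRingHom (Polynomial.mapRingHom f))) ≫ Tot.chart₁ R)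
    (by
      simp only [← Category.assoc, ← Spec.map_comp, ← CommRingCat.ofHom_comp, chartHom₀_map,
        chartHom₁_map]
      simp only [CommRingCat.ofHom_comp, Spec.map_comp, Category.assoc, Tot.chart_condition])

/-- The inclusion of the closed subscheme `f(x, u) = 0` in the affine plane `Spec R[x][u]`. -/
def planeCurve (f : R[X][X]) :
    Spec (CommRingCat.of (R[X][X] ⧸ Ideal.span {f})) ⟶ Spec (CommRingCat.of R[X][X]) :=
  Spec.map (CommRingCat.ofHom (S := R[X][X] ⧸ Ideal.span {f}) (Ideal.Quotient.mk (Ideal.span {f})))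

/-- The polynomial `u^n - (τ x^n + x^(n+1))` in the coordinates `x`, `u`. -/
def degenerationEqn (n : ℕ) (τ : R) : R[X][X] :=
  Polynomial.X ^ n -
    Polynomial.C (Polynomial.C τ * Polynomial.X ^ n + Polynomial.X ^ (n + 1))

/-- The origin of the affine plane `Spec K[x][u]` over a field. -/
def origin (K : Type) [Field K] : Spec (CommRingCat.of K[X][X]) :=
  Spec.map (CommRingCat.ofHom
    ((Polynomial.evalRingHom (0 : K)).comp (Polynomial.evalRingHom (0 : K[X]))))
    (IsLocalRing.closedPoint K)

end TotalSpace

/-! ### The Hitchin base -/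

section HitchinBase

/-- `H⁰(ℙ¹, O(d))` over `R`: pairs of functions `p(x)`, `q(z)` on the two standard charts of the
projective line which satisfy `p(x) = x^d q(x⁻¹)` on the overlap. -/
def sectionsO (R : Type) [CommRing R] (d : ℕ) : Submodule R (R[X] × R[X]) where
  carrier := {s | s.1.toLaurent = LaurentPolynomial.T d * LaurentPolynomial.invert s.2.toLaurent}
  add_mem' {s t} hs ht := by
    simp only [Set.mem_ofPred_eq] at hs ht ⊢
    simp [hs, ht, mul_add]
  zero_mem' := by simp
  smul_mem' c s hs := by
    simp only [Set.mem_ofPred_eq] at hs ⊢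
    simp [Polynomial.smul_eq_C_mul, hs]
    ring

/-- The Hitchin base `⨁_{i = 2}^n H⁰(ℙ¹, O(2)^{⊗ i})` for the group `SL_n` and the line bundle
`O(2)` on the projective line over `R`. -/
abbrev HitchinBase (n : ℕ) (R : Type) [CommRing R] : Type :=
  (i : Set.Icc 2 n) → sectionsO R (2 * i)

variable {R : Type} [CommRing R] {n : ℕ}

theorem map_mem_sectionsO {S : Type} [CommRing S] (f : R →+* S) (d : ℕ) (s : sectionsO R d) :
    (s.1.1.map f, s.1.2.map f) ∈ sectionsO S d := by
  have h : s.1.1.toLaurent =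
    LaurentPolynomial.T d * LaurentPolynomial.invert s.1.2.toLaurent := s.2
  change (s.1.1.map f).toLaurent =
    LaurentPolynomial.T d * LaurentPolynomial.invert (s.1.2.map f).toLaurent
  rw [← laurentMap_toLaurent, h, map_mul, laurentMap_T, laurentMap_invert, laurentMap_toLaurent]

/-- Base change of points of the Hitchin base. -/
def HitchinBase.map {S : Type} [CommRing S] (f : R →+* S) (a : HitchinBase n R) :
    HitchinBase n S :=
  fun i => ⟨((a i).1.1.map f, (a i).1.2.map f), map_mem_sectionsO f _ (a i)⟩

/-- The line through `a` with direction `b` in the Hitchin base, as a morphism from the affine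
line `Spec R[t]` to the Hitchin base, that is, as an `R[t]`-valued point `a + t b`. -/
def HitchinBase.line (a b : HitchinBase n R) : HitchinBase n R[X] :=
  a.map Polynomial.C + (Polynomial.X : R[X]) • b.map Polynomial.C

/-- The left hand side `u^n + a_2(x) u^(n-2) + ⋯ + a_n(x)` of the equation of the spectral curve
in the chart with coordinates `x`, `u`. -/
def HitchinBase.eqn₀ (a : HitchinBase n R) : R[X][X] :=
  Polynomial.X ^ n + ∑ i : Set.Icc 2 n, Polynomial.C (a i).1.1 * Polynomial.X ^ (n - i)

/-- The left hand side `v^n + a_2(z) v^(n-2) + ⋯ + a_n(z)` of the equation of the spectral curve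
in the chart at infinity with coordinates `z`, `v`. -/
def HitchinBase.eqn₁ (a : HitchinBase n R) : R[X][X] :=
  Polynomial.X ^ n + ∑ i : Set.Icc 2 n, Polynomial.C (a i).1.2 * Polynomial.X ^ (n - i)

theorem chartHom₀_C_mul_X_pow (p : R[X]) (k : ℕ) :
    chartHom₀ R (Polynomial.C p * Polynomial.X ^ k) =
      Polynomial.C p.toLaurent * Polynomial.X ^ k := by
  simp [chartHom₀]

theorem chartHom₁_C_mul_X_pow (p : R[X]) (k : ℕ) :
    chartHom₁ R (Polynomial.C p * Polynomial.X ^ k) =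
      Polynomial.C (LaurentPolynomial.invert p.toLaurent * LaurentPolynomial.T (-2 * k)) *
        Polynomial.X ^ k := by
  have h : (LaurentPolynomial.T (-2 * k) : R[T;T⁻¹]) = LaurentPolynomial.T (-2) ^ k := by
    rw [LaurentPolynomial.T_pow, mul_comm]
  rw [h, map_mul, map_pow, map_mul, map_pow, mul_assoc, ← mul_pow]
  simp [chartHom₁]

theorem sectionsO_mul_T (i : ℕ) (hi : i ≤ n) (s : sectionsO R (2 * i)) :
    LaurentPolynomial.T (2 * n) *
      (LaurentPolynomial.invert s.1.2.toLaurent * LaurentPolynomial.T (-2 * (n - i : ℕ))) =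
    s.1.1.toLaurent := by
  have h : s.1.1.toLaurent =
    LaurentPolynomial.T (2 * i : ℕ) * LaurentPolynomial.invert s.1.2.toLaurent := s.2
  have hT : (LaurentPolynomial.T (2 * i : ℕ) : R[T;T⁻¹]) =
      LaurentPolynomial.T (2 * n) * LaurentPolynomial.T (-2 * (n - i : ℕ)) := by
    rw [← LaurentPolynomial.T_add, Nat.cast_sub hi]
    congr 1; push_cast; ring
  rw [h, hT]
  ring

/-- The two equations of the spectral curve differ by a unit on the overlap. -/
theorem HitchinBase.chartHom₁_eqn₁ (a : HitchinBase n R) :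
    Polynomial.C (LaurentPolynomial.T (2 * n)) * chartHom₁ R a.eqn₁ = chartHom₀ R a.eqn₀ := by
  have hn : (Polynomial.X ^ n : R[X][X]) = Polynomial.C 1 * Polynomial.X ^ n := by simp
  have hT : (LaurentPolynomial.T (2 * n) : R[T;T⁻¹]) * LaurentPolynomial.T (-2 * n) = 1 := by
    rw [← LaurentPolynomial.T_add]; simp
  rw [eqn₀, eqn₁, hn, map_add, map_add, map_sum, map_sum, mul_add, Finset.mul_sum,
    chartHom₀_C_mul_X_pow, chartHom₁_C_mul_X_pow]
  congr 1
  · rw [← mul_assoc, ← map_mul, map_one, map_one, one_mul, hT]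
  · refine Finset.sum_congr rfl fun i _ => ?_
    rw [chartHom₀_C_mul_X_pow, chartHom₁_C_mul_X_pow, ← mul_assoc, ← map_mul,
      sectionsO_mul_T (i : ℕ) i.2.2]

end HitchinBase

/-! ### Spectral curves -/

section SpectralCurve

variable {R : Type} [CommRing R] {n : ℕ} (a : HitchinBase n R)

/-- Coordinate ring of the part of the spectral curve in the chart with coordinates `x`, `u`. -/
abbrev Coord₀ : Type := R[X][X] ⧸ Ideal.span {a.eqn₀}

/-- Coordinate ring of the part of the spectral curve in the chart at infinity. -/
abbrev Coord₁ : Type := R[X][X] ⧸ Ideal.span {a.eqn₁}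

/-- Coordinate ring of the part of the spectral curve over the overlap. -/
abbrev Coord₀₁ : Type := R[T;T⁻¹][X] ⧸ Ideal.span {chartHom₀ R a.eqn₀}

theorem map_span_eqn₀ :
    (Ideal.span {a.eqn₀}).map (chartHom₀ R) = Ideal.span {chartHom₀ R a.eqn₀} := by
  rw [Ideal.map_span, Set.image_singleton]

theorem map_span_eqn₁ :
    (Ideal.span {a.eqn₁}).map (chartHom₁ R) = Ideal.span {chartHom₀ R a.eqn₀} := by
  rw [Ideal.map_span, Set.image_singleton, ← a.chartHom₁_eqn₁]
  exact (Ideal.span_singleton_mul_left_unit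
    ((LaurentPolynomial.isUnit_T (2 * n : ℤ)).map Polynomial.C) _).symm

/-- Restriction of functions from the first chart of the spectral curve to the overlap. -/
def coordHom₀ : Coord₀ a →+* Coord₀₁ a :=
  Ideal.quotientMap _ (chartHom₀ R) (Ideal.map_le_iff_le_comap.1 (map_span_eqn₀ a).le)

/-- Restriction of functions from the second chart of the spectral curve to the overlap. -/
def coordHom₁ : Coord₁ a →+* Coord₀₁ a :=
  Ideal.quotientMap _ (chartHom₁ R) (Ideal.map_le_iff_le_comap.1 (map_span_eqn₁ a).le)

instance : IsOpenImmersion (Spec.map (CommRingCat.ofHom (R := Coord₀ a) (S := Coord₀₁ a) (coordHom₀ a))) :=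
  isOpenImmersion_SpecMap _ (quotientMap_isStandardOpenImmersion _
    (chartHom₀_isStandardOpenImmersion R) _ _ (map_span_eqn₀ a))

instance : IsOpenImmersion (Spec.map (CommRingCat.ofHom (R := Coord₁ a) (S := Coord₀₁ a) (coordHom₁ a))) :=
  isOpenImmersion_SpecMap _ (quotientMap_isStandardOpenImmersion _
    (chartHom₁_isStandardOpenImmersion R) _ _ (map_span_eqn₁ a))

/-- The spectral curve of an `R`-valued point `a` of the Hitchin base, that is, the closed
subscheme `y^n + a_2 y^(n-2) + ⋯ + a_n = 0` of `Tot(O(2))` (`y` the tautological section of the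
pull-back of `O(2)`), glued from its parts in the two standard charts. -/
def spectralCurve : Scheme.{0} :=
  pushout (Spec.map (CommRingCat.ofHom (R := Coord₀ a) (S := Coord₀₁ a) (coordHom₀ a))) (Spec.map (CommRingCat.ofHom (R := Coord₁ a) (S := Coord₀₁ a) (coordHom₁ a)))

/-- The inclusion of the spectral curve in `Tot(O(2))`. -/
def spectralCurve.ι : spectralCurve a ⟶ Tot R :=
  pushout.desc
    (Spec.map (CommRingCat.ofHom (S := Coord₀ a) (Ideal.Quotient.mk (Ideal.span {a.eqn₀}))) ≫ Tot.chart₀ R)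
    (Spec.map (CommRingCat.ofHom (S := Coord₁ a) (Ideal.Quotient.mk (Ideal.span {a.eqn₁}))) ≫ Tot.chart₁ R)
    (by
      simp only [← Category.assoc, ← Spec.map_comp, ← CommRingCat.ofHom_comp, coordHom₀, coordHom₁,
        Ideal.quotientMap_comp_mk]
      simp only [CommRingCat.ofHom_comp, Spec.map_comp, Category.assoc, Tot.chart_condition])

/-- The structure morphism of the spectral curve. -/
def spectralCurve.toBase : spectralCurve a ⟶ Spec (CommRingCat.of R) :=
  spectralCurve.ι a ≫ Tot.toBase R

end SpectralCurve

/-! ### Higgs bundles and the Hitchin map -/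

section Higgs

/-- An `SL_n`-Higgs bundle with values in `O(2)` on the projective line over `R`, given by a
transition matrix `g` of determinant one between trivialisations on the two standard charts and by
trace-free matrices `φ₀(x)`, `φ₁(z)` with `φ₀ = T² g φ₁ g⁻¹` on the overlap. Over a field
every `SL_n`-bundle on the affine line is trivial, so that every Higgs bundle is of this form. -/
structure HiggsBundle (n : ℕ) (R : Type) [CommRing R] where
  g : Matrix.SpecialLinearGroup (Fin n) R[T;T⁻¹]
  φ₀ : Matrix (Fin n) (Fin n) R[X]
  φ₁ : Matrix (Fin n) (Fin n) R[X]
  trace_φ₀ : φ₀.trace = 0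
  trace_φ₁ : φ₁.trace = 0
  compat : φ₀.map Polynomial.toLaurent =
    (LaurentPolynomial.T 2 : R[T;T⁻¹]) •
      ((g : Matrix (Fin n) (Fin n) R[T;T⁻¹]) *
        φ₁.map (fun p => LaurentPolynomial.invert p.toLaurent) *
        ((g⁻¹ : Matrix.SpecialLinearGroup (Fin n) R[T;T⁻¹]) : Matrix (Fin n) (Fin n) R[T;T⁻¹]))

theorem charpoly_smul_coeff {S : Type} [CommRing S] {n : ℕ} (c : S)
    (M : Matrix (Fin n) (Fin n) S) (i : ℕ) (hi : i ≤ n) :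
    (c • M).charpoly.coeff (n - i) = c ^ i * M.charpoly.coeff (n - i) := by
  have h1 := (c • M).charpoly_coeff_eq_sum_minors i (by simpa using hi)
  have h2 := M.charpoly_coeff_eq_sum_minors i (by simpa using hi)
  rw [Fintype.card_fin] at h1 h2
  rw [h1, h2, mul_left_comm]
  congr 1
  rw [Finset.mul_sum]
  refine (Finset.sum_congr rfl fun (s : Finset (Fin n)) hs => ?_)
  have hc : (c • M).submatrix (Subtype.val : s → Fin n) (Subtype.val : s → Fin n) =
    c • M.submatrix Subtype.val Subtype.val := rfl
  rw [hc, Matrix.det_smul, Fintype.card_coe, (Finset.mem_powersetCard.mp hs).2]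

variable {R : Type} [CommRing R] {n : ℕ}

theorem HiggsBundle.coeff_mem (E : HiggsBundle n R) (i : ℕ) (hi : i ≤ n) :
    (E.φ₀.charpoly.coeff (n - i), E.φ₁.charpoly.coeff (n - i)) ∈ sectionsO R (2 * i) := by
  change (E.φ₀.charpoly.coeff (n - i)).toLaurent = LaurentPolynomial.T (2 * i : ℕ) *
    LaurentPolynomial.invert (E.φ₁.charpoly.coeff (n - i)).toLaurent
  have h₀ : (E.φ₀.charpoly.coeff (n - i)).toLaurent =
      (E.φ₀.map Polynomial.toLaurent).charpoly.coeff (n - i) := by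
    rw [Matrix.charpoly_map, Polynomial.coeff_map]
  have h₁ : LaurentPolynomial.invert (E.φ₁.charpoly.coeff (n - i)).toLaurent =
      (E.φ₁.map (fun p => LaurentPolynomial.invert p.toLaurent)).charpoly.coeff (n - i) := by
    have := Matrix.charpoly_map E.φ₁
      ((LaurentPolynomial.invert (R := R) : R[T;T⁻¹] →+* R[T;T⁻¹]).comp Polynomial.toLaurent)
    have h := congrArg (fun p => p.coeff (n - i)) this
    rw [Polynomial.coeff_map] at h
    exact h.symm
  have hconj : ((E.g : Matrix (Fin n) (Fin n) R[T;T⁻¹]) *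
        E.φ₁.map (fun p => LaurentPolynomial.invert p.toLaurent) *
        ((E.g⁻¹ : Matrix.SpecialLinearGroup (Fin n) R[T;T⁻¹]) :
          Matrix (Fin n) (Fin n) R[T;T⁻¹])).charpoly =
      (E.φ₁.map (fun p => LaurentPolynomial.invert p.toLaurent)).charpoly := by
    rw [Matrix.charpoly_mul_comm, ← mul_assoc, ← Matrix.SpecialLinearGroup.coe_mul]
    simp
  rw [h₀, h₁, E.compat, charpoly_smul_coeff _ _ _ hi, hconj, LaurentPolynomial.T_pow]
  congr 2
  push_cast; ring

/-- The Hitchin map: a Higgs bundle `(E, φ)` is sent to the coefficients of the characteristic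
polynomial `det(y - φ) = y^n + a_2 y^(n-2) + ⋯ + a_n`. -/
def HiggsBundle.hitchinMap (E : HiggsBundle n R) : HitchinBase n R :=
  fun i => ⟨(E.φ₀.charpoly.coeff (n - i), E.φ₁.charpoly.coeff (n - i)), E.coeff_mem i i.2.2⟩

theorem charpoly_eq_of_trace {S : Type} [CommRing S] (M : Matrix (Fin n) (Fin n) S)
    (hM : M.trace = 0) :
    M.charpoly = Polynomial.X ^ n +
      ∑ i : Set.Icc 2 n, Polynomial.C (M.charpoly.coeff (n - i)) * Polynomial.X ^ (n - i : ℕ) := by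
  nontriviality S
  have hdeg : M.charpoly.natDegree = n := by simp
  have hs : ∑ i : Set.Icc 2 n, Polynomial.C (M.charpoly.coeff (n - i)) *
        (Polynomial.X : S[X]) ^ (n - i : ℕ) =
      ∑ i ∈ Finset.Icc 2 n, Polynomial.C (M.charpoly.coeff (n - i)) * Polynomial.X ^ (n - i) := by
    rw [← Finset.sum_subtype (p := fun i => i ∈ Set.Icc 2 n) (Finset.Icc 2 n) (by simp)
      (fun i => Polynomial.C (M.charpoly.coeff (n - i)) * (Polynomial.X : S[X]) ^ (n - i))]
  rw [hs]
  ext k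
  simp only [Polynomial.coeff_add, Polynomial.coeff_X_pow, Polynomial.finsetSum_coeff,
    Polynomial.coeff_C_mul]
  rcases lt_trichotomy k n with hk | rfl | hk
  · rw [if_neg hk.ne, zero_add]
    by_cases hk1 : k + 1 = n
    · have hne : Nonempty (Fin n) := ⟨⟨0, by omega⟩⟩
      have ht := M.trace_eq_neg_charpoly_coeff
      rw [hM, Fintype.card_fin, show n - 1 = k by omega] at ht
      rw [show M.charpoly.coeff k = 0 by simpa using ht.symm]
      refine (Finset.sum_eq_zero fun i hi => ?_).symm
      rw [Finset.mem_Icc] at hi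
      rw [if_neg (by omega), mul_zero]
    · rw [Finset.sum_eq_single (n - k)]
      · rw [show n - (n - k) = k by omega]; simp
      · intro i hi hne
        rw [Finset.mem_Icc] at hi
        rw [if_neg (by omega), mul_zero]
      · intro h
        rw [Finset.mem_Icc] at h
        omega
  · rw [if_pos rfl, Finset.sum_eq_zero, add_zero]
    · have := M.charpoly_monic.coeff_natDegree
      rwa [hdeg] at this
    · intro i hi
      rw [Finset.mem_Icc] at hi
      rw [if_neg (by omega), mul_zero]
  · rw [if_neg hk.ne', Finset.sum_eq_zero, add_zero]
    · exact Polynomial.coeff_eq_zero_of_natDegree_lt (by omega)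
    · intro i hi
      rw [if_neg (by omega), mul_zero]

/-- The spectral curve of the image of `(E, φ)` in the Hitchin base is `det(y - φ) = 0`. -/
theorem HiggsBundle.eqn₀_hitchinMap (E : HiggsBundle n R) : E.hitchinMap.eqn₀ = E.φ₀.charpoly :=
  (charpoly_eq_of_trace E.φ₀ E.trace_φ₀).symm

theorem HiggsBundle.eqn₁_hitchinMap (E : HiggsBundle n R) : E.hitchinMap.eqn₁ = E.φ₁.charpoly :=
  (charpoly_eq_of_trace E.φ₁ E.trace_φ₁).symm

end Higgs

/-! ### Local equations of plane curve singularities -/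

section Singularities

/-- The structure homomorphism from `ℂ` to the local ring of a `ℂ`-scheme at a point. -/
def constants {C : Scheme.{0}} (s : C ⟶ Spec (CommRingCat.of ℂ)) (p : C) :
    ℂ →+* C.presheaf.stalk p :=
  ((Scheme.ΓSpecIso (CommRingCat.of ℂ)).inv ≫ s.appTop ≫ C.presheaf.germ ⊤ p trivial).hom

/-- The point `p` of the `ℂ`-scheme `C` has (formal) local equation `f = 0`: the completed local
ring of `C` at `p` is isomorphic to `ℂ⟦x, y⟧ / (f)` as a `ℂ`-algebra. -/
def HasLocalEquation {C : Scheme.{0}} (s : C ⟶ Spec (CommRingCat.of ℂ)) (p : C)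
    (f : MvPowerSeries (Fin 2) ℂ) : Prop :=
  ∃ e : AdicCompletion (IsLocalRing.maximalIdeal (C.presheaf.stalk p)) (C.presheaf.stalk p) ≃+*
      (MvPowerSeries (Fin 2) ℂ ⧸ Ideal.span {f}),
    ∀ c : ℂ, e (algebraMap _ _ (constants s p c)) = algebraMap ℂ _ c

/-- The point `p` of `C` is singular: the local ring at `p` is not regular. -/
def IsSingularPoint (C : Scheme.{0}) (p : C) : Prop :=
  ¬ IsRegularLocalRing (C.presheaf.stalk p)

end Singularities

end

end SpectralFamily

open SpectralFamily

/-!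
The points of the Hitchin base are supported in degree `n`: `a` has the component `-x^(n+1)`
(at infinity `-z^(n-1)`) and `b` the component `-x^n` (at infinity `-z^n`). The curve over `a + t b`
is therefore `y^n = t x^n + x^(n+1)` in the first chart and `v^n = t z^n + z^(n-1)` in the second,
and `z = 0` forces `v = 0`, so that the second chart adds the single point `p` to the first one.

*The curve and the family.* A spectral curve is glued from two plane curves in the same way as
`Tot(O(2))` is glued from two planes, and the gluing reflects the overlap
(`mem_range_SpecMap_of_surjective`). Hence the squares formed by the charts are cartesian, and the
closed immersion into `Tot(O(2))` and the description of the fibres of the family reduce to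
quotients of polynomial rings (`spectralCurve.isClosedImmersion_ι`,
`spectralCurve.isPullback_baseChange`). The point `a + t b` is the image of the Higgs bundle
`O(n-1) ⊕ O(n-3) ⊕ ⋯ ⊕ O(1-n)` with the companion matrices of the two equations as Higgs field
(`hitchinMap_cyclicHiggsBundle`).

*Integrality.* The ideal of the first chart is the kernel of the parametrization `x = w^n - t`,
`y = w (w^n - t)` with values in `K[w]` (`span_eq_ker_parametrization`): modulo the equation a
polynomial is `∑ i < n, hᵢ(x) y^i`, and its image vanishes only if all `hᵢ` do, since
`1, w, …, w^(n-1)` are independent over `K[x]`. So this ideal is prime, it remains prime on the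
overlap, and the ideal of the second chart is its contraction (`comap_chartHom₁_span`).

*Local equations.* The completed local ring at the origin of a plane curve `F = 0` is the quotient
of the ring of formal power series by the Taylor expansion of `F` (`exists_completion_equiv`). An
equation `y^n = (c + d x) x^m` with `c ≠ 0` becomes `y^n = x^m` after the substitution
`y ↦ u(x) y`, where `u^n = c + d x` is provided by the binomial series
(`exists_quotient_algEquiv_of_linear`). At `p` this applies with `c + d x = 1 + t z`, and at `q`,
for `t ≠ 0`, with `c + d x = t + x`.

*Singular points.* The local rings are domains of dimension at most one, so that they are regular
exactly when the maximal ideal is principal (`isRegularLocalRing_iff_isPrincipal`). On a curve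
`y^n = g(x)` it is generated by `x - α` at a point `(α, β)` with `β ≠ 0`, and by `y` at a simple
zero of `g` (`isPrincipal_of_ne_zero`, `isPrincipal_of_eval_ne_zero`). If the equation has no terms of
order less than two it is not principal, because `x` and `y` are independent modulo terms of order
two (`not_isPrincipal_maximalIdeal`). The zeros of `t x^n + x^(n+1)` other than the origin are
simple, and at infinity `z^(n-1)` has order at least two if and only if `n ≥ 3`.
-/

namespace SpectralFamily

noncomputable section

/-! ### Gluing two schemes along an open subscheme -/

section Gluing

variable {U V W U' V' W' : Scheme.{0}} (f : W ⟶ U) (g : W ⟶ V) (f' : W' ⟶ U') (g' : W' ⟶ V')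
  [IsOpenImmersion f] [IsOpenImmersion g] [IsOpenImmersion f'] [IsOpenImmersion g']

instance isOpenImmersion_pushout_inl : IsOpenImmersion (pushout.inl f g) :=
  inferInstanceAs (IsOpenImmersion (colimit.ι (span _ _) WalkingSpan.left))

instance isOpenImmersion_pushout_inr : IsOpenImmersion (pushout.inr f g) :=
  inferInstanceAs (IsOpenImmersion (colimit.ι (span _ _) WalkingSpan.right))

theorem pushout_mem_range_or (x : ↥(pushout f g)) :
    x ∈ Set.range (pushout.inl f g) ∨ x ∈ Set.range (pushout.inr f g) := by
  obtain ⟨i, y, hy⟩ := (Scheme.IsLocallyDirected.openCover (span f g)).exists_eq x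
  match i, y, hy with
  | none, y, hy =>
    refine .inl ⟨(span f g).map WalkingSpan.Hom.fst y, ?_⟩
    exact congr($(colimit.w (span f g) WalkingSpan.Hom.fst) y).trans hy
  | some .left, y, hy => exact .inl ⟨y, hy⟩
  | some .right, y, hy => exact .inr ⟨y, hy⟩

/-- Two points of the charts are identified in the gluing only if they come from a common point of
the overlap. -/
theorem pushout_inl_eq_inr {u : U} {v : V} (h : pushout.inl f g u = pushout.inr f g v) :
    ∃ w, f w = u ∧ g w = v := by
  have h' : colimit.ι (span f g) WalkingSpan.left u =
    colimit.ι (span f g) WalkingSpan.right v := h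
  obtain ⟨k, fi, fj, x, hx, hy⟩ := (Scheme.IsLocallyDirected.ι_eq_ι_iff (span f g)).1 h'
  match k, fi, fj, x, hx, hy with
  | none, .init _, .init _, x, hx, hy => exact ⟨x, hx, hy⟩

/-- A morphism of glued schemes which maps charts to charts and reflects the overlap in the second
chart is, over the first chart, the given morphism of first charts. -/
theorem isPullback_pushout_inl (φ : pushout f g ⟶ pushout f' g') (α : U ⟶ U') (β : V ⟶ V')
    (hα : pushout.inl f g ≫ φ = α ≫ pushout.inl f' g')
    (hβ : pushout.inr f g ≫ φ = β ≫ pushout.inr f' g')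
    (H : ∀ v : V, β v ∈ Set.range g' → v ∈ Set.range g) :
    IsPullback (pushout.inl f g) α φ (pushout.inl f' g') := by
  refine (IsOpenImmersion.isPullback _ _ _ _ hα ?_).flip
  ext x
  simp only [TopologicalSpace.Opens.map_coe, Scheme.Hom.coe_opensRange, Set.mem_preimage]
  constructor
  · rintro ⟨u', hu'⟩
    rcases pushout_mem_range_or f g x with h | ⟨v, rfl⟩
    · exact h
    · rw [← Scheme.Hom.comp_apply, hβ, Scheme.Hom.comp_apply] at hu'
      obtain ⟨w', -, hw'⟩ := pushout_inl_eq_inr f' g' hu'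
      obtain ⟨w, rfl⟩ := H v ⟨w', hw'⟩
      exact ⟨f w, by rw [← Scheme.Hom.comp_apply, pushout.condition, Scheme.Hom.comp_apply]⟩
  · rintro ⟨u, rfl⟩
    exact ⟨α u, by rw [← Scheme.Hom.comp_apply, ← Scheme.Hom.comp_apply, hα]⟩

theorem isPullback_pushout_inr (φ : pushout f g ⟶ pushout f' g') (α : U ⟶ U') (β : V ⟶ V')
    (hα : pushout.inl f g ≫ φ = α ≫ pushout.inl f' g')
    (hβ : pushout.inr f g ≫ φ = β ≫ pushout.inr f' g')
    (H : ∀ u : U, α u ∈ Set.range f' → u ∈ Set.range f) :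
    IsPullback (pushout.inr f g) β φ (pushout.inr f' g') := by
  refine (IsOpenImmersion.isPullback _ _ _ _ hβ ?_).flip
  ext x
  simp only [TopologicalSpace.Opens.map_coe, Scheme.Hom.coe_opensRange, Set.mem_preimage]
  constructor
  · rintro ⟨v', hv'⟩
    rcases pushout_mem_range_or f g x with ⟨u, rfl⟩ | h
    · rw [← Scheme.Hom.comp_apply, hα, Scheme.Hom.comp_apply] at hv'
      obtain ⟨w', hw', -⟩ := pushout_inl_eq_inr f' g' hv'.symm
      obtain ⟨w, rfl⟩ := H u ⟨w', hw'⟩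
      exact ⟨g w, by rw [← Scheme.Hom.comp_apply, ← pushout.condition, Scheme.Hom.comp_apply]⟩
    · exact h
  · rintro ⟨v, rfl⟩
    exact ⟨β v, by rw [← Scheme.Hom.comp_apply, ← Scheme.Hom.comp_apply, hβ]⟩

/-- A property of morphisms which is local on the target can be checked on open immersions into
the target that are jointly surjective. -/
theorem of_forall_exists_isPullback (P : MorphismProperty Scheme.{0}) [IsZariskiLocalAtTarget P]
    {X Y : Scheme.{0}} (φ : X ⟶ Y)
    (H : ∀ y : Y, ∃ (A B : Scheme.{0}) (iX : A ⟶ X) (φ' : A ⟶ B) (iY : B ⟶ Y),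
      IsOpenImmersion iY ∧ y ∈ Set.range iY ∧ IsPullback iX φ' φ iY ∧ P φ') : P φ := by
  choose A B iX φ' iY h₁ h₂ h₃ h₄ using H
  refine IsZariskiLocalAtTarget.of_iSup_eq_top (fun y => (iY y).opensRange) ?_ fun y => ?_
  · rw [eq_top_iff]
    intro y _
    exact TopologicalSpace.Opens.mem_iSup.2 ⟨y, h₂ y⟩
  · refine (P.arrow_mk_iso_iff (morphismRestrictOpensRange φ (iY y))).2 ?_
    have := (h₃ y).isoPullback_inv_snd
    rw [← this]
    exact (P.cancel_left_of_respectsIso _ _).2 (h₄ y)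

/-- A commutative square of schemes is cartesian if it is so over the members of an open cover of
its top right corner. -/
theorem isPullback_of_forall_exists {X' X S' S : Scheme.{0}} (j : X' ⟶ X) (a' : X' ⟶ S')
    (a : X ⟶ S) (s : S' ⟶ S) (w : j ≫ a = a' ≫ s)
    (H : ∀ x : X, ∃ (A B : Scheme.{0}) (i' : A ⟶ X') (j' : A ⟶ B) (i : B ⟶ X),
      IsOpenImmersion i ∧ x ∈ Set.range i ∧ IsPullback i' j' j i ∧
        IsPullback j' (i' ≫ a') (i ≫ a) s) : IsPullback j a' a s := by
  have hD := IsPullback.of_hasPullback a s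
  suffices IsIso (hD.lift j a' w) by
    exact IsPullback.of_iso hD (asIso (hD.lift j a' w)).symm (Iso.refl _) (Iso.refl _)
      (Iso.refl _) (by simp) (by simp) (by simp) (by simp)
  change MorphismProperty.isomorphisms Scheme (hD.lift j a' w)
  refine of_forall_exists_isPullback _ _ fun y => ?_
  obtain ⟨A, B, i', j', i, h₁, h₂, h₃, h₄⟩ := H (pullback.fst a s y)
  have hE := IsPullback.of_hasPullback (pullback.fst a s) i
  have hw : (i' ≫ hD.lift j a' w) ≫ pullback.fst a s = j' ≫ i := by simp [h₃.w]
  refine ⟨A, _, i', hE.lift _ j' hw, pullback.fst (pullback.fst a s) i, inferInstance,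
    ?_, ?_, ?_⟩
  · obtain ⟨b, hb⟩ := h₂
    obtain ⟨z, hz, -⟩ := Scheme.Pullback.exists_preimage_pullback y b hb.symm
    exact ⟨z, hz⟩
  · refine IsPullback.of_bot ?_ (by simp) hE
    simpa using h₃
  · have hF := hE.flip.paste_vert hD
    have : hE.lift _ j' hw = (h₄.isoIsPullback _ _ hF).hom := by
      refine hF.hom_ext (by simp) (by simp)
    rw [this]
    exact inferInstanceAs (IsIso (h₄.isoIsPullback _ _ hF).hom)

end Gluing

/-- A point of a closed subscheme which lies in an open subscheme comes from the intersection of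
the two; here the open subscheme is `Spec B → Spec A`, the closed one is `Spec A' → Spec A`. -/
theorem mem_range_SpecMap_of_surjective {A B A' B' : Type} [CommRing A] [CommRing B] [CommRing A']
    [CommRing B'] (g : A →+* B) (g' : A' →+* B') (π : A →+* A') (ρ : B →+* B')
    (hπ : Function.Surjective π) (hρ : Function.Surjective ρ) (h : g'.comp π = ρ.comp g)
    (hker : RingHom.ker ρ ≤ (RingHom.ker π).map g) (v : Spec (CommRingCat.of A'))
    (hv : Spec.map (CommRingCat.ofHom π) v ∈ Set.range (Spec.map (CommRingCat.ofHom g))) :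
    v ∈ Set.range (Spec.map (CommRingCat.ofHom g')) := by
  obtain ⟨w, hw⟩ := hv
  have hw' : PrimeSpectrum.comap g w = PrimeSpectrum.comap π v := hw
  have hle : RingHom.ker ρ ≤ w.asIdeal := by
    refine hker.trans (Ideal.map_le_iff_le_comap.2 ?_)
    change RingHom.ker π ≤ (PrimeSpectrum.comap g w).asIdeal
    rw [hw']
    exact Ideal.ker_le_comap _
  obtain ⟨w', rfl⟩ : w ∈ Set.range (PrimeSpectrum.comap ρ) := by
    rw [range_comap_of_surjective _ _ hρ]
    exact hle
  refine ⟨w', ?_⟩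
  refine PrimeSpectrum.comap_injective_of_surjective π hπ ?_
  rw [← hw', ← PrimeSpectrum.comap_comp_apply, ← h]
  rfl

/-! ### Surjections of rings and cartesian squares of spectra -/

section Surjections

variable {A B A' B' : Type} [CommRing A] [CommRing B] [CommRing A'] [CommRing B']

theorem ker_quotientMap_of_surjective (p : A →+* B) (hp : Function.Surjective p) (I : Ideal A)
    (J : Ideal B) (h : I.map p = J) (h' : I ≤ J.comap p) :
    RingHom.ker (Ideal.quotientMap J p h') = (RingHom.ker p).map (Ideal.Quotient.mk I) := by
  refine le_antisymm (fun x hx => ?_) (Ideal.map_le_iff_le_comap.2 fun a ha => ?_)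
  · obtain ⟨a, rfl⟩ := Ideal.Quotient.mk_surjective x
    rw [RingHom.mem_ker, Ideal.quotientMap_mk, Ideal.Quotient.eq_zero_iff_mem, ← h,
      Ideal.mem_map_iff_of_surjective p hp] at hx
    obtain ⟨i, hi, hia⟩ := hx
    have hi' : Ideal.Quotient.mk I i = 0 := Ideal.Quotient.eq_zero_iff_mem.2 hi
    rw [← sub_zero (Ideal.Quotient.mk I a), ← hi', ← map_sub]
    exact Ideal.mem_map_of_mem _ (by rw [RingHom.mem_ker, map_sub, hia, sub_self])
  · rw [Ideal.mem_comap, RingHom.mem_ker, Ideal.quotientMap_mk, RingHom.mem_ker.1 ha, map_zero]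

/-- If `A → A'` is the quotient by the ideal generated by the kernel of a surjection `B → B'`,
then `A'` is the base change of `A` along `B → B'`. -/
theorem isPullback_SpecMap_of_surjective (φ : B →+* A) (ψ : B' →+* A') (π : A →+* A')
    (f : B →+* B') (hπ : Function.Surjective π) (hf : Function.Surjective f)
    (h : π.comp φ = ψ.comp f) (hker : RingHom.ker π ≤ (RingHom.ker f).map φ) :
    IsPullback (Spec.map (CommRingCat.ofHom π)) (Spec.map (CommRingCat.ofHom ψ))
      (Spec.map (CommRingCat.ofHom φ)) (Spec.map (CommRingCat.ofHom f)) := by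
  refine isPullback_SpecMap_of_isPushout _ _ _ _ ⟨⟨?_⟩, ⟨?_⟩⟩
  · rw [← CommRingCat.ofHom_comp, ← CommRingCat.ofHom_comp, h]
  · have hle (s : PushoutCocone (CommRingCat.ofHom φ) (CommRingCat.ofHom f)) :
        RingHom.ker π ≤ RingHom.ker s.inl.hom := by
      refine hker.trans (Ideal.map_le_iff_le_comap.2 fun b hb => ?_)
      rw [Ideal.mem_comap, RingHom.mem_ker]
      have := congr($(s.condition).hom b)
      simpa [RingHom.mem_ker.1 hb] using this
    have hfac (s : PushoutCocone (CommRingCat.ofHom φ) (CommRingCat.ofHom f)) :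
        (RingHom.liftOfSurjective π hπ ⟨s.inl.hom, hle s⟩).comp π = s.inl.hom :=
      RingHom.liftOfSurjective_comp ..
    refine PushoutCocone.IsColimit.mk _
      (fun s => CommRingCat.ofHom (RingHom.liftOfSurjective π hπ ⟨s.inl.hom, hle s⟩)) ?_ ?_ ?_
    · intro s
      ext a
      exact congr($(hfac s) a)
    · intro s
      ext b
      obtain ⟨b, rfl⟩ := hf b
      have h₁ := congr($h b)
      have h₂ := congr($(s.condition).hom b)
      have h₃ := congr($(hfac s) (φ b))
      simp only [RingHom.comp_apply] at h₁ h₃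
      change RingHom.liftOfSurjective π hπ ⟨s.inl.hom, hle s⟩ (ψ (f b)) = s.inr.hom (f b)
      rw [← h₁, h₃]
      exact h₂
    · intro s m hm _
      ext a
      obtain ⟨a, rfl⟩ := hπ a
      exact (congr($(hm).hom a)).trans congr($(hfac s) a).symm

end Surjections

/-! ### The spectral curve and its charts -/

section Charts

variable {R : Type} [CommRing R] {n : ℕ} (a : HitchinBase n R)

theorem Tot.chart₀_toBase : Tot.chart₀ R ≫ Tot.toBase R =
    Spec.map (CommRingCat.ofHom (Polynomial.C.comp Polynomial.C)) := pushout.inl_desc _ _ _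

theorem Tot.chart₁_toBase : Tot.chart₁ R ≫ Tot.toBase R =
    Spec.map (CommRingCat.ofHom (Polynomial.C.comp Polynomial.C)) := pushout.inr_desc _ _ _

theorem Tot.chart₀_baseChange {S : Type} [CommRing S] (f : R →+* S) :
    Tot.chart₀ S ≫ Tot.baseChange f =
      Spec.map (CommRingCat.ofHom (Polynomial.mapRingHom (Polynomial.mapRingHom f))) ≫
        Tot.chart₀ R := pushout.inl_desc _ _ _

theorem Tot.chart₁_baseChange {S : Type} [CommRing S] (f : R →+* S) :
    Tot.chart₁ S ≫ Tot.baseChange f =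
      Spec.map (CommRingCat.ofHom (Polynomial.mapRingHom (Polynomial.mapRingHom f))) ≫
        Tot.chart₁ R := pushout.inr_desc _ _ _

/-- The chart of the spectral curve with coordinates `x`, `u`. -/
def spectralCurve.chart₀ : Spec (CommRingCat.of (Coord₀ a)) ⟶ spectralCurve a := pushout.inl _ _

/-- The chart of the spectral curve at infinity. -/
def spectralCurve.chart₁ : Spec (CommRingCat.of (Coord₁ a)) ⟶ spectralCurve a := pushout.inr _ _

theorem spectralCurve.chart_condition :
    Spec.map (CommRingCat.ofHom (R := Coord₀ a) (S := Coord₀₁ a) (coordHom₀ a)) ≫ chart₀ a =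
      Spec.map (CommRingCat.ofHom (R := Coord₁ a) (S := Coord₀₁ a) (coordHom₁ a)) ≫ chart₁ a :=
  pushout.condition

instance : IsOpenImmersion (spectralCurve.chart₀ a) := isOpenImmersion_pushout_inl _ _

instance : IsOpenImmersion (spectralCurve.chart₁ a) := isOpenImmersion_pushout_inr _ _

theorem spectralCurve.chart₀_ι : spectralCurve.chart₀ a ≫ spectralCurve.ι a =
    Spec.map (CommRingCat.ofHom (S := Coord₀ a) (Ideal.Quotient.mk (Ideal.span {a.eqn₀}))) ≫
      Tot.chart₀ R := pushout.inl_desc _ _ _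

theorem spectralCurve.chart₁_ι : spectralCurve.chart₁ a ≫ spectralCurve.ι a =
    Spec.map (CommRingCat.ofHom (S := Coord₁ a) (Ideal.Quotient.mk (Ideal.span {a.eqn₁}))) ≫
      Tot.chart₁ R := pushout.inr_desc _ _ _

theorem spectralCurve.chart₀_toBase : spectralCurve.chart₀ a ≫ spectralCurve.toBase a =
    Spec.map (CommRingCat.ofHom ((Ideal.Quotient.mk (Ideal.span {a.eqn₀})).comp
      (Polynomial.C.comp Polynomial.C))) := by
  rw [toBase, ← Category.assoc, chart₀_ι, Category.assoc, Tot.chart₀_toBase,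
    ← Spec.map_comp, ← CommRingCat.ofHom_comp]

theorem spectralCurve.chart₁_toBase : spectralCurve.chart₁ a ≫ spectralCurve.toBase a =
    Spec.map (CommRingCat.ofHom ((Ideal.Quotient.mk (Ideal.span {a.eqn₁})).comp
      (Polynomial.C.comp Polynomial.C))) := by
  rw [toBase, ← Category.assoc, chart₁_ι, Category.assoc, Tot.chart₁_toBase,
    ← Spec.map_comp, ← CommRingCat.ofHom_comp]

/-- The first chart of the spectral curve is its intersection with the first chart of
`Tot(O(2))`. -/
theorem spectralCurve.isPullback_chart₀ : IsPullback (spectralCurve.chart₀ a)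
    (Spec.map (CommRingCat.ofHom (S := Coord₀ a) (Ideal.Quotient.mk (Ideal.span {a.eqn₀}))))
    (spectralCurve.ι a) (Tot.chart₀ R) := by
  refine isPullback_pushout_inl _ _ _ _ _ _ _ (chart₀_ι a) (chart₁_ι a) fun v hv => ?_
  refine mem_range_SpecMap_of_surjective _ _ _ (Ideal.Quotient.mk _) Ideal.Quotient.mk_surjective
    Ideal.Quotient.mk_surjective (Ideal.quotientMap_comp_mk _) ?_ v hv
  rw [Ideal.mk_ker, Ideal.mk_ker, map_span_eqn₁]

theorem spectralCurve.isPullback_chart₁ : IsPullback (spectralCurve.chart₁ a)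
    (Spec.map (CommRingCat.ofHom (S := Coord₁ a) (Ideal.Quotient.mk (Ideal.span {a.eqn₁}))))
    (spectralCurve.ι a) (Tot.chart₁ R) := by
  refine isPullback_pushout_inr _ _ _ _ _ _ _ (chart₀_ι a) (chart₁_ι a) fun v hv => ?_
  refine mem_range_SpecMap_of_surjective _ _ _ (Ideal.Quotient.mk _) Ideal.Quotient.mk_surjective
    Ideal.Quotient.mk_surjective (Ideal.quotientMap_comp_mk _) ?_ v hv
  rw [Ideal.mk_ker, Ideal.mk_ker, map_span_eqn₀]

theorem spectralCurve.isClosedImmersion_ι : IsClosedImmersion (spectralCurve.ι a) := by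
  refine of_forall_exists_isPullback @IsClosedImmersion _ fun y => ?_
  rcases pushout_mem_range_or _ _ y with h | h
  · exact ⟨_, _, _, _, Tot.chart₀ R, inferInstance, h, isPullback_chart₀ a,
      IsClosedImmersion.spec_of_surjective _ Ideal.Quotient.mk_surjective⟩
  · exact ⟨_, _, _, _, Tot.chart₁ R, inferInstance, h, isPullback_chart₁ a,
      IsClosedImmersion.spec_of_surjective _ Ideal.Quotient.mk_surjective⟩

end Charts

/-! ### Base change of spectral curves along a surjection -/

section BaseChange

variable {R S : Type} [CommRing R] [CommRing S] {n : ℕ} (f : R →+* S) (a : HitchinBase n R)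

theorem HitchinBase.eqn₀_map : (a.map f).eqn₀ =
    Polynomial.mapRingHom (Polynomial.mapRingHom f) a.eqn₀ := by
  simp [eqn₀, map, Polynomial.map_sum]

theorem HitchinBase.eqn₁_map : (a.map f).eqn₁ =
    Polynomial.mapRingHom (Polynomial.mapRingHom f) a.eqn₁ := by
  simp [eqn₁, map, Polynomial.map_sum]

theorem map_span_eqn₀_map : (Ideal.span {a.eqn₀}).map
    (Polynomial.mapRingHom (Polynomial.mapRingHom f)) = Ideal.span {(a.map f).eqn₀} := by
  rw [Ideal.map_span, Set.image_singleton, a.eqn₀_map]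

theorem map_span_eqn₁_map : (Ideal.span {a.eqn₁}).map
    (Polynomial.mapRingHom (Polynomial.mapRingHom f)) = Ideal.span {(a.map f).eqn₁} := by
  rw [Ideal.map_span, Set.image_singleton, a.eqn₁_map]

theorem map_span_eqn₀₁_map : (Ideal.span {chartHom₀ R a.eqn₀}).map
    (Polynomial.mapRingHom (laurentMap f)) = Ideal.span {chartHom₀ S (a.map f).eqn₀} := by
  rw [Ideal.map_span, Set.image_singleton, a.eqn₀_map]
  congr 2
  exact congr($(chartHom₀_map f) a.eqn₀).symm

/-- Base change on the chart with coordinates `x`, `u`. -/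
def coordMap₀ : Coord₀ a →+* Coord₀ (a.map f) :=
  Ideal.quotientMap _ _ (Ideal.map_le_iff_le_comap.1 (map_span_eqn₀_map f a).le)

/-- Base change on the chart at infinity. -/
def coordMap₁ : Coord₁ a →+* Coord₁ (a.map f) :=
  Ideal.quotientMap _ _ (Ideal.map_le_iff_le_comap.1 (map_span_eqn₁_map f a).le)

/-- Base change on the overlap. -/
def coordMap₀₁ : Coord₀₁ a →+* Coord₀₁ (a.map f) :=
  Ideal.quotientMap _ _ (Ideal.map_le_iff_le_comap.1 (map_span_eqn₀₁_map f a).le)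

theorem coordHom₀_comp_coordMap₀ :
    (coordHom₀ (a.map f)).comp (coordMap₀ f a) = (coordMap₀₁ f a).comp (coordHom₀ a) := by
  refine Ideal.Quotient.ringHom_ext (RingHom.ext fun p => ?_)
  exact congrArg (Ideal.Quotient.mk _) congr($(chartHom₀_map f) p)

theorem coordHom₁_comp_coordMap₁ :
    (coordHom₁ (a.map f)).comp (coordMap₁ f a) = (coordMap₀₁ f a).comp (coordHom₁ a) := by
  refine Ideal.Quotient.ringHom_ext (RingHom.ext fun p => ?_)
  exact congrArg (Ideal.Quotient.mk _) congr($(chartHom₁_map f) p)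

/-- The morphism of spectral curves induced by a ring homomorphism. -/
def spectralCurve.baseChange : spectralCurve (a.map f) ⟶ spectralCurve a :=
  pushout.desc
    (Spec.map (CommRingCat.ofHom (coordMap₀ f a)) ≫ chart₀ a)
    (Spec.map (CommRingCat.ofHom (coordMap₁ f a)) ≫ chart₁ a)
    (by
      have h₀ : CommRingCat.ofHom (R := Coord₀ a) (S := Coord₀ (a.map f)) (coordMap₀ f a) ≫
          CommRingCat.ofHom (R := Coord₀ (a.map f)) (S := Coord₀₁ (a.map f)) (coordHom₀ (a.map f)) =
          CommRingCat.ofHom (R := Coord₀ a) (S := Coord₀₁ a) (coordHom₀ a) ≫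
          CommRingCat.ofHom (R := Coord₀₁ a) (S := Coord₀₁ (a.map f)) (coordMap₀₁ f a) :=
        congrArg CommRingCat.ofHom (coordHom₀_comp_coordMap₀ f a)
      have h₁ : CommRingCat.ofHom (R := Coord₁ a) (S := Coord₁ (a.map f)) (coordMap₁ f a) ≫
          CommRingCat.ofHom (R := Coord₁ (a.map f)) (S := Coord₀₁ (a.map f)) (coordHom₁ (a.map f)) =
          CommRingCat.ofHom (R := Coord₁ a) (S := Coord₀₁ a) (coordHom₁ a) ≫
          CommRingCat.ofHom (R := Coord₀₁ a) (S := Coord₀₁ (a.map f)) (coordMap₀₁ f a) :=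
        congrArg CommRingCat.ofHom (coordHom₁_comp_coordMap₁ f a)
      rw [← Category.assoc, ← Category.assoc, ← Spec.map_comp, ← Spec.map_comp, h₀, h₁,
        Spec.map_comp, Spec.map_comp, Category.assoc, Category.assoc, chart_condition])

theorem spectralCurve.chart₀_baseChange : chart₀ (a.map f) ≫ baseChange f a =
    Spec.map (CommRingCat.ofHom (coordMap₀ f a)) ≫ chart₀ a := pushout.inl_desc _ _ _

theorem spectralCurve.chart₁_baseChange : chart₁ (a.map f) ≫ baseChange f a =
    Spec.map (CommRingCat.ofHom (coordMap₁ f a)) ≫ chart₁ a := pushout.inr_desc _ _ _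

theorem spectralCurve.baseChange_ι : baseChange f a ≫ ι a = ι (a.map f) ≫ Tot.baseChange f := by
  refine pushout.hom_ext ?_ ?_
  · change chart₀ (a.map f) ≫ _ = chart₀ (a.map f) ≫ _
    rw [← Category.assoc, chart₀_baseChange, ← Category.assoc, chart₀_ι, Category.assoc, chart₀_ι,
      Category.assoc, Tot.chart₀_baseChange]
    simp only [← Category.assoc, ← Spec.map_comp, ← CommRingCat.ofHom_comp, coordMap₀,
      Ideal.quotientMap_comp_mk]
  · change chart₁ (a.map f) ≫ _ = chart₁ (a.map f) ≫ _
    rw [← Category.assoc, chart₁_baseChange, ← Category.assoc, chart₁_ι, Category.assoc, chart₁_ι,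
      Category.assoc, Tot.chart₁_baseChange]
    simp only [← Category.assoc, ← Spec.map_comp, ← CommRingCat.ofHom_comp, coordMap₁,
      Ideal.quotientMap_comp_mk]

theorem ker_mapRingHom_mapRingHom :
    RingHom.ker (Polynomial.mapRingHom (Polynomial.mapRingHom f)) =
      (RingHom.ker f).map (Polynomial.C.comp (Polynomial.C : R →+* R[X])) := by
  rw [Polynomial.ker_mapRingHom, Polynomial.ker_mapRingHom, Ideal.map_map]

/-- Multiplying by a power of `T` reduces the claim to polynomials. -/
theorem ker_laurentMap : RingHom.ker (laurentMap f) ≤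
    (RingHom.ker f).map (LaurentPolynomial.C : R →+* R[T;T⁻¹]) := by
  intro p hp
  obtain ⟨k, q, hq⟩ := p.exists_T_pow
  have hq' : q ∈ RingHom.ker (Polynomial.mapRingHom f) := by
    rw [RingHom.mem_ker, Polynomial.coe_mapRingHom, ← Polynomial.toLaurent_inj, map_zero,
      ← laurentMap_toLaurent, hq, map_mul, RingHom.mem_ker.1 hp, zero_mul]
  rw [Polynomial.ker_mapRingHom] at hq'
  have h := Ideal.mem_map_of_mem Polynomial.toLaurent hq'
  have hC : (Polynomial.toLaurent (R := R)).comp Polynomial.C = LaurentPolynomial.C :=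
    RingHom.ext fun c => Polynomial.toLaurent_C c
  rw [Ideal.map_map, hC, hq] at h
  exact (Ideal.mul_unit_mem_iff_mem _ (LaurentPolynomial.isUnit_T _)).1 h

theorem laurentMap_surjective (hf : Function.Surjective f) :
    Function.Surjective (laurentMap f) := by
  intro p
  induction p using LaurentPolynomial.induction_on' with
  | add p q hp hq =>
    obtain ⟨p, rfl⟩ := hp
    obtain ⟨q, rfl⟩ := hq
    exact ⟨p + q, map_add _ _ _⟩
  | C_mul_T k c =>
    obtain ⟨c, rfl⟩ := hf c
    exact ⟨LaurentPolynomial.C c * LaurentPolynomial.T k, by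
      rw [map_mul, laurentMap_C, laurentMap_T]⟩

theorem coordMap₀_comp_C : (coordMap₀ f a).comp ((Ideal.Quotient.mk (Ideal.span {a.eqn₀})).comp
      (Polynomial.C.comp Polynomial.C)) =
    ((Ideal.Quotient.mk (Ideal.span {(a.map f).eqn₀})).comp
      (Polynomial.C.comp Polynomial.C)).comp f := by
  refine RingHom.ext fun c => congrArg (Ideal.Quotient.mk (Ideal.span {(a.map f).eqn₀})) ?_
  simp

theorem coordMap₀_surjective (hf : Function.Surjective f) : Function.Surjective (coordMap₀ f a) :=
  Ideal.quotientMap_surjective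
    (Polynomial.map_surjective _ (Polynomial.map_surjective f hf))

theorem coordMap₁_comp_C : (coordMap₁ f a).comp ((Ideal.Quotient.mk (Ideal.span {a.eqn₁})).comp
      (Polynomial.C.comp Polynomial.C)) =
    ((Ideal.Quotient.mk (Ideal.span {(a.map f).eqn₁})).comp
      (Polynomial.C.comp Polynomial.C)).comp f := by
  refine RingHom.ext fun c => congrArg (Ideal.Quotient.mk (Ideal.span {(a.map f).eqn₁})) ?_
  simp

theorem coordMap₁_surjective (hf : Function.Surjective f) : Function.Surjective (coordMap₁ f a) :=
  Ideal.quotientMap_surjective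
    (Polynomial.map_surjective _ (Polynomial.map_surjective f hf))

theorem coordMap₀₁_surjective (hf : Function.Surjective f) :
    Function.Surjective (coordMap₀₁ f a) :=
  Ideal.quotientMap_surjective (Polynomial.map_surjective _ (laurentMap_surjective f hf))

theorem ker_coordMap₀ (hf : Function.Surjective f) : RingHom.ker (coordMap₀ f a) =
    (RingHom.ker f).map ((Ideal.Quotient.mk (Ideal.span {a.eqn₀})).comp
      (Polynomial.C.comp Polynomial.C)) := by
  rw [coordMap₀, ker_quotientMap_of_surjective _
    (Polynomial.map_surjective _ (Polynomial.map_surjective f hf)) _ _ (map_span_eqn₀_map f a),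
    ker_mapRingHom_mapRingHom, Ideal.map_map]

theorem ker_coordMap₁ (hf : Function.Surjective f) : RingHom.ker (coordMap₁ f a) =
    (RingHom.ker f).map ((Ideal.Quotient.mk (Ideal.span {a.eqn₁})).comp
      (Polynomial.C.comp Polynomial.C)) := by
  rw [coordMap₁, ker_quotientMap_of_surjective _
    (Polynomial.map_surjective _ (Polynomial.map_surjective f hf)) _ _ (map_span_eqn₁_map f a),
    ker_mapRingHom_mapRingHom, Ideal.map_map]

theorem ker_coordMap₀₁ (hf : Function.Surjective f) : RingHom.ker (coordMap₀₁ f a) ≤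
    (RingHom.ker f).map ((Ideal.Quotient.mk (Ideal.span {chartHom₀ R a.eqn₀})).comp
      (Polynomial.C.comp LaurentPolynomial.C)) := by
  rw [coordMap₀₁, ker_quotientMap_of_surjective _
    (Polynomial.map_surjective _ (laurentMap_surjective f hf)) _ _ (map_span_eqn₀₁_map f a),
    Polynomial.ker_mapRingHom, ← Ideal.map_map, ← Ideal.map_map]
  exact Ideal.map_mono (Ideal.map_mono (ker_laurentMap f))

theorem ker_coordMap₀₁_le_map_coordHom₀ (hf : Function.Surjective f) :
    RingHom.ker (coordMap₀₁ f a) ≤ (RingHom.ker (coordMap₀ f a)).map (coordHom₀ a) := by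
  refine (ker_coordMap₀₁ f a hf).trans ?_
  rw [ker_coordMap₀ f a hf, Ideal.map_map]
  refine le_of_eq (congrArg (fun φ => Ideal.map φ (RingHom.ker f)) (RingHom.ext fun c => ?_))
  refine congrArg (Ideal.Quotient.mk _) ?_
  simp [chartHom₀]

theorem ker_coordMap₀₁_le_map_coordHom₁ (hf : Function.Surjective f) :
    RingHom.ker (coordMap₀₁ f a) ≤ (RingHom.ker (coordMap₁ f a)).map (coordHom₁ a) := by
  refine (ker_coordMap₀₁ f a hf).trans ?_
  rw [ker_coordMap₁ f a hf, Ideal.map_map]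
  refine le_of_eq (congrArg (fun φ => Ideal.map φ (RingHom.ker f)) (RingHom.ext fun c => ?_))
  refine congrArg (Ideal.Quotient.mk _) ?_
  simp [chartHom₁]

theorem spectralCurve.isPullback_chart₀_baseChange (hf : Function.Surjective f) :
    IsPullback (chart₀ (a.map f)) (Spec.map (CommRingCat.ofHom (coordMap₀ f a))) (baseChange f a)
      (chart₀ a) := by
  have h := @mem_range_SpecMap_of_surjective (Coord₁ a) (Coord₀₁ a) (Coord₁ (a.map f))
    (Coord₀₁ (a.map f)) _ _ _ _ (coordHom₁ a) (coordHom₁ (a.map f)) (coordMap₁ f a)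
    (coordMap₀₁ f a)
  have h₁ := h (coordMap₁_surjective f a hf)
  have h₂ := h₁ (coordMap₀₁_surjective f a hf)
  have h₃ := h₂ (coordHom₁_comp_coordMap₁ f a)
  have h₄ := h₃ (ker_coordMap₀₁_le_map_coordHom₁ f a hf)
  exact isPullback_pushout_inl _ _ _ _ _ _ _ (chart₀_baseChange f a) (chart₁_baseChange f a) h₄

theorem spectralCurve.isPullback_chart₁_baseChange (hf : Function.Surjective f) :
    IsPullback (chart₁ (a.map f)) (Spec.map (CommRingCat.ofHom (coordMap₁ f a))) (baseChange f a)
      (chart₁ a) := by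
  have h := @mem_range_SpecMap_of_surjective (Coord₀ a) (Coord₀₁ a) (Coord₀ (a.map f))
    (Coord₀₁ (a.map f)) _ _ _ _ (coordHom₀ a) (coordHom₀ (a.map f)) (coordMap₀ f a)
    (coordMap₀₁ f a)
  have h₁ := h (coordMap₀_surjective f a hf)
  have h₂ := h₁ (coordMap₀₁_surjective f a hf)
  have h₃ := h₂ (coordHom₀_comp_coordMap₀ f a)
  have h₄ := h₃ (ker_coordMap₀₁_le_map_coordHom₀ f a hf)
  exact isPullback_pushout_inr _ _ _ _ _ _ _ (chart₀_baseChange f a) (chart₁_baseChange f a) h₄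

/-- The spectral curve of the image of `a` under a surjection `R → S` is the base change to `S` of
the spectral curve of `a`. -/
theorem spectralCurve.isPullback_baseChange (hf : Function.Surjective f) :
    IsPullback (baseChange f a) (toBase (a.map f)) (toBase a)
      (Spec.map (CommRingCat.ofHom f)) := by
  have w : baseChange f a ≫ toBase a = toBase (a.map f) ≫ Spec.map (CommRingCat.ofHom f) := by
    refine pushout.hom_ext ?_ ?_
    · change chart₀ (a.map f) ≫ _ = chart₀ (a.map f) ≫ _
      rw [← Category.assoc, chart₀_baseChange, Category.assoc, chart₀_toBase, ← Category.assoc,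
        chart₀_toBase, ← Spec.map_comp, ← Spec.map_comp, ← CommRingCat.ofHom_comp,
        ← CommRingCat.ofHom_comp, coordMap₀_comp_C]
    · change chart₁ (a.map f) ≫ _ = chart₁ (a.map f) ≫ _
      rw [← Category.assoc, chart₁_baseChange, Category.assoc, chart₁_toBase, ← Category.assoc,
        chart₁_toBase, ← Spec.map_comp, ← Spec.map_comp, ← CommRingCat.ofHom_comp,
        ← CommRingCat.ofHom_comp, coordMap₁_comp_C]
  refine isPullback_of_forall_exists _ _ _ _ w fun x => ?_
  rcases pushout_mem_range_or _ _ x with h | h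
  · refine ⟨_, _, chart₀ (a.map f), Spec.map (CommRingCat.ofHom (coordMap₀ f a)), chart₀ a,
      inferInstance, h, isPullback_chart₀_baseChange f a hf, ?_⟩
    rw [chart₀_toBase, chart₀_toBase]
    exact isPullback_SpecMap_of_surjective _ _ _ _ (coordMap₀_surjective f a hf) hf
      (coordMap₀_comp_C f a) (ker_coordMap₀ f a hf).le
  · refine ⟨_, _, chart₁ (a.map f), Spec.map (CommRingCat.ofHom (coordMap₁ f a)), chart₁ a,
      inferInstance, h, isPullback_chart₁_baseChange f a hf, ?_⟩
    rw [chart₁_toBase, chart₁_toBase]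
    exact isPullback_SpecMap_of_surjective _ _ _ _ (coordMap₁_surjective f a hf) hf
      (coordMap₁_comp_C f a) (ker_coordMap₁ f a hf).le

end BaseChange

/-! ### Integrality -/

/-- The gluing of two integral schemes along a common integral, hence nonempty, open subscheme is
integral. -/
theorem isIntegral_pushout {U V W : Scheme.{0}} (f : W ⟶ U) (g : W ⟶ V) [IsOpenImmersion f]
    [IsOpenImmersion g] [AlgebraicGeometry.IsIntegral U] [AlgebraicGeometry.IsIntegral V]
    [AlgebraicGeometry.IsIntegral W] : AlgebraicGeometry.IsIntegral (pushout f g) := by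
  have hred : AlgebraicGeometry.IsReduced (pushout f g) := by
    have (i : (Scheme.IsLocallyDirected.openCover (span f g)).I₀) : AlgebraicGeometry.IsReduced
        ((Scheme.IsLocallyDirected.openCover (span f g)).X i) := by
      match i with
      | none => exact inferInstanceAs (AlgebraicGeometry.IsReduced W)
      | some .left => exact inferInstanceAs (AlgebraicGeometry.IsReduced U)
      | some .right => exact inferInstanceAs (AlgebraicGeometry.IsReduced V)
    exact IsReduced.of_openCover _ (Scheme.IsLocallyDirected.openCover (span f g))
  have hrange {Z : Scheme.{0}} (i : Z ⟶ pushout f g) [AlgebraicGeometry.IsIntegral Z] :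
      IsIrreducible (Set.range i) := by
    rw [← Set.image_univ]
    exact (IrreducibleSpace.isIrreducible_univ Z).image i i.continuous.continuousOn
  obtain ⟨w⟩ : Nonempty W := inferInstance
  -- the second chart lies in the closure of the first one, as it meets it
  have hcl : closure (Set.range (pushout.inl f g)) = Set.univ := by
    refine Set.eq_univ_of_forall fun x => ?_
    rcases pushout_mem_range_or f g x with h | h
    · exact subset_closure h
    · refine closure_mono Set.inter_subset_right
        (subset_closure_inter_of_isPreirreducible_of_isOpen (hrange (pushout.inr f g)).2
          (pushout.inl f g).isOpenEmbedding.isOpen_range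
          ⟨pushout.inr f g (g w), ⟨_, rfl⟩, f w, ?_⟩ h)
      rw [← Scheme.Hom.comp_apply, pushout.condition, Scheme.Hom.comp_apply]
  have hirr : IrreducibleSpace ↥(pushout f g) := by
    rw [irreducibleSpace_def, Set.top_eq_univ, ← hcl]
    exact (hrange (pushout.inl f g)).closure
  exact isIntegral_of_irreducibleSpace_of_isReduced _

section Domain

open Polynomial in
/-- The powers `1, X, …, X^(n-1)` are linearly independent over the subring `K[s]` of `K[X]` when
`s` has degree `n`: the degrees of the terms of a nontrivial relation are distinct modulo `n`. -/
theorem eq_zero_of_sum_comp_mul_X_pow_eq_zero {K : Type} [Field K] {n : ℕ} (s : K[X])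
    (hs : s.natDegree = n) (h : ℕ → K[X])
    (hsum : ∑ i ∈ Finset.range n, (h i).comp s * X ^ i = 0) (i : ℕ) (hi : i < n) : h i = 0 := by
  have hs0 : s.natDegree ≠ 0 := by omega
  have hcomp (j : ℕ) (hj : (h j).comp s * X ^ j ≠ 0) :
      ((h j).comp s * X ^ j).natDegree = (h j).natDegree * n + j := by
    rw [natDegree_mul (left_ne_zero_of_mul hj) (right_ne_zero_of_mul hj), natDegree_comp, hs,
      natDegree_X_pow]
  have hdis : {j | j ∈ Finset.range n ∧ (h j).comp s * X ^ j ≠ 0}.Pairwise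
      (Function.onFun (· ≠ ·) (degree ∘ fun j => (h j).comp s * X ^ j)) := by
    rintro j ⟨hj, hj0⟩ k ⟨hk, hk0⟩ hjk heq
    have hd := natDegree_eq_of_degree_eq heq
    rw [hcomp j hj0, hcomp k hk0] at hd
    have := congrArg (· % n) hd
    simp only [Nat.mul_add_mod_self_right, Nat.mod_eq_of_lt (Finset.mem_range.1 hj),
      Nat.mod_eq_of_lt (Finset.mem_range.1 hk)] at this
    exact hjk this
  have hdeg := degree_sum_eq_of_disjoint _ _ hdis
  rw [hsum, degree_zero] at hdeg
  have hle := (Finset.sup_eq_bot_iff _ _).1 hdeg.symm i (Finset.mem_range.2 hi)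
  rw [degree_eq_bot] at hle
  have h0 : (h i).comp s = 0 := (mul_eq_zero.1 hle).resolve_right (pow_ne_zero _ X_ne_zero)
  rcases comp_eq_zero_iff.1 h0 with h0 | ⟨-, h0⟩
  · exact h0
  · rw [h0, natDegree_C] at hs0
    exact absurd rfl hs0

open Polynomial in
/-- The curve `y^n = t x^n + x^(n+1)` is the image of the affine line under the morphism
`w ↦ (s, w s)`, where `s = w^n - t`. -/
theorem span_eq_ker_parametrization {K : Type} [Field K] {n : ℕ} (hn : 0 < n) (t : K) :
    Ideal.span {(X ^ n - C (C t * X ^ n + X ^ (n + 1)) : K[X][X])} =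
      RingHom.ker (eval₂RingHom (compRingHom (X ^ n - C t)) (X * (X ^ n - C t) : K[X])) := by
  set F : K[X][X] := X ^ n - C (C t * X ^ n + X ^ (n + 1)) with hF
  set s : K[X] := X ^ n - C t with hs
  set Φ := eval₂RingHom (compRingHom s) (X * s : K[X]) with hΦ
  have hFmonic : F.Monic := monic_X_pow_sub_C _ hn.ne'
  have hFdeg : F.degree = n := degree_X_pow_sub_C hn _
  have hΦF : Φ F = 0 := by
    simp only [hΦ, hF, map_sub, map_pow, map_add, map_mul, coe_eval₂RingHom, eval₂_X, eval₂_C,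
      coe_compRingHom_apply, C_comp, X_comp]
    rw [mul_pow, show (X : K[X]) ^ n = s + C t by rw [hs, sub_add_cancel]]
    ring
  refine le_antisymm ((Ideal.span_singleton_le_iff_mem _).2 hΦF) fun p hp => ?_
  have hr : Φ (p %ₘ F) = 0 := by
    have := congrArg Φ (modByMonic_add_div p F)
    rwa [map_add, map_mul, hΦF, zero_mul, add_zero, RingHom.mem_ker.1 hp] at this
  have hrdeg : (p %ₘ F).degree < n := hFdeg ▸ degree_modByMonic_lt p hFmonic
  have hrnat : (p %ₘ F).natDegree < n := by
    by_cases h : p %ₘ F = 0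
    · rwa [h, natDegree_zero]
    · exact (natDegree_lt_iff_degree_lt h).2 hrdeg
  have hsum : ∑ i ∈ Finset.range n, ((p %ₘ F).coeff i * X ^ i).comp s * X ^ i = 0 := by
    rw [as_sum_range_C_mul_X_pow' (p %ₘ F) hrnat,
      map_sum] at hr
    rw [← hr]
    refine Finset.sum_congr rfl fun i _ => ?_
    simp only [hΦ, map_mul, map_pow, coe_eval₂RingHom, eval₂_X, eval₂_C, coe_compRingHom_apply,
      mul_comp, pow_comp, X_comp]
    rw [mul_pow, mul_comm (X ^ i), mul_assoc]
  have h0 := eq_zero_of_sum_comp_mul_X_pow_eq_zero s (natDegree_X_pow_sub_C) _ hsum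
  have hzero : p %ₘ F = 0 := by
    ext1 i
    rw [coeff_zero]
    by_cases hi : i < n
    · exact (mul_eq_zero.1 (h0 i hi)).resolve_right (pow_ne_zero _ X_ne_zero)
    · exact coeff_eq_zero_of_degree_lt (hrdeg.trans_le (by exact_mod_cast not_lt.1 hi))
  exact Ideal.mem_span_singleton.2 ((modByMonic_eq_zero_iff_dvd hFmonic).1 hzero)

variable {R : Type} [CommRing R] {n : ℕ} (a : HitchinBase n R)

theorem degree_sum_C_mul_X_pow_lt (hn : 0 < n) (c : Set.Icc 2 n → R[X]) :
    (∑ i : Set.Icc 2 n, Polynomial.C (c i) * Polynomial.X ^ (n - i : ℕ)).degree <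
      (n : WithBot ℕ) := by
  refine (Polynomial.degree_sum_le _ _).trans_lt
    ((Finset.sup_lt_iff (WithBot.bot_lt_coe n)).2 fun i _ => ?_)
  refine (Polynomial.degree_C_mul_X_pow_le _ _).trans_lt ?_
  have := i.2.1
  exact WithBot.coe_lt_coe.2 (by omega : n - (i : ℕ) < n)

theorem HitchinBase.monic_eqn₀ (hn : 0 < n) : a.eqn₀.Monic :=
  Polynomial.monic_X_pow_add (degree_sum_C_mul_X_pow_lt hn _)

theorem HitchinBase.monic_eqn₁ (hn : 0 < n) : a.eqn₁.Monic :=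
  Polynomial.monic_X_pow_add (degree_sum_C_mul_X_pow_lt hn _)

theorem HitchinBase.degree_eqn₀ [Nontrivial R] (hn : 0 < n) : a.eqn₀.degree = n := by
  rw [eqn₀, Polynomial.degree_add_eq_left_of_degree_lt, Polynomial.degree_X_pow]
  rw [Polynomial.degree_X_pow]
  exact degree_sum_C_mul_X_pow_lt hn _

theorem HitchinBase.degree_eqn₁ [Nontrivial R] (hn : 0 < n) : a.eqn₁.degree = n := by
  rw [eqn₁, Polynomial.degree_add_eq_left_of_degree_lt, Polynomial.degree_X_pow]
  rw [Polynomial.degree_X_pow]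
  exact degree_sum_C_mul_X_pow_lt hn _

theorem chartHom₁_injective : Function.Injective (chartHom₁ R) := by
  rw [chartHom₁_eq]
  exact (Function.Involutive.injective (overlapHom_overlapHom R)).comp
    (Polynomial.map_injective _ Polynomial.toLaurent_injective)

/-- The restriction from the chart at infinity multiplies `v^k` by a power of `T`, and so does not
raise the degree in the fibre coordinate. -/
theorem degree_chartHom₁_le (p : R[X][X]) : (chartHom₁ R p).degree ≤ p.degree := by
  conv_lhs => rw [p.as_sum_support_C_mul_X_pow, map_sum]
  refine (Polynomial.degree_sum_le _ _).trans (Finset.sup_le fun k hk => ?_)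
  rw [chartHom₁_C_mul_X_pow]
  exact (Polynomial.degree_C_mul_X_pow_le _ _).trans
    (Polynomial.le_degree_of_mem_supp k hk)

theorem HitchinBase.monic_chartHom₀_eqn₀ (hn : 0 < n) : (chartHom₀ R a.eqn₀).Monic :=
  (a.monic_eqn₀ hn).map _

theorem HitchinBase.degree_chartHom₀_eqn₀ [Nontrivial R] (hn : 0 < n) :
    (chartHom₀ R a.eqn₀).degree = n :=
  ((a.monic_eqn₀ hn).degree_map _).trans (a.degree_eqn₀ hn)

variable [IsDomain R]

/-- The ideal of the curve on the overlap is the localisation of its ideal in the first chart. -/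
theorem isPrime_span_chartHom₀_eqn₀ (hn : 0 < n) (h : (Ideal.span {a.eqn₀}).IsPrime) :
    (Ideal.span {chartHom₀ R a.eqn₀}).IsPrime := by
  let : Algebra R[X][X] R[T;T⁻¹][X] := Polynomial.algebra R[X] R[T;T⁻¹]
  have hloc := Polynomial.isLocalization (Submonoid.powers (Polynomial.X : R[X])) R[T;T⁻¹]
  rw [← map_span_eqn₀]
  refine IsLocalization.isPrime_of_isPrime_disjoint
    ((Submonoid.powers (Polynomial.X : R[X])).map Polynomial.C) R[T;T⁻¹][X] _ h ?_
  rw [Set.disjoint_left]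
  rintro _ ⟨_, ⟨k, rfl⟩, rfl⟩ hmem
  refine (a.monic_eqn₀ hn).not_dvd_of_degree_lt ?_ ?_ (Ideal.mem_span_singleton.1 hmem)
  · exact Polynomial.C_ne_zero.2 (pow_ne_zero _ Polynomial.X_ne_zero)
  · rw [a.degree_eqn₀ hn]
    refine Polynomial.degree_C_le.trans_lt ?_
    exact_mod_cast hn

/-- The ideal of the curve in the chart at infinity is the contraction of its ideal on the overlap:
on remainders of division by the monic equation the restriction to the overlap does not raise the
degree, so that a remainder which becomes divisible by the equation vanishes. -/
theorem comap_chartHom₁_span (hn : 0 < n) :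
    (Ideal.span {chartHom₀ R a.eqn₀}).comap (chartHom₁ R) = Ideal.span {a.eqn₁} := by
  refine le_antisymm (fun p hp => ?_) (Ideal.map_le_iff_le_comap.1 (map_span_eqn₁ a).le)
  have hr : chartHom₁ R (p %ₘ a.eqn₁) ∈ Ideal.span {chartHom₀ R a.eqn₀} := by
    have h := congrArg (chartHom₁ R) (Polynomial.modByMonic_add_div p a.eqn₁)
    rw [map_add] at h
    rw [← eq_sub_iff_add_eq] at h
    rw [h]
    refine sub_mem hp ?_
    rw [map_mul, ← map_span_eqn₁]
    exact Ideal.mul_mem_right _ _ (Ideal.mem_map_of_mem _ (Ideal.mem_span_singleton_self _))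
  have hzero : chartHom₁ R (p %ₘ a.eqn₁) = 0 := by
    by_contra hne
    refine (a.monic_chartHom₀_eqn₀ hn).not_dvd_of_degree_lt hne ?_ (Ideal.mem_span_singleton.1 hr)
    rw [a.degree_chartHom₀_eqn₀ hn, ← a.degree_eqn₁ hn]
    exact (degree_chartHom₁_le _).trans_lt (Polynomial.degree_modByMonic_lt p (a.monic_eqn₁ hn))
  rw [← map_zero (chartHom₁ R)] at hzero
  exact Ideal.mem_span_singleton.2
    ((Polynomial.modByMonic_eq_zero_iff_dvd (a.monic_eqn₁ hn)).1 (chartHom₁_injective hzero))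

theorem isPrime_span_eqn₁ (hn : 0 < n) (h : (Ideal.span {a.eqn₀}).IsPrime) :
    (Ideal.span {a.eqn₁}).IsPrime := by
  have := isPrime_span_chartHom₀_eqn₀ a hn h
  rw [← comap_chartHom₁_span a hn]
  exact Ideal.comap_isPrime _ _

/-- A spectral curve is integral as soon as its chart with coordinates `x`, `u` is. -/
theorem spectralCurve.isIntegral (hn : 0 < n) (h : (Ideal.span {a.eqn₀}).IsPrime) :
    AlgebraicGeometry.IsIntegral (spectralCurve a) := by
  have := isPrime_span_eqn₁ a hn h
  have := isPrime_span_chartHom₀_eqn₀ a hn h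
  have : IsDomain (Coord₀ a) := Ideal.Quotient.isDomain _
  have : IsDomain (Coord₁ a) := Ideal.Quotient.isDomain _
  have : IsDomain (Coord₀₁ a) := Ideal.Quotient.isDomain _
  have : Nonempty (Spec (CommRingCat.of (Coord₀₁ a))) :=
    inferInstanceAs (Nonempty (PrimeSpectrum (Coord₀₁ a)))
  exact isIntegral_pushout _ _

end Domain

/-! ### Points of a plane curve -/

section Points

open Polynomial

variable {K : Type} [Field K]

/-- Evaluation of polynomials in two variables at the point `(α, β)`. -/
def evalAt (α β : K) : K[X][X] →+* K := (evalRingHom α).comp (evalRingHom (C β))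

theorem evalAt_C (α β : K) (p : K[X]) : evalAt α β (C p) = p.eval α := by simp [evalAt]

theorem evalAt_X (α β : K) : evalAt α β X = β := by simp [evalAt]

theorem ker_evalAt (α β : K) :
    RingHom.ker (evalAt α β) = Ideal.span {C (X - C α), X - C (C β)} := by
  refine le_antisymm (fun p hp => ?_) ?_
  · have h₁ : p - C (p.eval (C β)) ∈ Ideal.span {C (X - C α), X - C (C β)} :=
      Ideal.mem_of_dvd _ (X_sub_C_dvd_sub_C_eval) (Ideal.subset_span (by simp))
    have h₂ : C (p.eval (C β)) ∈ Ideal.span {C (X - C α), X - C (C β)} := by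
      have h := (dvd_iff_isRoot (p := p.eval (C β)) (a := α)).2 hp
      exact Ideal.mem_of_dvd _ (map_dvd C h) (Ideal.subset_span (by simp))
    simpa using add_mem h₁ h₂
  · rw [Ideal.span_le, Set.insert_subset_iff, Set.singleton_subset_iff]
    simp [RingHom.mem_ker, evalAt]

variable {n : ℕ} {g : K[X]} {A : Type} [CommRing A] {π : K[X][X] →+* A}

theorem finite_comp_C (hn : 0 < n) (hπ : Function.Surjective π)
    (hker : RingHom.ker π = Ideal.span {X ^ n - C g}) : (π.comp C).Finite := by
  let := (π.comp C).toAlgebra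
  have hfin : Module.Finite K[X] (K[X][X] ⧸ Ideal.span {(X ^ n - C g : K[X][X])}) :=
    (monic_X_pow_sub_C g hn.ne').finite_quotient
  let e : (K[X][X] ⧸ Ideal.span {(X ^ n - C g : K[X][X])}) →ₐ[K[X]] A :=
    Ideal.Quotient.liftₐ _ ⟨π, fun _ => rfl⟩ fun p hp => by
      rwa [← hker] at hp
  have he : Function.Surjective e := fun a => by
    obtain ⟨p, rfl⟩ := hπ a
    exact ⟨Ideal.Quotient.mk _ p, rfl⟩
  exact Module.Finite.of_surjective e.toLinearMap he

/-- A nonzero prime ideal of the coordinate ring of an integral curve `y^n = g(x)` over an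
algebraically closed field is the maximal ideal of a point of the curve. -/
theorem exists_comap_eq_ker_evalAt [IsAlgClosed K] [IsDomain A] (hn : 0 < n)
    (hπ : Function.Surjective π) (hker : RingHom.ker π = Ideal.span {X ^ n - C g}) (P : Ideal A)
    [hP : P.IsPrime] (h0 : P ≠ ⊥) : ∃ α β, P.comap π = RingHom.ker (evalAt α β) := by
  set P' := P.comap π with hP'
  have hP'prime : P'.IsPrime := Ideal.comap_isPrime _ _
  have hFP : X ^ n - C g ∈ P' := by
    have hF : X ^ n - C g ∈ RingHom.ker π := hker ▸ Ideal.mem_span_singleton_self _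
    rw [hP', Ideal.mem_comap, RingHom.mem_ker.1 hF]
    exact zero_mem _
  -- the prime ideal contains a nonzero polynomial in `x`, hence a linear one
  obtain ⟨c, hc, hc0⟩ : ∃ c : K[X], C c ∈ P' ∧ c ≠ 0 := by
    obtain ⟨x, hxP, hx0⟩ := Submodule.exists_mem_ne_zero_of_ne_bot h0
    let := (π.comp C).toAlgebra
    have hfin : Module.Finite K[X] A := finite_comp_C hn hπ hker
    have hne := Ideal.comap_ne_bot_of_integral_mem (R := K[X]) hx0 hxP
      (Algebra.IsIntegral.isIntegral x)
    exact Submodule.exists_mem_ne_zero_of_ne_bot hne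
  obtain ⟨α, hα⟩ : ∃ α, C (X - C α) ∈ P' := by
    rw [(IsAlgClosed.splits c).eq_prod_roots, map_mul] at hc
    rcases hP'prime.mem_or_mem hc with h | h
    · refine absurd (Ideal.eq_top_of_isUnit_mem _ h ?_) hP'prime.ne_top
      exact ((isUnit_iff_ne_zero.2 (leadingCoeff_ne_zero.2 hc0)).map C).map C
    · rw [map_multiset_prod, Multiset.map_map, hP'prime.multiset_prod_mem_iff_exists_mem] at h
      obtain ⟨q, hq, hqP⟩ := h
      obtain ⟨α, -, rfl⟩ := Multiset.mem_map.1 hq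
      exact ⟨α, hqP⟩
  have hg : X ^ n - C (C (g.eval α)) ∈ P' := by
    have h₁ : C (g - C (g.eval α)) ∈ P' := Ideal.mem_of_dvd _ (map_dvd C X_sub_C_dvd_sub_C_eval) hα
    have := add_mem hFP h₁
    rwa [C_sub, sub_add_sub_cancel] at this
  obtain ⟨β, hβ⟩ : ∃ β, X - C (C β) ∈ P' := by
    have hs : (X ^ n - C (C (g.eval α)) : K[X][X]) = (X ^ n - C (g.eval α) : K[X]).map C := by simp
    rw [hs, (IsAlgClosed.splits (X ^ n - C (g.eval α) : K[X])).eq_prod_roots_of_monic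
      (monic_X_pow_sub_C _ hn.ne'), Polynomial.map_multiset_prod, Multiset.map_map,
      hP'prime.multiset_prod_mem_iff_exists_mem] at hg
    obtain ⟨q, hq, hqP⟩ := hg
    obtain ⟨β, -, rfl⟩ := Multiset.mem_map.1 hq
    exact ⟨β, by simpa using hqP⟩
  have hmax : (RingHom.ker (evalAt α β)).IsMaximal :=
    RingHom.ker_isMaximal_of_surjective _ fun c => ⟨C (C c), by simp [evalAt_C]⟩
  refine ⟨α, β, (hmax.eq_of_le hP'prime.ne_top ?_).symm⟩
  rw [ker_evalAt, Ideal.span_le, Set.insert_subset_iff, Set.singleton_subset_iff]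
  exact ⟨hα, hβ⟩

end Points

/-! ### Formal power series and completions -/

section PowerSeries

variable {σ R : Type} [Finite σ] [CommRing R]

variable (σ R) in
/-- The ideal of power series generated by the variables. -/
abbrev varIdeal : Ideal (MvPowerSeries σ R) := Ideal.span (Set.range MvPowerSeries.X)

/-- The powers of the ideal generated by the variables are the ideals of the order filtration; this
is read off from the identification of the power series ring with the completion of the polynomial
ring. -/
theorem mem_varIdeal_pow_iff (k : ℕ) (G : MvPowerSeries σ R) :
    G ∈ varIdeal σ R ^ k ↔ ∀ d, Finsupp.degree d < k → MvPowerSeries.coeff d G = 0 := by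
  let e := MvPowerSeries.toAdicCompletionAlgEquiv σ R
  have hmap : (varIdeal σ R).map e.toRingEquiv = (MvPolynomial.idealOfVars σ R).map
      (algebraMap _ (AdicCompletion (MvPolynomial.idealOfVars σ R) (MvPolynomial σ R))) := by
    simp_rw [varIdeal, Ideal.map_span, ← Set.range_comp]
    congr 2; ext1
    simp [e, AdicCompletion.algebraMap_apply, ← MvPolynomial.coe_X,
      MvPowerSeries.toAdicCompletion_coe]
  have h₁ : G ∈ varIdeal σ R ^ k ↔ e.toRingEquiv G ∈ ((varIdeal σ R) ^ k).map e.toRingEquiv := by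
    rw [Ideal.mem_map_of_equiv]
    exact ⟨fun h => ⟨G, h, rfl⟩, fun ⟨x, hx, hxG⟩ => e.toRingEquiv.injective hxG ▸ hx⟩
  have h₂ : e.toRingEquiv G ∈ ((varIdeal σ R) ^ k).map e.toRingEquiv ↔
      AdicCompletion.eval _ _ k (e G) = 0 := by
    rw [Ideal.map_pow, hmap, ← Ideal.map_pow, ← LinearMap.mem_ker,
      ← AdicCompletion.pow_smul_top_eq_ker_eval (MvPolynomial.idealOfVars_fg σ R),
      Ideal.smul_top_eq_map]
    rfl
  rw [h₁, h₂]
  change (MvPowerSeries.toAdicCompletion σ R G).val k = 0 ↔ _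
  rw [MvPowerSeries.toAdicCompletion_apply_eq_mk_truncTotal]
  change Submodule.Quotient.mk (MvPowerSeries.truncTotal k G) = 0 ↔ _
  rw [Submodule.Quotient.mk_eq_zero, smul_eq_mul, Ideal.mul_top,
    MvPolynomial.mem_pow_idealOfVars_iff']
  refine forall₂_congr fun d hd => ?_
  rw [MvPowerSeries.coeff_truncTotal _ hd]

theorem sub_truncTotal_mem_varIdeal_pow (k : ℕ) (G : MvPowerSeries σ R) :
    G - MvPowerSeries.truncTotal k G ∈ varIdeal σ R ^ k := by
  rw [mem_varIdeal_pow_iff]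
  intro d hd
  rw [map_sub, MvPolynomial.coeff_coe, MvPowerSeries.coeff_truncTotal _ hd, sub_self]

theorem mem_varIdeal_iff (G : MvPowerSeries σ R) :
    G ∈ varIdeal σ R ↔ MvPowerSeries.constantCoeff G = 0 := by
  rw [← pow_one (varIdeal σ R), mem_varIdeal_pow_iff]
  simp [Finsupp.degree_eq_zero_iff]

/-- A quotient of a power series ring over a field is complete. -/
theorem isAdicComplete_quotient {K : Type} [Field K] (I : Ideal (MvPowerSeries σ K)) :
    IsAdicComplete ((varIdeal σ K).map (Ideal.Quotient.mk I)) (MvPowerSeries σ K ⧸ I) := by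
  refine (IsAdicComplete.map_algebraMap_iff (R := MvPowerSeries σ K)
    (S := MvPowerSeries σ K ⧸ I) (M := MvPowerSeries σ K ⧸ I) (varIdeal σ K)).2 ?_
  have hne : varIdeal σ K ≠ ⊤ := by
    rw [Ideal.ne_top_iff_one, mem_varIdeal_iff]
    simp
  have hH : IsHausdorff (varIdeal σ K) (MvPowerSeries σ K ⧸ I) := IsHausdorff.of_isLocalRing _ _ hne
  have hP : IsPrecomplete (varIdeal σ K) (MvPowerSeries σ K ⧸ I) := by
    rw [← AdicCompletion.of_surjective_iff]
    intro y
    obtain ⟨y, rfl⟩ := AdicCompletion.map_surjective (varIdeal σ K) (f := I.mkQ)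
      (Submodule.mkQ_surjective I) y
    obtain ⟨G, rfl⟩ := AdicCompletion.of_surjective (varIdeal σ K) (MvPowerSeries σ K) y
    exact ⟨I.mkQ G, (AdicCompletion.map_of _ _ _).symm⟩
  exact { }

end PowerSeries

section Completion

variable {S B : Type} [CommRing S] [CommRing B]

/-- A homomorphism to a complete ring which identifies the quotients by all powers of two ideals
extends to an isomorphism from the completion of its source. -/
theorem exists_adicCompletion_ringEquiv (m : Ideal S) (N : Ideal B) [IsAdicComplete N B]
    (ψ : S →+* B) (hψ : ∀ k, (N ^ k).comap ψ = m ^ k)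
    (hdense : ∀ k b, ∃ s, b - ψ s ∈ N ^ k) :
    ∃ e : AdicCompletion m S ≃+* B, ∀ s, e (algebraMap _ _ s) = ψ s := by
  let q (k : ℕ) : S ⧸ m ^ k →+* B ⧸ N ^ k := Ideal.quotientMap _ ψ (hψ k).ge
  have hq (k : ℕ) : Function.Bijective (q k) := by
    refine ⟨Ideal.quotientMap_injective' (hψ k).le, fun b => ?_⟩
    obtain ⟨b, rfl⟩ := Ideal.Quotient.mk_surjective b
    obtain ⟨s, hs⟩ := hdense k b
    exact ⟨Ideal.Quotient.mk _ s, by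
      rw [Ideal.quotientMap_mk]; exact (Ideal.Quotient.eq.2 hs).symm⟩
  let f (k : ℕ) : AdicCompletion m S →+* B ⧸ N ^ k :=
    (q k).comp (AdicCompletion.evalₐ m k : AdicCompletion m S →+* S ⧸ m ^ k)
  have hqf {k l : ℕ} (hkl : k ≤ l) : (Ideal.Quotient.factorPow N hkl).comp (q l) =
      (q k).comp (Ideal.Quotient.factorPow m hkl) :=
    Ideal.Quotient.ringHom_ext (RingHom.ext fun s => rfl)
  have hev {k l : ℕ} (hkl : k ≤ l) (x : AdicCompletion m S) :
      Ideal.Quotient.factorPow m hkl (AdicCompletion.evalₐ m l x) =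
        AdicCompletion.evalₐ m k x := by
    obtain ⟨x, rfl⟩ := AdicCompletion.mk_surjective m S x
    rw [AdicCompletion.evalₐ_mk, AdicCompletion.evalₐ_mk]
    exact AdicCompletion.Ideal.mk_eq_mk m hkl x
  have hf {k l : ℕ} (hkl : k ≤ l) : (Ideal.Quotient.factorPow N hkl).comp (f l) = f k := by
    refine RingHom.ext fun x => ?_
    have h₁ := congr($(hqf hkl) (AdicCompletion.evalₐ m l x))
    simp only [RingHom.comp_apply, hev] at h₁
    exact h₁
  let Φ := IsAdicComplete.liftRingHom N f hf
  have hΦ (k : ℕ) (x : AdicCompletion m S) :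
      Ideal.Quotient.mk (N ^ k) (Φ x) = q k (AdicCompletion.evalₐ m k x) :=
    IsAdicComplete.mk_liftRingHom N f hf k x
  have hext (b b' : B) (h : ∀ k, Ideal.Quotient.mk (N ^ k) b = Ideal.Quotient.mk (N ^ k) b') :
      b = b' := by
    rw [← sub_eq_zero]
    refine IsHausdorff.haus (I := N) inferInstance _ fun k => ?_
    rw [SModEq.zero, smul_eq_mul, Ideal.mul_top]
    exact Ideal.Quotient.eq.1 (h k)
  have hinj : Function.Injective Φ := fun x y hxy => AdicCompletion.ext_evalₐ fun k => by
    have := congrArg (Ideal.Quotient.mk (N ^ k)) hxy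
    rw [hΦ, hΦ] at this
    exact (hq k).1 this
  have hsurj : Function.Surjective Φ := by
    intro b
    let g (k : ℕ) : B →+* S ⧸ m ^ k :=
      ((RingEquiv.ofBijective _ (hq k)).symm : B ⧸ N ^ k →+* S ⧸ m ^ k).comp (Ideal.Quotient.mk _)
    have hqg (k : ℕ) (b : B) : q k (g k b) = Ideal.Quotient.mk _ b :=
      (RingEquiv.ofBijective _ (hq k)).apply_symm_apply _
    have hg {k l : ℕ} (hkl : k ≤ l) : (Ideal.Quotient.factorPow m hkl).comp (g l) = g k := by
      refine RingHom.ext fun b => (hq k).1 ?_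
      have h₁ := congr($(hqf hkl) (g l b))
      simp only [RingHom.comp_apply, hqg] at h₁
      rw [RingHom.comp_apply, ← h₁, hqg]
      rfl
    refine ⟨AdicCompletion.liftRingHom m g hg b, hext _ _ fun k => ?_⟩
    rw [hΦ, AdicCompletion.evalₐ_liftRingHom, hqg]
  refine ⟨RingEquiv.ofBijective Φ ⟨hinj, hsurj⟩, fun s => hext _ _ fun k => ?_⟩
  change Ideal.Quotient.mk (N ^ k) (Φ _) = _
  rw [hΦ, AlgHom.commutes]
  rfl

end Completion

section Localization

variable {A B S : Type} [CommRing A] [CommRing B] [CommRing S]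

/-- If a homomorphism identifies the quotients by all powers of two ideals, then so does the
homomorphism it induces on the quotients by a principal ideal and by its extension. -/
theorem comap_map_mk_pow {C : Type} [CommRing C] (θ : A →+* B) (M : Ideal A) (N : Ideal B)
    (hθ : ∀ k, (N ^ k).comap θ = M ^ k) (hdense : ∀ k b, ∃ a, b - θ a ∈ N ^ k) (F : A)
    (π : A →+* C) (hπ : Function.Surjective π) (hker : RingHom.ker π = Ideal.span {F})
    (φ : C →+* B ⧸ Ideal.span {θ F}) (hφ : ∀ a, φ (π a) = Ideal.Quotient.mk _ (θ a)) (k : ℕ) :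
    (N.map (Ideal.Quotient.mk (Ideal.span {θ F})) ^ k).comap φ = M.map π ^ k := by
  simp_rw [← Ideal.map_pow]
  ext a
  obtain ⟨a, rfl⟩ := hπ a
  rw [Ideal.mem_comap, hφ, ← Ideal.mem_comap, Ideal.comap_map_of_surjective' _
    Ideal.Quotient.mk_surjective, ← Ideal.mem_comap (f := π), Ideal.comap_map_of_surjective' _ hπ,
    hker, Ideal.mk_ker, Submodule.mem_sup]
  constructor
  · rintro ⟨g, hg, c, hc, h⟩
    obtain ⟨h', rfl⟩ := Ideal.mem_span_singleton'.1 hc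
    obtain ⟨b, hb⟩ := hdense k h'
    rw [Submodule.mem_sup]
    refine ⟨a - b * F, ?_, b * F, Ideal.mem_span_singleton'.2 ⟨b, rfl⟩, by ring⟩
    rw [← hθ, Ideal.mem_comap]
    have : θ (a - b * F) = g + (h' - θ b) * θ F := by
      rw [map_sub, map_mul, ← h]; ring
    rw [this]
    exact add_mem hg (Ideal.mul_mem_right _ _ hb)
  · intro h
    obtain ⟨g, hg, c, hc, rfl⟩ := Submodule.mem_sup.1 h
    obtain ⟨b, rfl⟩ := Ideal.mem_span_singleton'.1 hc
    rw [← hθ] at hg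
    exact ⟨θ g, hg, θ (b * F), Ideal.mem_span_singleton'.2 ⟨θ b, by simp⟩, by simp⟩

variable [Algebra A S]

/-- A homomorphism which identifies the quotients by all powers of a prime ideal and of another
ideal extends to the localization and keeps this property there. -/
theorem exists_lift_atPrime (M : Ideal A) [M.IsPrime] [IsLocalRing S] [IsLocalization.AtPrime S M]
    (N : Ideal B) (φ : A →+* B) (hφ : ∀ k, (N ^ k).comap φ = M ^ k)
    (hunit : ∀ u ∉ M, IsUnit (φ u)) :
    ∃ ψ : S →+* B, (∀ a, ψ (algebraMap A S a) = φ a) ∧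
      ∀ k, (N ^ k).comap ψ = IsLocalRing.maximalIdeal S ^ k := by
  let ψ : S →+* B := IsLocalization.lift (M := M.primeCompl) (g := φ) fun u => hunit u u.2
  have hψ (a : A) : ψ (algebraMap A S a) = φ a := IsLocalization.lift_eq _ a
  refine ⟨ψ, hψ, fun k => ?_⟩
  rw [← IsLocalization.AtPrime.map_eq_maximalIdeal M S, ← Ideal.map_pow, ← hφ]
  apply le_antisymm
  · intro s hs
    obtain ⟨a, u, rfl⟩ := IsLocalization.exists_mk'_eq M.primeCompl s
    rw [IsLocalization.mk'_eq_mul_mk'_one]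
    refine Ideal.mul_mem_right _ _ (Ideal.mem_map_of_mem _ ?_)
    rw [Ideal.mem_comap, ← hψ, ← IsLocalization.mk'_spec S a u, map_mul]
    exact Ideal.mul_mem_right _ _ hs
  · rw [Ideal.map_le_iff_le_comap]
    intro a ha
    rw [Ideal.mem_comap, Ideal.mem_comap, hψ]
    exact ha

end Localization

/-! ### Taylor expansion of plane curves at the origin -/

section PlaneCurve

variable (K : Type) [Field K]

/-- The Taylor expansion at the origin of polynomials in `x`, `u`. -/
def taylorHom : K[X][X] →+* MvPowerSeries (Fin 2) K :=
  Polynomial.eval₂RingHom (Polynomial.eval₂RingHom MvPowerSeries.C (MvPowerSeries.X 0))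
    (MvPowerSeries.X 1)

variable {K}

@[simp] theorem taylorHom_C_C (c : K) :
    taylorHom K (Polynomial.C (Polynomial.C c)) = MvPowerSeries.C c := by simp [taylorHom]

@[simp] theorem taylorHom_C_X : taylorHom K (Polynomial.C Polynomial.X) = MvPowerSeries.X 0 := by
  simp [taylorHom]

@[simp] theorem taylorHom_X : taylorHom K Polynomial.X = MvPowerSeries.X 1 := by simp [taylorHom]

theorem taylorHom_aeval (p : MvPolynomial (Fin 2) K) :
    taylorHom K (MvPolynomial.aeval ![Polynomial.C Polynomial.X, Polynomial.X] p) = p := by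
  induction p using MvPolynomial.induction_on with
  | C a =>
    rw [MvPolynomial.aeval_C, MvPolynomial.coe_C]
    exact taylorHom_C_C a
  | add p q hp hq => simp [hp, hq]
  | mul_X p i hp =>
    rw [map_mul, map_mul, hp, MvPolynomial.aeval_X, MvPolynomial.coe_mul, MvPolynomial.coe_X]
    fin_cases i <;> simp

/-- The polynomials in two variables map onto the iterated polynomial ring. -/
theorem aeval_surjective : Function.Surjective
    (MvPolynomial.aeval (R := K) ![(Polynomial.C Polynomial.X : K[X][X]), Polynomial.X]) := by
  intro p
  change p ∈ (MvPolynomial.aeval (R := K)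
    ![(Polynomial.C Polynomial.X : K[X][X]), Polynomial.X]).range
  have hX : Polynomial.X ∈ (MvPolynomial.aeval (R := K)
      ![(Polynomial.C Polynomial.X : K[X][X]), Polynomial.X]).range :=
    ⟨MvPolynomial.X 1, by simp⟩
  have hCX : Polynomial.C Polynomial.X ∈ (MvPolynomial.aeval (R := K)
      ![(Polynomial.C Polynomial.X : K[X][X]), Polynomial.X]).range :=
    ⟨MvPolynomial.X 0, by simp⟩
  have hC (q : K[X]) : Polynomial.C q ∈ (MvPolynomial.aeval (R := K)
      ![(Polynomial.C Polynomial.X : K[X][X]), Polynomial.X]).range := by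
    induction q using Polynomial.induction_on' with
    | add p q hp hq => rw [map_add]; exact add_mem hp hq
    | monomial k c =>
      rw [← Polynomial.C_mul_X_pow_eq_monomial, map_mul, map_pow]
      exact mul_mem (Subalgebra.algebraMap_mem _ c) (pow_mem hCX k)
  induction p using Polynomial.induction_on' with
  | add p q hp hq => exact add_mem hp hq
  | monomial k c =>
    rw [← Polynomial.C_mul_X_pow_eq_monomial]
    exact mul_mem (hC c) (pow_mem hX k)

theorem ker_evalAt_zero_eq_map : RingHom.ker (evalAt (0 : K) 0) =
    (MvPolynomial.idealOfVars (Fin 2) K).map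
      (MvPolynomial.aeval (R := K) ![(Polynomial.C Polynomial.X : K[X][X]), Polynomial.X]) := by
  rw [ker_evalAt, MvPolynomial.idealOfVars, Ideal.map_span, ← Set.range_comp]
  congr 1
  ext p
  simp [Fin.exists_fin_two, eq_comm]

/-- The Taylor expansion identifies the order filtration of power series with the powers of the
maximal ideal of the origin. -/
theorem comap_taylorHom_pow (k : ℕ) :
    (varIdeal (Fin 2) K ^ k).comap (taylorHom K) = RingHom.ker (evalAt (0 : K) 0) ^ k := by
  rw [ker_evalAt_zero_eq_map, ← Ideal.map_pow]
  have h (p : MvPolynomial (Fin 2) K) : (p : MvPowerSeries (Fin 2) K) ∈ varIdeal (Fin 2) K ^ k ↔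
      p ∈ MvPolynomial.idealOfVars (Fin 2) K ^ k := by
    rw [mem_varIdeal_pow_iff, MvPolynomial.mem_pow_idealOfVars_iff']
    simp
  apply le_antisymm
  · intro p hp
    obtain ⟨p, rfl⟩ := aeval_surjective p
    rw [Ideal.mem_comap, taylorHom_aeval, h] at hp
    exact Ideal.mem_map_of_mem _ hp
  · rw [Ideal.map_le_iff_le_comap]
    intro p hp
    rw [Ideal.mem_comap, Ideal.mem_comap, taylorHom_aeval, h]
    exact hp

theorem exists_sub_taylorHom_mem (k : ℕ) (G : MvPowerSeries (Fin 2) K) :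
    ∃ p, G - taylorHom K p ∈ varIdeal (Fin 2) K ^ k :=
  ⟨_, by rw [taylorHom_aeval]; exact sub_truncTotal_mem_varIdeal_pow k G⟩

theorem isUnit_taylorHom {p : K[X][X]} (hp : evalAt 0 0 p ≠ 0) : IsUnit (taylorHom K p) := by
  rw [MvPowerSeries.isUnit_iff_constantCoeff, isUnit_iff_ne_zero, Ne, ← mem_varIdeal_iff,
    ← pow_one (varIdeal (Fin 2) K), ← Ideal.mem_comap, comap_taylorHom_pow]
  rwa [show RingHom.ker (evalAt (0 : K) 0) ^ 1 = _ from pow_one _]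

/-- The linear part of `G * H` is `H(0)` times the linear part of `G`, if `G` has no constant
term. -/
theorem coeff_single_mul_of_mem {G H : MvPowerSeries (Fin 2) K} (hG : G ∈ varIdeal (Fin 2) K)
    (i : Fin 2) : MvPowerSeries.coeff (Finsupp.single i 1) (G * H) =
      MvPowerSeries.coeff (Finsupp.single i 1) G * MvPowerSeries.constantCoeff H := by
  have hH : H - MvPowerSeries.C (MvPowerSeries.constantCoeff H) ∈ varIdeal (Fin 2) K := by
    rw [mem_varIdeal_iff]; simp
  have h := Ideal.mul_mem_mul hG hH
  rw [← pow_two, mem_varIdeal_pow_iff] at h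
  have h' := h (Finsupp.single i 1) (by simp)
  rw [mul_sub, map_sub, sub_eq_zero] at h'
  rw [h', mul_comm, MvPowerSeries.coeff_C_mul, mul_comm]

variable {F : K[X][X]} {A S : Type} [CommRing A] [CommRing S] [IsLocalRing S] [Algebra A S]
  {π : K[X][X] →+* A} (hπ : Function.Surjective π) (hker : RingHom.ker π = Ideal.span {F})
  (P : Ideal A) [P.IsPrime] [IsLocalization.AtPrime S P]
  (hP : P.comap π = RingHom.ker (evalAt (0 : K) 0))

include hπ hker hP

/-- The Taylor expansion on the local ring at the origin of the plane curve `F = 0`. -/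
theorem exists_taylor_localRing :
    ∃ ψ : S →+* MvPowerSeries (Fin 2) K ⧸ Ideal.span {taylorHom K F},
      (∀ p, ψ (algebraMap A S (π p)) = Ideal.Quotient.mk _ (taylorHom K p)) ∧
      ∀ k, (((varIdeal (Fin 2) K).map (Ideal.Quotient.mk _)) ^ k).comap ψ =
        IsLocalRing.maximalIdeal S ^ k := by
  have hle : RingHom.ker π ≤ RingHom.ker
      ((Ideal.Quotient.mk (Ideal.span {taylorHom K F})).comp (taylorHom K)) := by
    rw [hker, Ideal.span_singleton_le_iff_mem, RingHom.mem_ker, RingHom.comp_apply,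
      Ideal.Quotient.eq_zero_iff_mem]
    exact Ideal.mem_span_singleton_self _
  let φ := RingHom.liftOfSurjective π hπ ⟨_, hle⟩
  have hφ (p) : φ (π p) = Ideal.Quotient.mk _ (taylorHom K p) :=
    RingHom.liftOfRightInverse_comp_apply _ _ _ _ _
  have hPM : P = (RingHom.ker (evalAt (0 : K) 0)).map π := by
    rw [← hP, Ideal.map_comap_of_surjective _ hπ]
  have hpow (k : ℕ) : ((varIdeal (Fin 2) K).map
      (Ideal.Quotient.mk (Ideal.span {taylorHom K F})) ^ k).comap φ = P ^ k := by
    rw [hPM]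
    exact comap_map_mk_pow (taylorHom K) _ _ comap_taylorHom_pow exists_sub_taylorHom_mem F π hπ
      hker φ hφ k
  have hunit (u : A) (hu : u ∉ P) : IsUnit (φ u) := by
    obtain ⟨u, rfl⟩ := hπ u
    rw [hφ]
    refine (isUnit_taylorHom ?_).map _
    rwa [← Ideal.mem_comap, hP] at hu
  obtain ⟨ψ, h₁, h₂⟩ := exists_lift_atPrime (S := S) P _ φ hpow hunit
  exact ⟨ψ, fun p => (h₁ _).trans (hφ p), h₂⟩

/-- The completed local ring at the origin of the plane curve `F = 0` is the quotient of the
power series ring by the Taylor expansion of `F`. -/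
theorem exists_completion_equiv :
    ∃ e : AdicCompletion (IsLocalRing.maximalIdeal S) S ≃+*
        MvPowerSeries (Fin 2) K ⧸ Ideal.span {taylorHom K F},
      ∀ p, e (algebraMap _ _ (algebraMap A S (π p))) =
        Ideal.Quotient.mk _ (taylorHom K p) := by
  obtain ⟨ψ, hψ, hc⟩ := exists_taylor_localRing (S := S) hπ hker P hP
  have := isAdicComplete_quotient (Ideal.span {taylorHom K F})
  obtain ⟨e, he⟩ := exists_adicCompletion_ringEquiv _ _ ψ hc fun k b => by
    obtain ⟨G, rfl⟩ := Ideal.Quotient.mk_surjective b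
    obtain ⟨p, hp⟩ := exists_sub_taylorHom_mem k G
    refine ⟨algebraMap A S (π p), ?_⟩
    rw [hψ, ← map_sub, ← Ideal.map_pow]
    exact Ideal.mem_map_of_mem _ hp
  exact ⟨e, fun p => (he _).trans (hψ p)⟩

/-- At a point where the equation of a plane curve has no terms of order less than two, the
maximal ideal of the local ring is not principal. -/
theorem not_isPrincipal_maximalIdeal
    (hF : taylorHom K F ∈ varIdeal (Fin 2) K ^ 2) :
    ¬ (IsLocalRing.maximalIdeal S).IsPrincipal := by
  rintro ⟨⟨s, hs⟩⟩
  obtain ⟨ψ, hψ, hc⟩ := exists_taylor_localRing (S := S) hπ hker P hP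
  have hc1 (s : S) : s ∈ IsLocalRing.maximalIdeal S ↔
      ψ s ∈ (varIdeal (Fin 2) K).map (Ideal.Quotient.mk (Ideal.span {taylorHom K F})) := by
    have := hc 1
    rw [pow_one, pow_one] at this
    rw [← this, Ideal.mem_comap]
  obtain ⟨G, hG⟩ := Ideal.Quotient.mk_surjective (ψ s)
  have hmem (H : MvPowerSeries (Fin 2) K) : Ideal.Quotient.mk (Ideal.span {taylorHom K F}) H ∈
      (varIdeal (Fin 2) K).map (Ideal.Quotient.mk (Ideal.span {taylorHom K F})) ↔
      H ∈ varIdeal (Fin 2) K := by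
    rw [← Ideal.mem_comap, Ideal.comap_map_of_surjective' _ Ideal.Quotient.mk_surjective,
      Ideal.mk_ker, sup_of_le_left]
    rw [Ideal.span_singleton_le_iff_mem]
    exact Ideal.pow_le_self two_ne_zero hF
  have hGm : G ∈ varIdeal (Fin 2) K := by
    rw [← hmem, hG, ← hc1, hs]
    exact Submodule.mem_span_singleton_self s
  -- if `G` generates the maximal ideal, then the linear parts of `x` and `y` are multiples of the
  -- linear part of `G`
  have key (i : Fin 2) (p : K[X][X]) (hp : taylorHom K p = MvPowerSeries.X i) :
      ∃ c : K, ∀ j, MvPowerSeries.coeff (Finsupp.single j 1) (MvPowerSeries.X i) =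
        MvPowerSeries.coeff (Finsupp.single j 1) G * c := by
    have : algebraMap A S (π p) ∈ IsLocalRing.maximalIdeal S := by
      rw [hc1, hψ, hmem, hp]
      exact Ideal.subset_span ⟨i, rfl⟩
    rw [hs] at this
    obtain ⟨r, hr⟩ := Submodule.mem_span_singleton.1 this
    obtain ⟨H, hH⟩ := Ideal.Quotient.mk_surjective (ψ r)
    have h := congrArg ψ hr
    rw [hψ, smul_eq_mul, map_mul, ← hH, ← hG, ← map_mul, hp, Ideal.Quotient.eq,
      Ideal.mem_span_singleton'] at h
    obtain ⟨L, hL⟩ := h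
    refine ⟨MvPowerSeries.constantCoeff H, fun j => ?_⟩
    rw [← coeff_single_mul_of_mem hGm, mul_comm G, ← sub_eq_zero, ← neg_eq_zero, ← map_sub,
      ← map_neg, neg_sub, ← hL]
    exact (mem_varIdeal_pow_iff 2 _).1 (Ideal.mul_mem_left _ L hF) _ (by simp)
  obtain ⟨c, h0⟩ := key 0 _ taylorHom_C_X
  obtain ⟨d, h1⟩ := key 1 _ taylorHom_X
  have h00 := h0 0
  have h01 := h0 1
  have h10 := h1 0
  have h11 := h1 1
  simp [MvPowerSeries.coeff_X, Finsupp.single_left_inj] at h00 h01 h10 h11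
  rcases h01 with h | h <;> simp [h] at h00 h11

end PlaneCurve

/-! ### Formal changes of coordinates -/

section CoordinateChange

variable {K : Type} [Field K]

theorem hasSubst_rescaleSnd (g : MvPowerSeries (Fin 2) K) :
    MvPowerSeries.HasSubst ![MvPowerSeries.X 0, g * MvPowerSeries.X 1] :=
  MvPowerSeries.hasSubst_of_constantCoeff_zero fun s => by fin_cases s <;> simp

theorem hasSubst_X_zero : PowerSeries.HasSubst (MvPowerSeries.X 0 : MvPowerSeries (Fin 2) K) :=
  PowerSeries.HasSubst.X 0

variable (K) in
/-- The inclusion of the power series in `x` into those in `x`, `y`. -/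
def inclFst : PowerSeries K →ₐ[K] MvPowerSeries (Fin 2) K :=
  PowerSeries.substAlgHom hasSubst_X_zero

theorem inclFst_X : inclFst K PowerSeries.X = MvPowerSeries.X 0 :=
  PowerSeries.substAlgHom_X hasSubst_X_zero

theorem inclFst_C (c : K) : inclFst K (PowerSeries.C c) = MvPowerSeries.C c :=
  (inclFst K).commutes c

/-- The substitution `x ↦ x`, `y ↦ u(x) y`. -/
def rescaleSnd (u : PowerSeries K) : MvPowerSeries (Fin 2) K →ₐ[K] MvPowerSeries (Fin 2) K :=
  MvPowerSeries.substAlgHom (hasSubst_rescaleSnd (inclFst K u))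

theorem rescaleSnd_X_zero (u : PowerSeries K) :
    rescaleSnd u (MvPowerSeries.X 0) = MvPowerSeries.X 0 :=
  MvPowerSeries.substAlgHom_X _ 0

theorem rescaleSnd_X_one (u : PowerSeries K) :
    rescaleSnd u (MvPowerSeries.X 1) = inclFst K u * MvPowerSeries.X 1 :=
  MvPowerSeries.substAlgHom_X _ 1

theorem rescaleSnd_inclFst (u v : PowerSeries K) :
    rescaleSnd u (inclFst K v) = inclFst K v := by
  simp only [rescaleSnd, inclFst, MvPowerSeries.coe_substAlgHom, PowerSeries.coe_substAlgHom]
  refine (MvPowerSeries.subst_comp_subst_apply hasSubst_X_zero.const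
    (hasSubst_rescaleSnd _) v).trans ?_
  rw [MvPowerSeries.subst_X (hasSubst_rescaleSnd _)]
  rfl

theorem rescaleSnd_rescaleSnd {u v : PowerSeries K} (huv : u * v = 1)
    (G : MvPowerSeries (Fin 2) K) : rescaleSnd v (rescaleSnd u G) = G := by
  rw [rescaleSnd, rescaleSnd, MvPowerSeries.substAlgHom_comp_substAlgHom_apply,
    MvPowerSeries.coe_substAlgHom]
  conv_rhs => rw [← id_eq G, ← MvPowerSeries.subst_self]
  congr 1
  funext s
  change rescaleSnd v _ = _
  fin_cases s
  · exact rescaleSnd_X_zero v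
  · simp only [Fin.mk_one, Matrix.cons_val_one, Matrix.cons_val_fin_one]
    rw [map_mul, rescaleSnd_inclFst, rescaleSnd_X_one, ← mul_assoc, ← map_mul, huv, map_one,
      one_mul]

/-- Replacing `y` by `u(x) y`, with `u` a unit, turns `y^n = u(x)^n x^m` into `y^n = x^m`. -/
theorem exists_quotient_algEquiv {u : PowerSeries K} (hu : IsUnit u) (n m : ℕ) :
    Nonempty ((MvPowerSeries (Fin 2) K ⧸ Ideal.span
        {MvPowerSeries.X 1 ^ n - inclFst K (u ^ n) * MvPowerSeries.X 0 ^ m}) ≃ₐ[K]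
      MvPowerSeries (Fin 2) K ⧸ Ideal.span
        {(MvPowerSeries.X 1 ^ n - MvPowerSeries.X 0 ^ m : MvPowerSeries (Fin 2) K)}) := by
  obtain ⟨v, huv⟩ := hu.exists_right_inv
  let e : MvPowerSeries (Fin 2) K ≃ₐ[K] MvPowerSeries (Fin 2) K :=
    AlgEquiv.ofAlgHom (rescaleSnd u) (rescaleSnd v)
      (AlgHom.ext fun G => rescaleSnd_rescaleSnd (by rwa [mul_comm]) G)
      (AlgHom.ext fun G => rescaleSnd_rescaleSnd huv G)
  refine ⟨Ideal.quotientEquivAlg _ _ e ?_⟩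
  have he : e (MvPowerSeries.X 1 ^ n - inclFst K (u ^ n) * MvPowerSeries.X 0 ^ m) =
      inclFst K (u ^ n) * (MvPowerSeries.X 1 ^ n - MvPowerSeries.X 0 ^ m) := by
    change rescaleSnd u _ = _
    simp only [map_sub, map_mul, map_pow, rescaleSnd_inclFst, rescaleSnd_X_zero,
      rescaleSnd_X_one]
    ring
  rw [Ideal.map_span, Set.image_singleton]
  refine (Ideal.span_singleton_mul_left_unit ((hu.pow n).map (inclFst K)) _).symm.trans ?_
  rw [← he]
  rfl

/-- A linear polynomial with nonzero constant term is an `n`-th power of a power series. -/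
theorem exists_pow_eq_linear [IsAlgClosed K] [CharZero K] {n : ℕ} (hn : 0 < n) {c : K}
    (hc : c ≠ 0) (d : K) :
    ∃ u : PowerSeries K, IsUnit u ∧ u ^ n = PowerSeries.C c + PowerSeries.C d * PowerSeries.X := by
  -- the root is `s (1 + (d / c) X) ^ (1 / n)` with `s ^ n = c`
  obtain ⟨s, hs⟩ := IsAlgClosed.exists_pow_nat_eq c hn
  have hpow (k : ℕ) : PowerSeries.binomialSeries K (1 / n : ℚ) ^ k =
      PowerSeries.binomialSeries K (k / n : ℚ) := by
    induction k with
    | zero => simp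
    | succ k ih =>
      rw [pow_succ, ih, ← PowerSeries.binomialSeries_add]
      congr 1; push_cast; ring
  have h1 : PowerSeries.binomialSeries K (1 / n : ℚ) ^ n = 1 + PowerSeries.X := by
    rw [hpow, div_self (by positivity)]
    simpa using PowerSeries.binomialSeries_nat (R := ℚ) (A := K) 1
  have h2 : (PowerSeries.C s * PowerSeries.rescale (d / c)
      (PowerSeries.binomialSeries K (1 / n : ℚ))) ^ n =
      PowerSeries.C c + PowerSeries.C d * PowerSeries.X := by
    rw [mul_pow, ← map_pow, ← map_pow, h1, hs, map_add, map_one, PowerSeries.rescale_X, mul_add,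
      ← mul_assoc, ← map_mul, mul_div_cancel₀ _ hc, mul_one]
  refine ⟨_, (isUnit_pow_iff hn.ne').1 ?_, h2⟩
  rw [h2, PowerSeries.isUnit_iff_constantCoeff]
  simpa using hc

/-- A plane curve singularity with equation `y^n = (c + d x) x^m`, where `c ≠ 0`, is isomorphic
to `y^n = x^m`. -/
theorem exists_quotient_algEquiv_of_linear [IsAlgClosed K] [CharZero K] {n : ℕ} (hn : 0 < n)
    (m : ℕ) {c : K} (hc : c ≠ 0) (d : K) :
    Nonempty ((MvPowerSeries (Fin 2) K ⧸ Ideal.span {MvPowerSeries.X 1 ^ n -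
        (MvPowerSeries.C c + MvPowerSeries.C d * MvPowerSeries.X 0) * MvPowerSeries.X 0 ^ m}) ≃ₐ[K]
      MvPowerSeries (Fin 2) K ⧸ Ideal.span
        {(MvPowerSeries.X 1 ^ n - MvPowerSeries.X 0 ^ m : MvPowerSeries (Fin 2) K)}) := by
  obtain ⟨u, hu, h⟩ := exists_pow_eq_linear hn hc d
  have := exists_quotient_algEquiv hu n m
  rwa [h, map_add, map_mul, inclFst_C, inclFst_C, inclFst_X] at this

end CoordinateChange

/-! ### Regularity of the local rings of plane curves -/

section Regular

/-- A local domain of dimension at most one is regular if and only if its maximal ideal is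
principal. -/
theorem isRegularLocalRing_iff_isPrincipal (S : Type) [CommRing S] [IsLocalRing S] [IsDomain S]
    [IsNoetherianRing S] [Ring.DimensionLEOne S] :
    IsRegularLocalRing S ↔ (IsLocalRing.maximalIdeal S).IsPrincipal := by
  have htfae := tfae_of_isNoetherianRing_of_isLocalRing_of_isDomain S
  constructor
  · intro h
    have h₁ := (IsRegularLocalRing.iff_finrank_cotangentSpace S).1 h
    have h₂ : ringKrullDim S ≤ (1 : ℕ) := Order.KrullDimLE.krullDim_le
    rw [← h₁] at h₂
    exact (htfae.out 4 5).2 (by exact_mod_cast h₂)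
  · intro h
    have : IsPrincipalIdealRing S := (htfae.out 0 4).2 h
    infer_instance

theorem evalAt_map_C {K : Type} [Field K] (α β : K) (k : K[X]) :
    evalAt α β (k.map Polynomial.C) = k.eval β := by
  rw [evalAt, RingHom.comp_apply, Polynomial.coe_evalRingHom, Polynomial.coe_evalRingHom,
    Polynomial.eval_map, Polynomial.eval₂_hom, Polynomial.eval_C]

theorem eq_span_of_comap_eq {K A : Type} [Field K] [CommRing A] {P : Ideal A} {π : K[X][X] →+* A}
    (hπ : Function.Surjective π) {α β : K} (hP : P.comap π = RingHom.ker (evalAt α β)) :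
    P = Ideal.span {π (Polynomial.C (Polynomial.X - Polynomial.C α)),
      π (Polynomial.X - Polynomial.C (Polynomial.C β))} := by
  rw [← Ideal.map_comap_of_surjective _ hπ P, hP, ker_evalAt, Ideal.map_span, Set.image_pair]

theorem apply_mem_iff {K A : Type} [Field K] [CommRing A] {P : Ideal A} {π : K[X][X] →+* A}
    {α β : K} (hP : P.comap π = RingHom.ker (evalAt α β)) (p : K[X][X]) :
    π p ∈ P ↔ evalAt α β p = 0 := by
  rw [← Ideal.mem_comap, hP, RingHom.mem_ker]

theorem eval_eq_pow {K A : Type} [Field K] [CommRing A] {P : Ideal A} {π : K[X][X] →+* A}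
    {α β : K} (hP : P.comap π = RingHom.ker (evalAt α β)) {n : ℕ} {g : K[X]}
    (hF : π (Polynomial.X ^ n - Polynomial.C g) = 0) : g.eval α = β ^ n := by
  have h := zero_mem P
  rw [← hF, apply_mem_iff hP, map_sub, map_pow, evalAt_X, evalAt_C, sub_eq_zero] at h
  exact h.symm

variable {A S : Type} [CommRing A] [CommRing S] [IsLocalRing S] [Algebra A S] (P : Ideal A)
  [P.IsPrime] [IsLocalization.AtPrime S P]

/-- If `P` is generated by `r` and `s`, and `s` is a multiple of `r` up to a factor outside `P`,
then `r` generates the maximal ideal of the local ring at `P`. -/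
theorem isPrincipal_maximalIdeal_of_mul_mem {r s h : A} (hP : P = Ideal.span {r, s}) (hh : h ∉ P)
    (hs : h * s ∈ Ideal.span {r}) : (IsLocalRing.maximalIdeal S).IsPrincipal := by
  refine ⟨⟨algebraMap A S r, ?_⟩⟩
  have hS : algebraMap A S s ∈ Ideal.span {algebraMap A S r} := by
    have h₁ := Ideal.mem_map_of_mem (algebraMap A S) hs
    rw [Ideal.map_span, Set.image_singleton, map_mul] at h₁
    exact (Ideal.unit_mul_mem_iff_mem _ (IsLocalization.map_units S (⟨h, hh⟩ : P.primeCompl))).1 h₁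
  rw [← IsLocalization.AtPrime.map_eq_maximalIdeal P S, hP, Ideal.map_span, Set.image_pair]
  apply le_antisymm
  · rw [Ideal.span_le, Set.insert_subset_iff, Set.singleton_subset_iff]
    exact ⟨Ideal.mem_span_singleton_self _, hS⟩
  · exact Ideal.span_mono (by simp)

variable {K : Type} [Field K] {n : ℕ} {g : K[X]} {π : K[X][X] →+* A}

open Polynomial

variable (hπ : Function.Surjective π) {α β : K} (hP : P.comap π = RingHom.ker (evalAt α β))

include hπ hP

/-- Away from the line `y = 0` the function `x` is a local coordinate on the curve
`y^n = g(x)`. -/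
theorem isPrincipal_of_ne_zero [CharZero K] (hn : 0 < n) (hF : π (X ^ n - C g) = 0) (hβ : β ≠ 0) :
    (IsLocalRing.maximalIdeal S).IsPrincipal := by
  have hg := eval_eq_pow hP hF
  obtain ⟨k, hk⟩ := sub_dvd_pow_sub_pow (X : K[X]) (C β) n
  have hkβ : k.eval β ≠ 0 := by
    have h := congrArg (fun p : K[X] => (derivative p).eval β) hk
    have h0 : n * β ^ (n - 1) = k.eval β := by simpa [derivative_pow] using h
    rw [← h0]
    exact mul_ne_zero (Nat.cast_ne_zero.2 hn.ne') (pow_ne_zero _ hβ)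
  -- the factor `k = (y^n - β^n) / (y - β)`, as a polynomial in `y` with constant coefficients
  refine isPrincipal_maximalIdeal_of_mul_mem (h := π (k.map C)) P (eq_span_of_comap_eq hπ hP)
    ?_ ?_
  · rw [apply_mem_iff hP, evalAt_map_C]
    exact hkβ
  · have h₁ : (X - C (C β) : K[X][X]) * k.map C = (X ^ n - C g) + C (g - C (g.eval α)) := by
      have h := congrArg (Polynomial.map C) hk
      rw [Polynomial.map_mul, Polynomial.map_sub, Polynomial.map_sub, Polynomial.map_pow,
        Polynomial.map_pow, map_X, map_C] at h
      rw [← h, hg]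
      simp
    rw [mul_comm, ← map_mul, h₁, map_add, hF, zero_add]
    obtain ⟨c, hc⟩ := X_sub_C_dvd_sub_C_eval (p := g) (a := α)
    rw [hc, C_mul, map_mul]
    exact Ideal.mul_mem_right _ _ (Ideal.mem_span_singleton_self _)

/-- At a simple zero of `g` the function `y` is a local coordinate on the curve `y^n = g(x)`. -/
theorem isPrincipal_of_eval_ne_zero (hn : 0 < n) (hF : π (X ^ n - C g) = 0) (hβ : β = 0) {k : K[X]}
    (hg : g = (X - C α) * k) (hk : k.eval α ≠ 0) : (IsLocalRing.maximalIdeal S).IsPrincipal := by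
  refine isPrincipal_maximalIdeal_of_mul_mem (r := π (X - C (C β))) (s := π (C (X - C α)))
    (h := π (C k)) P ((eq_span_of_comap_eq hπ hP).trans (by rw [Set.pair_comm])) ?_ ?_
  · rw [apply_mem_iff hP, evalAt_C]
    exact hk
  · rw [map_sub, sub_eq_zero] at hF
    rw [← map_mul, ← C_mul, mul_comm, ← hg, ← hF, hβ, C_0, C_0, sub_zero, map_pow]
    exact Ideal.pow_mem_of_mem _ (Ideal.mem_span_singleton_self _) _ hn

end Regular

/-! ### The local rings of the curves `y^n = c x^n + x^m` -/

section LocalRings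

open Polynomial

variable {K : Type} [Field K] {n : ℕ}

theorem taylorHom_mem_varIdeal_sq (hn : 2 ≤ n) {m : ℕ} (hm : 2 ≤ m) (c : K) :
    taylorHom K (X ^ n - C (C c * X ^ n + X ^ m)) ∈ varIdeal (Fin 2) K ^ 2 := by
  have h (i : Fin 2) {k : ℕ} (hk : 2 ≤ k) :
      (MvPowerSeries.X i : MvPowerSeries (Fin 2) K) ^ k ∈ varIdeal (Fin 2) K ^ 2 :=
    Ideal.pow_le_pow_right hk (Ideal.pow_mem_pow (Ideal.subset_span (Set.mem_range_self i)) k)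
  simp only [map_sub, map_add, map_mul, map_pow, taylorHom_X, taylorHom_C_X, taylorHom_C_C]
  exact sub_mem (h 1 hn) (add_mem (Ideal.mul_mem_left _ _ (h 0 hn)) (h 0 hm))

section Dimension

variable {g : K[X]} {A : Type} [CommRing A] [IsDomain A] {π : K[X][X] →+* A}

theorem dimensionLEOne_of_curve (hn : 0 < n) (hπ : Function.Surjective π)
    (hker : RingHom.ker π = Ideal.span {X ^ n - C g}) : Ring.DimensionLEOne A := by
  let := (π.comp C).toAlgebra
  have : Module.Finite K[X] A := finite_comp_C hn hπ hker
  exact Ring.DimensionLEOne.of_isIntegral K[X] A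

end Dimension

section Completion

variable {A S : Type} [CommRing A] [CommRing S]
  [IsLocalRing S] [Algebra A S] {π : K[X][X] →+* A} (hπ : Function.Surjective π) (P : Ideal A)
  [P.IsPrime] [IsLocalization.AtPrime S P]

include hπ

/-- The description of the completed local ring at the origin, transported along an isomorphism of
`K`-algebras; the resulting isomorphism respects the constants. -/
theorem exists_completion_equiv_of_algEquiv {F : K[X][X]} (hker : RingHom.ker π = Ideal.span {F})
    (hP : P.comap π = RingHom.ker (evalAt (0 : K) 0)) {G : MvPowerSeries (Fin 2) K}
    (hG : taylorHom K F = G) {B : Type} [CommRing B] [Algebra K B]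
    (e' : (MvPowerSeries (Fin 2) K ⧸ Ideal.span {G}) ≃ₐ[K] B) :
    ∃ e : AdicCompletion (IsLocalRing.maximalIdeal S) S ≃+* B,
      ∀ a, e (algebraMap _ _ (algebraMap A S (π (C (C a))))) = algebraMap K B a := by
  subst hG
  obtain ⟨e, he⟩ := exists_completion_equiv (S := S) hπ hker P hP
  refine ⟨e.trans e'.toRingEquiv, fun a => ?_⟩
  have h := he (C (C a))
  rw [taylorHom_C_C] at h
  exact (congrArg e' h).trans (e'.commutes a)

end Completion

variable {A S : Type} [CommRing A] [IsDomain A] [CommRing S]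
  [IsLocalRing S] [Algebra A S] {π : K[X][X] →+* A} (hπ : Function.Surjective π) (P : Ideal A)
  [P.IsPrime] [IsLocalization.AtPrime S P]

include hπ P

/-- The local rings of an integral curve `y^n = g(x)`, that of the generic point included, are
regular if and only if their maximal ideal is principal. -/
theorem isRegularLocalRing_iff_of_curve {g : K[X]} (hn : 0 < n)
    (hker : RingHom.ker π = Ideal.span {X ^ n - C g}) :
    IsRegularLocalRing S ↔ (IsLocalRing.maximalIdeal S).IsPrincipal := by
  have := dimensionLEOne_of_curve hn hπ hker
  have : IsNoetherianRing A := isNoetherianRing_of_surjective _ _ π hπ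
  have hle : P.primeCompl ≤ nonZeroDivisors A := P.primeCompl_le_nonZeroDivisors
  have := IsLocalization.isDomain_of_le_nonZeroDivisors S hle
  have := IsLocalization.isNoetherianRing P.primeCompl S inferInstance
  have := Ring.DimensionLEOne.localization S hle
  exact isRegularLocalRing_iff_isPrincipal S

variable [CharZero K]

/-- The only singular point of the integral curve `y^n = c x^n + x^(n+1)` is the origin: a further
point of it on the line `y = 0` is `x = -c`, where the right hand side has a simple zero. -/
theorem not_isRegularLocalRing_iff₀ [IsAlgClosed K] (hn : 2 ≤ n) (c : K)
    (hker : RingHom.ker π = Ideal.span {X ^ n - C (C c * X ^ n + X ^ (n + 1))}) :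
    ¬ IsRegularLocalRing S ↔ P.comap π = RingHom.ker (evalAt (0 : K) 0) := by
  have hn0 : 0 < n := by omega
  rw [isRegularLocalRing_iff_of_curve hπ P hn0 hker]
  have hF : π (X ^ n - C (C c * X ^ n + X ^ (n + 1))) = 0 := by
    rw [← RingHom.mem_ker, hker]; exact Ideal.mem_span_singleton_self _
  constructor
  · intro h
    -- the local ring at the generic point is a field
    have hbot : P ≠ ⊥ := by
      rintro rfl
      refine h ⟨⟨0, ?_⟩⟩
      rw [← IsLocalization.AtPrime.map_eq_maximalIdeal (⊥ : Ideal A) S, Ideal.map_bot]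
      simp
    obtain ⟨α, β, hP⟩ := exists_comap_eq_ker_evalAt hn0 hπ hker P hbot
    have hβ : β = 0 := by
      by_contra hβ
      exact h (isPrincipal_of_ne_zero P hπ hP hn0 hF hβ)
    have hα : α = 0 := by
      by_contra hα
      have he := eval_eq_pow hP hF
      rw [hβ, zero_pow hn0.ne'] at he
      have he' : α ^ n * (α + c) = 0 := by
        rw [← he]; simp; ring
      have hc : c = -α := by
        rw [eq_neg_iff_add_eq_zero, add_comm]
        exact (mul_eq_zero.1 he').resolve_left (pow_ne_zero n hα)
      refine h (isPrincipal_of_eval_ne_zero P hπ hP hn0 hF hβ (k := X ^ n) ?_ ?_)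
      · rw [hc, C_neg]; ring
      · simpa [hn0.ne'] using hα
    rw [hP, hα, hβ]
  · intro hP
    exact not_isPrincipal_maximalIdeal hπ hker P hP
      (taylorHom_mem_varIdeal_sq hn (by omega) c)

/-- The origin is a singular point of the integral curve `y^n = c x^n + x^(n-1)` if and only if
`n ≥ 3`; for `n = 2` the right hand side has a simple zero there. -/
theorem not_isRegularLocalRing_iff₁ (hn : 2 ≤ n) (c : K)
    (hker : RingHom.ker π = Ideal.span {X ^ n - C (C c * X ^ n + X ^ (n - 1))})
    (hP : P.comap π = RingHom.ker (evalAt (0 : K) 0)) :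
    ¬ IsRegularLocalRing S ↔ 3 ≤ n := by
  have hn0 : 0 < n := by omega
  rw [isRegularLocalRing_iff_of_curve hπ P hn0 hker]
  have hF : π (X ^ n - C (C c * X ^ n + X ^ (n - 1))) = 0 := by
    rw [← RingHom.mem_ker, hker]; exact Ideal.mem_span_singleton_self _
  constructor
  · intro h
    by_contra h3
    obtain rfl : n = 2 := by omega
    refine h (isPrincipal_of_eval_ne_zero P hπ hP hn0 hF rfl (k := C c * X + 1) ?_ ?_)
    · rw [C_0]; ring
    · simp
  · intro h3
    exact not_isPrincipal_maximalIdeal hπ hker P hP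
      (taylorHom_mem_varIdeal_sq hn (by omega) c)

end LocalRings

/-! ### Stalks at the points of an affine chart -/

section Stalks

/-- The stalk of a `ℂ`-scheme at a point `P` of an affine open chart `Spec A` is the localization
of the `ℂ`-algebra `A` at `P`. -/
theorem exists_stalk_algebra {C : Scheme.{0}} {A : Type} [CommRing A]
    (j : Spec (CommRingCat.of A) ⟶ C) [IsOpenImmersion j] (s : C ⟶ Spec (CommRingCat.of ℂ))
    (σ : ℂ →+* A) (h : j ≫ s = Spec.map (CommRingCat.ofHom σ)) (P : PrimeSpectrum A) :
    ∃ _ : Algebra A (C.presheaf.stalk (j P)),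
      IsLocalization.AtPrime (C.presheaf.stalk (j P)) P.asIdeal ∧
      ∀ c, algebraMap A (C.presheaf.stalk (j P)) (σ c) = constants s (j P) c := by
  let x : Spec (CommRingCat.of A) := P
  let i : C.presheaf.stalk (j P) ≅ CommRingCat.of (Localization.AtPrime P.asIdeal) :=
    asIso (j.stalkMap x) ≪≫ Spec.stalkIso (CommRingCat.of A) P
  let e : C.presheaf.stalk (j P) ≃+* Localization.AtPrime P.asIdeal := i.commRingCatIsoToRingEquiv
  let alg : Algebra A (C.presheaf.stalk (j P)) :=
    ((e.symm : _ →+* _).comp (algebraMap A (Localization.AtPrime P.asIdeal))).toAlgebra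
  let e' : Localization.AtPrime P.asIdeal ≃ₐ[A] C.presheaf.stalk (j P) :=
    AlgEquiv.ofRingEquiv (f := e.symm) fun _ => rfl
  refine ⟨alg, IsLocalization.isLocalization_of_algEquiv P.asIdeal.primeCompl e', fun c => ?_⟩
  have key : (Scheme.ΓSpecIso (CommRingCat.of ℂ)).inv ≫ s.appTop ≫
      C.presheaf.germ ⊤ (j P) trivial ≫ i.hom =
      CommRingCat.ofHom σ ≫
        CommRingCat.ofHom (algebraMap A (Localization.AtPrime P.asIdeal)) := by
    have h₁ : C.presheaf.germ ⊤ (j P) trivial ≫ i.hom = j.appTop ≫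
        (Spec (CommRingCat.of A)).presheaf.germ ⊤ P trivial ≫
          (Spec.stalkIso (CommRingCat.of A) P).hom := by
      have h₂ := Scheme.Hom.germ_stalkMap j ⊤ P trivial
      simp only [i, Iso.trans_hom, asIso_hom]
      rw [reassoc_of% h₂]
      rfl
    rw [h₁, Spec.germ_stalkMapIso_hom, ← Category.assoc s.appTop, ← Scheme.Hom.comp_appTop, h,
      ← Scheme.ΓSpecIso_inv_naturality_assoc, Iso.inv_hom_id_assoc]
  have hc : e (constants s (j P) c) = algebraMap A _ (σ c) := congr($(key).hom c)
  change e.symm (algebraMap A _ (σ c)) = _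
  rw [← hc, e.symm_apply_apply]

end Stalks

/-! ### Points of spectral curves -/

section Overlap

variable {R : Type} [CommRing R]

/-- The overlap is the open subset `z ≠ 0` of the chart at infinity. -/
theorem mem_range_comap_chartHom₁ (y : PrimeSpectrum R[X][X])
    (hy : Polynomial.C Polynomial.X ∉ y.asIdeal) :
    y ∈ Set.range (PrimeSpectrum.comap (chartHom₁ R)) := by
  let : Algebra R[X][X] R[T;T⁻¹][X] := Polynomial.algebra R[X] R[T;T⁻¹]
  have hloc := Polynomial.isLocalization (Submonoid.powers (Polynomial.X : R[X])) R[T;T⁻¹]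
  rw [Submonoid.map_powers] at hloc
  have hrange := PrimeSpectrum.localization_away_comap_range R[T;T⁻¹][X]
    (Polynomial.C (Polynomial.X : R[X]))
  have hy' : y ∈ (PrimeSpectrum.basicOpen (Polynomial.C (Polynomial.X : R[X])) :
    Set (PrimeSpectrum R[X][X])) := hy
  rw [← hrange] at hy'
  obtain ⟨w, rfl⟩ := hy'
  refine ⟨PrimeSpectrum.comap (overlapHom R) w, ?_⟩
  rw [← PrimeSpectrum.comap_comp_apply, chartHom₁_eq, ← RingHom.comp_assoc,
    RingHom.ext (overlapHom_overlapHom R) (f := (overlapHom R).comp (overlapHom R))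
      (g := RingHom.id _)]
  rfl

/-- The point `y` of the chart at infinity lies in the other chart if and only if `z ≠ 0` there. -/
theorem Tot.chart₁_mem_range_chart₀_iff (y : PrimeSpectrum R[X][X]) :
    Tot.chart₁ R y ∈ Set.range (Tot.chart₀ R) ↔ Polynomial.C Polynomial.X ∉ y.asIdeal := by
  constructor
  · rintro ⟨u, hu⟩ hy
    obtain ⟨w, -, hw⟩ := pushout_inl_eq_inr _ _ hu
    have hmem : chartHom₁ R (Polynomial.C Polynomial.X) ∈ PrimeSpectrum.asIdeal w := by
      have hy' : PrimeSpectrum.comap (chartHom₁ R) w = y := hw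
      rw [← hy'] at hy
      exact hy
    have hunit : IsUnit (chartHom₁ R (Polynomial.C Polynomial.X)) := by
      have := (LaurentPolynomial.isUnit_T (R := R) (-1)).map Polynomial.C
      simpa [chartHom₁] using this
    exact w.isPrime.ne_top (Ideal.eq_top_of_isUnit_mem _ hmem hunit)
  · intro hy
    obtain ⟨w, hw⟩ := mem_range_comap_chartHom₁ y hy
    refine ⟨Spec.map (CommRingCat.ofHom (chartHom₀ R)) w, ?_⟩
    have h := congr($(Tot.chart_condition R) w)
    exact h.trans (congrArg (Tot.chart₁ R) hw)

/-- The origin, as a point of the spectrum, is the kernel of the evaluation at `(0, 0)`. -/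
theorem origin_asIdeal (K : Type) [Field K] :
    PrimeSpectrum.asIdeal (R := K[X][X]) (origin K) = RingHom.ker (evalAt (0 : K) 0) := by
  have h : PrimeSpectrum.asIdeal (R := K[X][X]) (origin K) =
      (IsLocalRing.maximalIdeal K).comap (evalAt (0 : K) 0) := by
    simp only [evalAt, Polynomial.C_0]
    rfl
  rw [h, IsLocalRing.maximalIdeal_eq_bot]
  rfl

theorem C_X_mem_origin (K : Type) [Field K] :
    Polynomial.C Polynomial.X ∈ PrimeSpectrum.asIdeal (R := K[X][X]) (origin K) := by
  rw [origin_asIdeal, RingHom.mem_ker, evalAt_C, Polynomial.eval_X]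

theorem Tot.chart₁_origin_notMem_range (K : Type) [Field K] :
    Tot.chart₁ K (origin K) ∉ Set.range (Tot.chart₀ K) := by
  exact fun h => (Tot.chart₁_mem_range_chart₀_iff (origin K)).1 h (C_X_mem_origin K)

end Overlap

section Points

variable {K : Type} [Field K] {n : ℕ} (a : HitchinBase n K)

open spectralCurve

theorem spectralCurve.ι_chart₀ (P : PrimeSpectrum (Coord₀ a)) : ι a (chart₀ a P) =
    Tot.chart₀ K (PrimeSpectrum.comap (Ideal.Quotient.mk (Ideal.span {a.eqn₀})) P) := by
  have h := congr($(chart₀_ι a) P)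
  exact h

theorem spectralCurve.ι_chart₁ (P : PrimeSpectrum (Coord₁ a)) : ι a (chart₁ a P) =
    Tot.chart₁ K (PrimeSpectrum.comap (Ideal.Quotient.mk (Ideal.span {a.eqn₁})) P) := by
  have h := congr($(chart₁_ι a) P)
  exact h

/-- A point of the spectral curve lies in its first chart as soon as it does so in `Tot(O(2))`. -/
theorem spectralCurve.mem_range_chart₀_iff (r : spectralCurve a) :
    r ∈ Set.range (chart₀ a) ↔ ι a r ∈ Set.range (Tot.chart₀ K) := by
  constructor
  · rintro ⟨P, rfl⟩
    exact ⟨_, (ι_chart₀ a P).symm⟩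
  · rintro ⟨u, hu⟩
    obtain ⟨w, hw, -⟩ := Scheme.Pullback.exists_preimage_pullback r u hu.symm
    refine ⟨(isPullback_chart₀ a).isoPullback.inv w, ?_⟩
    exact congr($((isPullback_chart₀ a).isoPullback_inv_fst) w).trans hw

theorem exists_comap_mk_eq {A : Type} [CommRing A] {F : A} (y : PrimeSpectrum A)
    (h : F ∈ y.asIdeal) :
    ∃ P, PrimeSpectrum.comap (Ideal.Quotient.mk (Ideal.span {F})) P = y := by
  have : y ∈ Set.range (PrimeSpectrum.comap (Ideal.Quotient.mk (Ideal.span {F}))) := by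
    rw [range_comap_of_surjective _ _ Ideal.Quotient.mk_surjective, Ideal.mk_ker,
      PrimeSpectrum.mem_zeroLocus]
    exact (Ideal.span_singleton_le_iff_mem _).2 h
  exact this

theorem comap_eq_origin_iff {A : Type} [CommRing A] (π : K[X][X] →+* A) (P : PrimeSpectrum A) :
    PrimeSpectrum.comap π P = origin K ↔ P.asIdeal.comap π = RingHom.ker (evalAt (0 : K) 0) := by
  rw [← origin_asIdeal]
  exact PrimeSpectrum.ext_iff

end Points

/-! ### Companion matrices and cyclic Higgs bundles -/

section Companion

variable {n : ℕ} {S : Type} [CommRing S]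

/-- The companion matrix of `X ^ n - g`: it sends each basis vector to the next one, and the last
one to `g` times the first one. -/
def companionMatrix (n : ℕ) (g : S) : Matrix (Fin n) (Fin n) S :=
  fun i j => if (i : ℕ) = j + 1 then 1 else if (i : ℕ) = 0 ∧ (j : ℕ) + 1 = n then g else 0

theorem trace_companionMatrix (hn : 2 ≤ n) (g : S) : (companionMatrix n g).trace = 0 := by
  refine Finset.sum_eq_zero fun i _ => ?_
  rw [Matrix.diag_apply, companionMatrix, if_neg (by omega), if_neg (by omega)]

theorem map_companionMatrix {S' : Type} [CommRing S'] (f : S →+* S') (g : S) :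
    (companionMatrix n g).map f = companionMatrix n (f g) := by
  ext i j
  simp only [Matrix.map_apply, companionMatrix]
  split_ifs <;> simp

theorem companionMatrix_mulVec_single {k : ℕ} (hk : k + 1 < n) (g : S) :
    (companionMatrix n g).mulVec (Pi.single ⟨k, by omega⟩ 1) = Pi.single ⟨k + 1, hk⟩ 1 := by
  rw [Matrix.mulVec_single_one]
  funext i
  rw [Matrix.col_apply, companionMatrix, Pi.single_apply]
  simp only [Fin.ext_iff]
  congr 1
  rw [if_neg (by omega)]

theorem companionMatrix_mulVec_single_last (hn : 0 < n) (g : S) :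
    (companionMatrix n g).mulVec (Pi.single ⟨n - 1, by omega⟩ 1) = Pi.single ⟨0, hn⟩ g := by
  rw [Matrix.mulVec_single_one]
  funext i
  rw [Matrix.col_apply, companionMatrix, Pi.single_apply, if_neg (by simp only []; omega)]
  simp only [Fin.ext_iff]
  congr 1
  rw [eq_iff_iff]
  constructor <;> intro h <;> omega

theorem companionMatrix_pow_mulVec_single (hn : 0 < n) (g : S) {k : ℕ} (hk : k < n) :
    (companionMatrix n g ^ k).mulVec (Pi.single ⟨0, hn⟩ 1) = Pi.single ⟨k, hk⟩ 1 := by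
  induction k with
  | zero => rw [pow_zero, Matrix.one_mulVec]
  | succ k ih =>
    rw [pow_succ', ← Matrix.mulVec_mulVec, ih (by omega), companionMatrix_mulVec_single]

/-- By the Cayley–Hamilton theorem the characteristic polynomial annihilates the first basis
vector, whose images under the powers of the matrix are the other basis vectors. -/
theorem charpoly_companionMatrix (hn : 0 < n) (g : S) :
    (companionMatrix n g).charpoly = Polynomial.X ^ n - Polynomial.C g := by
  nontriviality S
  set M := companionMatrix n g with hM
  have hdeg : M.charpoly.natDegree = n := by simp
  have hsum : M.charpoly = Polynomial.X ^ n +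
      ∑ k : Fin n, Polynomial.C (M.charpoly.coeff k) * Polynomial.X ^ (k : ℕ) := by
    have h := M.charpoly_monic.as_sum
    rw [hdeg] at h
    rw [Fin.sum_univ_eq_sum_range fun k => Polynomial.C (M.charpoly.coeff k) * Polynomial.X ^ k]
    exact h
  have hMn : (M ^ n).mulVec (Pi.single ⟨0, hn⟩ 1) = Pi.single ⟨0, hn⟩ g := by
    obtain ⟨m, rfl⟩ : ∃ m, n = m + 1 := ⟨n - 1, by omega⟩
    rw [pow_succ', ← Matrix.mulVec_mulVec, companionMatrix_pow_mulVec_single hn g (by omega)]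
    exact companionMatrix_mulVec_single_last hn g
  have hCH : (Polynomial.aeval M M.charpoly).mulVec (Pi.single ⟨0, hn⟩ 1) = 0 := by
    rw [Matrix.aeval_self_charpoly, Matrix.zero_mulVec]
  have hcoeff (k : Fin n) : M.charpoly.coeff k = if (k : ℕ) = 0 then -g else 0 := by
    rw [hsum, map_add, map_sum, Matrix.add_mulVec, Matrix.sum_mulVec, map_pow, Polynomial.aeval_X,
      hMn] at hCH
    have h := congrFun hCH k
    have hterm (i : Fin n) : (Polynomial.aeval M
        (Polynomial.C (M.charpoly.coeff i) * Polynomial.X ^ (i : ℕ))).mulVec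
          (Pi.single ⟨0, hn⟩ 1) k = if k = i then M.charpoly.coeff i else 0 := by
      rw [map_mul, Polynomial.aeval_C, map_pow, Polynomial.aeval_X, ← Algebra.smul_def,
        Matrix.smul_mulVec, hM, companionMatrix_pow_mulVec_single hn g i.2, Pi.smul_apply,
        Pi.single_apply]
      simp
    rw [Pi.add_apply, Finset.sum_apply, Finset.sum_congr rfl fun i _ => hterm i,
      Finset.sum_ite_eq, if_pos (Finset.mem_univ k), Pi.single_apply, Pi.zero_apply] at h
    rw [eq_neg_of_add_eq_zero_right h]
    simp only [Fin.ext_iff]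
    split_ifs <;> simp
  rw [hsum, Fintype.sum_eq_single ⟨0, hn⟩]
  · rw [hcoeff, if_pos rfl, pow_zero, mul_one, map_neg, sub_eq_add_neg]
  · intro k hk
    rw [hcoeff, if_neg fun h => hk (Fin.ext h), map_zero, zero_mul]

end Companion

section Higgs

variable {R : Type} [CommRing R] {n : ℕ}

/-- The point of the Hitchin base whose only nonzero component is the one of degree `n`. -/
def HitchinBase.top (s : sectionsO R (2 * n)) : HitchinBase n R :=
  fun i => if h : (i : ℕ) = n then ⟨s.1, by rw [h]; exact s.2⟩ else 0

theorem HitchinBase.top_apply_self (hn : 2 ≤ n) (s : sectionsO R (2 * n)) :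
    (top s ⟨n, hn, le_rfl⟩).1 = s.1 := by
  rw [top, dif_pos rfl]

theorem HitchinBase.top_apply_of_ne (s : sectionsO R (2 * n)) (i : Set.Icc 2 n)
    (hi : (i : ℕ) ≠ n) : top s i = 0 := dif_neg hi

theorem sum_top (hn : 2 ≤ n) (s : sectionsO R (2 * n)) (f : R[X] × R[X] →+ R[X]) :
    ∑ i : Set.Icc 2 n, Polynomial.C (f (HitchinBase.top s i).1) *
      (Polynomial.X : R[X][X]) ^ (n - (i : ℕ)) = Polynomial.C (f s.1) := by
  rw [Fintype.sum_eq_single ⟨n, hn, le_rfl⟩]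
  · rw [HitchinBase.top_apply_self hn, Nat.sub_self, pow_zero, mul_one]
  · intro i hi
    rw [HitchinBase.top_apply_of_ne s i fun h => hi (Subtype.ext h)]
    simp

theorem HitchinBase.eqn₀_top (hn : 2 ≤ n) (s : sectionsO R (2 * n)) :
    (top s).eqn₀ = Polynomial.X ^ n + Polynomial.C s.1.1 :=
  congrArg (_ + ·) (sum_top hn s (AddMonoidHom.fst _ _))

theorem HitchinBase.eqn₁_top (hn : 2 ≤ n) (s : sectionsO R (2 * n)) :
    (top s).eqn₁ = Polynomial.X ^ n + Polynomial.C s.1.2 :=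
  congrArg (_ + ·) (sum_top hn s (AddMonoidHom.snd _ _))

/-- The bundle `O(n - 1) ⊕ O(n - 3) ⊕ ⋯ ⊕ O(1 - n)` has trivial determinant. -/
theorem prod_zpow_T (n : ℕ) :
    ∏ i : Fin n, (LaurentPolynomial.T ((n : ℤ) - 1 - 2 * i) : R[T;T⁻¹]) = 1 := by
  have h (s : Finset (Fin n)) (e : Fin n → ℤ) :
      ∏ i ∈ s, (LaurentPolynomial.T (e i) : R[T;T⁻¹]) = LaurentPolynomial.T (∑ i ∈ s, e i) := by
    induction s using Finset.cons_induction with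
    | empty => simp
    | cons i s hi ih => rw [Finset.prod_cons, Finset.sum_cons, LaurentPolynomial.T_add, ih]
  rw [h, ← LaurentPolynomial.T_zero]
  congr 1
  rw [Fin.sum_univ_eq_sum_range (fun i => (n : ℤ) - 1 - 2 * i), Finset.sum_sub_distrib,
    ← Finset.mul_sum]
  have h2 := Finset.sum_range_id_mul_two n
  simp only [Finset.sum_const, Finset.card_range, nsmul_eq_mul]
  rcases n with _ | n
  · simp
  · have h3 : ((∑ i ∈ Finset.range (n + 1), i : ℕ) : ℤ) * 2 = (n + 1) * n := by
      exact_mod_cast h2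
    push_cast at h3 ⊢
    linarith

/-- The transition matrix of the bundle `O(n - 1) ⊕ O(n - 3) ⊕ ⋯ ⊕ O(1 - n)`. -/
def cyclicTransition (n : ℕ) (R : Type) [CommRing R] :
    Matrix.SpecialLinearGroup (Fin n) R[T;T⁻¹] :=
  ⟨Matrix.diagonal fun i => LaurentPolynomial.T ((n : ℤ) - 1 - 2 * i), by
    rw [Matrix.det_diagonal, prod_zpow_T]⟩

/-- The cyclic Higgs bundle on `O(n - 1) ⊕ O(n - 3) ⊕ ⋯ ⊕ O(1 - n)` whose Higgs field is given in
both charts by companion matrices. -/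
def cyclicHiggsBundle (hn : 2 ≤ n) (s : sectionsO R (2 * n)) : HiggsBundle n R where
  g := cyclicTransition n R
  φ₀ := companionMatrix n (-s.1.1)
  φ₁ := companionMatrix n (-s.1.2)
  trace_φ₀ := trace_companionMatrix hn _
  trace_φ₁ := trace_companionMatrix hn _
  compat := by
    have hs : s.1.1.toLaurent = LaurentPolynomial.T (2 * n : ℕ) *
      LaurentPolynomial.invert s.1.2.toLaurent := s.2
    have h₀ : (companionMatrix n (-s.1.1)).map Polynomial.toLaurent =
        companionMatrix n (-s.1.1.toLaurent) := by
      rw [← map_neg]; exact map_companionMatrix _ _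
    have h₁ : (companionMatrix n (-s.1.2)).map
        (fun p => LaurentPolynomial.invert p.toLaurent) =
        companionMatrix n (-LaurentPolynomial.invert s.1.2.toLaurent) := by
      rw [← map_neg, ← map_neg]
      exact map_companionMatrix ((LaurentPolynomial.invert (R := R) : R[T;T⁻¹] →+* R[T;T⁻¹]).comp
        Polynomial.toLaurent) _
    have hconj : companionMatrix n (-s.1.1.toLaurent) *
        (cyclicTransition n R : Matrix (Fin n) (Fin n) R[T;T⁻¹]) =
        (LaurentPolynomial.T 2 : R[T;T⁻¹]) •
          ((cyclicTransition n R : Matrix (Fin n) (Fin n) R[T;T⁻¹]) *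
            companionMatrix n (-LaurentPolynomial.invert s.1.2.toLaurent)) := by
      have hD : (cyclicTransition n R : Matrix (Fin n) (Fin n) R[T;T⁻¹]) =
        Matrix.diagonal fun i : Fin n => LaurentPolynomial.T ((n : ℤ) - 1 - 2 * i) := rfl
      refine Matrix.ext fun i j => ?_
      rw [hD, Matrix.smul_apply, smul_eq_mul]
      rw [Matrix.mul_diagonal, Matrix.diagonal_mul, companionMatrix, companionMatrix, ← mul_assoc,
        ← LaurentPolynomial.T_add]
      split_ifs with hij hij
      · rw [one_mul, mul_one, show (n : ℤ) - 1 - 2 * j = 2 + (n - 1 - 2 * i) by omega]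
      · rw [hs, neg_mul, mul_neg, mul_right_comm, ← LaurentPolynomial.T_add,
          show ((2 * n : ℕ) : ℤ) + (n - 1 - 2 * j) = 2 + (n - 1 - 2 * i) by omega]
      · rw [zero_mul, mul_zero]
    rw [h₀, h₁, ← smul_mul_assoc, ← hconj, mul_assoc, ← Matrix.SpecialLinearGroup.coe_mul,
      mul_inv_cancel, Matrix.SpecialLinearGroup.coe_one, mul_one]

/-- Every point of the Hitchin base supported in degree `n` lies in the image of the Hitchin map. -/
theorem hitchinMap_cyclicHiggsBundle (hn : 2 ≤ n) (s : sectionsO R (2 * n)) :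
    (cyclicHiggsBundle hn s).hitchinMap = HitchinBase.top s := by
  have h (g : R[X]) (i : Set.Icc 2 n) : (companionMatrix n (-g)).charpoly.coeff (n - (i : ℕ)) =
      if (i : ℕ) = n then g else 0 := by
    have hi := i.2
    rw [charpoly_companionMatrix (by omega), map_neg, sub_neg_eq_add, Polynomial.coeff_add,
      Polynomial.coeff_X_pow, if_neg (by have := hi.1; omega), zero_add, Polynomial.coeff_C]
    congr 1
    rw [eq_iff_iff]
    have := hi.2
    omega
  funext i
  refine Subtype.ext ?_
  change ((companionMatrix n (-s.1.1)).charpoly.coeff (n - (i : ℕ)),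
    (companionMatrix n (-s.1.2)).charpoly.coeff (n - (i : ℕ))) = _
  rw [h, h, HitchinBase.top]
  split_ifs <;> rfl

end Higgs

/-! ### Local equations of spectral curves over the complex numbers -/

section LocalEquation

/-- At the origin of a chart isomorphic to a plane curve `F = 0`, a scheme has the local equation
`H = 0` as soon as the Taylor expansion of `F` defines the same singularity as `H`. -/
theorem hasLocalEquation_of_chart {C : Scheme.{0}} {A : Type} [CommRing A]
    (j : Spec (CommRingCat.of A) ⟶ C) [IsOpenImmersion j] (s : C ⟶ Spec (CommRingCat.of ℂ))
    {π : ℂ[X][X] →+* A} (hπ : Function.Surjective π) {F : ℂ[X][X]}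
    (hker : RingHom.ker π = Ideal.span {F})
    (h : j ≫ s = Spec.map (CommRingCat.ofHom (π.comp (Polynomial.C.comp Polynomial.C))))
    (P : PrimeSpectrum A) (hP : PrimeSpectrum.comap π P = origin ℂ)
    {G H : MvPowerSeries (Fin 2) ℂ} (hG : taylorHom ℂ F = G)
    (e : (MvPowerSeries (Fin 2) ℂ ⧸ Ideal.span {G}) ≃ₐ[ℂ]
      MvPowerSeries (Fin 2) ℂ ⧸ Ideal.span {H}) :
    HasLocalEquation s (j P) H := by
  obtain ⟨alg, hloc, hconst⟩ := exists_stalk_algebra j s _ h P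
  obtain ⟨e', he'⟩ := exists_completion_equiv_of_algEquiv (S := C.presheaf.stalk (j P))
    hπ P.asIdeal hker ((comap_eq_origin_iff _ _).1 hP) hG e
  exact ⟨e', fun c => by rw [← hconst]; exact he' c⟩

end LocalEquation

/-! ### The degenerating family -/

section Family

/-- The pair `x^n`, `z^n` and the pair `x^(n+1)`, `z^(n-1)` are sections of `O(2n)`. -/
theorem mem_sectionsO_of_pos {R : Type} [CommRing R] {n : ℕ} (hn : 0 < n) (c τ : R) :
    (-(Polynomial.C τ * Polynomial.X ^ n + Polynomial.C c * Polynomial.X ^ (n + 1)),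
      -(Polynomial.C τ * Polynomial.X ^ n + Polynomial.C c * Polynomial.X ^ (n - 1))) ∈
      sectionsO R (2 * n) := by
  obtain ⟨m, rfl⟩ : ∃ m, n = m + 1 := ⟨n - 1, by omega⟩
  have h₁ : (LaurentPolynomial.T (m + 1 : ℕ) : R[T;T⁻¹]) =
      LaurentPolynomial.T (2 * (m + 1) : ℕ) * LaurentPolynomial.T (-(m + 1 : ℕ)) := by
    rw [← LaurentPolynomial.T_add]; congr 1; push_cast; ring
  have h₂ : (LaurentPolynomial.T (m + 1 + 1 : ℕ) : R[T;T⁻¹]) =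
      LaurentPolynomial.T (2 * (m + 1) : ℕ) * LaurentPolynomial.T (-(m : ℕ)) := by
    rw [← LaurentPolynomial.T_add]; congr 1; push_cast; ring
  change Polynomial.toLaurent _ = LaurentPolynomial.T _ *
    LaurentPolynomial.invert (Polynomial.toLaurent _)
  simp only [map_neg, map_add, map_mul, Polynomial.toLaurent_C, Polynomial.toLaurent_X_pow,
    LaurentPolynomial.invert_C, LaurentPolynomial.invert_T, Nat.add_sub_cancel]
  rw [h₂, h₁]
  ring

variable {R : Type} [CommRing R] {n : ℕ}

theorem HitchinBase.top_add_smul_top (s s' : sectionsO R (2 * n)) (r : R) :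
    top s + r • top s' = top (s + r • s') := by
  funext i
  rw [Pi.add_apply, Pi.smul_apply]
  simp only [top]
  split_ifs
  · rfl
  · rw [smul_zero, add_zero]

theorem HitchinBase.map_top {S : Type} [CommRing S] (f : R →+* S) (s : sectionsO R (2 * n)) :
    (top s).map f = top ⟨_, map_mem_sectionsO f _ s⟩ := by
  funext i
  refine Subtype.ext ?_
  rw [HitchinBase.map]
  simp only [top]
  split_ifs
  · rfl
  · simp

/-- The point of the Hitchin base with spectral curve `y^n = τ x^n + c x^(n+1)`. -/
def binomialPoint (hn : 0 < n) (c τ : R) : HitchinBase n R :=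
  HitchinBase.top ⟨_, mem_sectionsO_of_pos hn c τ⟩

theorem binomialPoint_add_smul (hn : 0 < n) (c τ c' τ' r : R) :
    binomialPoint hn c τ + r • binomialPoint hn c' τ' =
      binomialPoint hn (c + r * c') (τ + r * τ') := by
  rw [binomialPoint, binomialPoint, HitchinBase.top_add_smul_top]
  refine congrArg HitchinBase.top (Subtype.ext (Prod.ext ?_ ?_))
  · simp [Polynomial.smul_eq_C_mul]; ring
  · simp [Polynomial.smul_eq_C_mul]; ring

theorem map_binomialPoint {S : Type} [CommRing S] (f : R →+* S) (hn : 0 < n) (c τ : R) :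
    (binomialPoint hn c τ).map f = binomialPoint hn (f c) (f τ) := by
  rw [binomialPoint, HitchinBase.map_top]
  refine congrArg HitchinBase.top (Subtype.ext (Prod.ext ?_ ?_)) <;> simp

theorem add_smul_binomialPoint (hn : 0 < n) (t : R) :
    binomialPoint hn (1 : R) 0 + t • binomialPoint hn 0 1 = binomialPoint hn 1 t := by
  rw [binomialPoint_add_smul, mul_zero, mul_one, add_zero, zero_add]

theorem line_binomialPoint (hn : 0 < n) :
    HitchinBase.line (binomialPoint hn (1 : R) 0) (binomialPoint hn 0 1) =
      binomialPoint hn 1 Polynomial.X := by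
  rw [HitchinBase.line, map_binomialPoint, map_binomialPoint, map_one, map_zero,
    add_smul_binomialPoint]

theorem eqn₀_binomialPoint (hn : 2 ≤ n) (τ : R) :
    (binomialPoint (by omega : 0 < n) 1 τ).eqn₀ = degenerationEqn n τ := by
  rw [binomialPoint, HitchinBase.eqn₀_top hn, degenerationEqn, map_neg, ← sub_eq_add_neg, map_one,
    one_mul]

theorem eqn₁_binomialPoint (hn : 2 ≤ n) (τ : R) :
    (binomialPoint (by omega : 0 < n) 1 τ).eqn₁ = Polynomial.X ^ n -
      Polynomial.C (Polynomial.C τ * Polynomial.X ^ n + Polynomial.X ^ (n - 1)) := by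
  rw [binomialPoint, HitchinBase.eqn₁_top hn, map_neg, ← sub_eq_add_neg, map_one, one_mul]

theorem binomialPoint_zero_one_ne_zero [Nontrivial R] (hn : 2 ≤ n) :
    binomialPoint (by omega : 0 < n) (0 : R) 1 ≠ 0 := by
  intro h
  have h₁ := congrArg (fun p : sectionsO R (2 * n) => p.1.1.coeff n)
    (congrFun h ⟨n, hn, le_rfl⟩)
  rw [binomialPoint] at h₁
  simp only [HitchinBase.top_apply_self hn] at h₁
  simp at h₁

end Family

/-! ### Singular points and local equations of the degenerating curves -/

section SingularPoints

variable {n : ℕ} {C : Scheme.{0}} {A : Type} [CommRing A] [IsDomain A]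
  (j : Spec (CommRingCat.of A) ⟶ C) [IsOpenImmersion j] (s : C ⟶ Spec (CommRingCat.of ℂ))
  {π : ℂ[X][X] →+* A} (hπ : Function.Surjective π)
  (h : j ≫ s = Spec.map (CommRingCat.ofHom (π.comp (Polynomial.C.comp Polynomial.C))))
  (hn : 2 ≤ n) (t : ℂ)

include s hπ h hn t

/-- The only singular point in a chart isomorphic to the integral curve `y^n = t x^n + x^(n+1)` is
the origin. -/
theorem isSingularPoint_iff₀ (hker : RingHom.ker π = Ideal.span {(Polynomial.X ^ n -
      Polynomial.C (Polynomial.C t * Polynomial.X ^ n + Polynomial.X ^ (n + 1)) : ℂ[X][X])})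
    (P : PrimeSpectrum A) : IsSingularPoint C (j P) ↔ PrimeSpectrum.comap π P = origin ℂ := by
  obtain ⟨alg, hloc, -⟩ := exists_stalk_algebra j s _ h P
  rw [comap_eq_origin_iff]
  exact not_isRegularLocalRing_iff₀ (S := C.presheaf.stalk (j P)) hπ P.asIdeal hn t hker

/-- The origin of a chart isomorphic to the integral curve `v^n = t z^n + z^(n-1)` is singular if
and only if `n ≥ 3`. -/
theorem isSingularPoint_iff₁ (hker : RingHom.ker π = Ideal.span {(Polynomial.X ^ n -
      Polynomial.C (Polynomial.C t * Polynomial.X ^ n + Polynomial.X ^ (n - 1)) : ℂ[X][X])})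
    (P : PrimeSpectrum A) (hP : PrimeSpectrum.comap π P = origin ℂ) :
    IsSingularPoint C (j P) ↔ 3 ≤ n := by
  obtain ⟨alg, hloc, -⟩ := exists_stalk_algebra j s _ h P
  rw [comap_eq_origin_iff] at hP
  exact not_isRegularLocalRing_iff₁ (S := C.presheaf.stalk (j P)) hπ P.asIdeal hn t hker hP

omit [IsDomain A] s hπ h in
/-- On the part `z = 0` of the chart at infinity the only point of the curve
`v^n = t z^n + z^(n-1)` is the origin. -/
theorem comap_eq_origin_of_C_X_mem (hker : RingHom.ker π = Ideal.span {(Polynomial.X ^ n -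
      Polynomial.C (Polynomial.C t * Polynomial.X ^ n + Polynomial.X ^ (n - 1)) : ℂ[X][X])})
    (P : PrimeSpectrum A)
    (hP : Polynomial.C Polynomial.X ∈ (PrimeSpectrum.comap π P).asIdeal) :
    PrimeSpectrum.comap π P = origin ℂ := by
  set y := PrimeSpectrum.comap π P with hy
  have hF : (Polynomial.X ^ n - Polynomial.C (Polynomial.C t * Polynomial.X ^ n +
      Polynomial.X ^ (n - 1)) : ℂ[X][X]) ∈ y.asIdeal := by
    have h0 := hker ▸ Ideal.mem_span_singleton_self (Polynomial.X ^ n - Polynomial.C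
      (Polynomial.C t * Polynomial.X ^ n + Polynomial.X ^ (n - 1)) : ℂ[X][X])
    rw [hy, PrimeSpectrum.comap_asIdeal, Ideal.mem_comap, RingHom.mem_ker.1 h0]
    exact zero_mem _
  have hg : (Polynomial.C (Polynomial.C t * Polynomial.X ^ n +
      Polynomial.X ^ (n - 1)) : ℂ[X][X]) ∈ y.asIdeal := by
    rw [Polynomial.C_add, Polynomial.C_mul, Polynomial.C_pow, Polynomial.C_pow]
    exact add_mem (Ideal.mul_mem_left _ _ (Ideal.pow_mem_of_mem _ hP _ (by omega)))
      (Ideal.pow_mem_of_mem _ hP _ (by omega))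
  have hX : Polynomial.X ∈ y.asIdeal := by
    have := add_mem hF hg
    rw [sub_add_cancel] at this
    exact y.isPrime.mem_of_pow_mem _ this
  have hmax : (RingHom.ker (evalAt (0 : ℂ) 0)).IsMaximal :=
    RingHom.ker_isMaximal_of_surjective _ fun c =>
      ⟨Polynomial.C (Polynomial.C c), by simp [evalAt_C]⟩
  rw [comap_eq_origin_iff]
  refine (hmax.eq_of_le y.isPrime.ne_top ?_).symm
  rw [ker_evalAt, Ideal.span_le, Set.insert_subset_iff, Set.singleton_subset_iff]
  simpa using ⟨hP, hX⟩

end SingularPoints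

section Curve

open spectralCurve

variable {n : ℕ} (hn : 2 ≤ n) {t : ℂ} {a : HitchinBase n ℂ}

section FirstChart

variable (h₀ : a.eqn₀ = degenerationEqn n t)

include h₀

theorem ker_mk_eqn₀ : RingHom.ker (Ideal.Quotient.mk (Ideal.span {a.eqn₀})) =
    Ideal.span {(Polynomial.X ^ n - Polynomial.C
      (Polynomial.C t * Polynomial.X ^ n + Polynomial.X ^ (n + 1)) : ℂ[X][X])} := by
  rw [Ideal.mk_ker, h₀]
  rfl

include hn

/-- The first chart of the curve is integral, being parametrized by the affine line. -/
theorem isPrime_span_eqn₀ : (Ideal.span {a.eqn₀}).IsPrime := by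
  rw [h₀, degenerationEqn, span_eq_ker_parametrization (by omega)]
  exact RingHom.ker_isPrime _

theorem eqn₀_mem_origin : a.eqn₀ ∈ PrimeSpectrum.asIdeal (R := ℂ[X][X]) (origin ℂ) := by
  rw [origin_asIdeal, RingHom.mem_ker, h₀, degenerationEqn]
  simp [evalAt_C, evalAt_X, show n ≠ 0 by omega]

theorem isSingularPoint_chart₀_iff (P : PrimeSpectrum (Coord₀ a)) :
    IsSingularPoint (spectralCurve a) (chart₀ a P) ↔
      PrimeSpectrum.comap (Ideal.Quotient.mk (Ideal.span {a.eqn₀})) P = origin ℂ := by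
  have := isPrime_span_eqn₀ hn h₀
  have : IsDomain (Coord₀ a) := Ideal.Quotient.isDomain _
  exact isSingularPoint_iff₀ (chart₀ a) (toBase a) Ideal.Quotient.mk_surjective
    (chart₀_toBase a) hn t (ker_mk_eqn₀ h₀) P

omit hn in
theorem hasLocalEquation_chart₀ (P : PrimeSpectrum (Coord₀ a))
    (hP : PrimeSpectrum.comap (Ideal.Quotient.mk (Ideal.span {a.eqn₀})) P = origin ℂ) :
    HasLocalEquation (toBase a) (chart₀ a P) (MvPowerSeries.X 1 ^ n -
      (MvPowerSeries.C t * MvPowerSeries.X 0 ^ n + MvPowerSeries.X 0 ^ (n + 1))) := by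
  refine hasLocalEquation_of_chart (chart₀ a) (toBase a) Ideal.Quotient.mk_surjective
    (ker_mk_eqn₀ h₀) (chart₀_toBase a) P hP ?_ AlgEquiv.refl
  simp only [map_sub, map_add, map_mul, map_pow, taylorHom_X, taylorHom_C_X, taylorHom_C_C]

theorem hasLocalEquation_chart₀_of_ne_zero (ht : t ≠ 0) (P : PrimeSpectrum (Coord₀ a))
    (hP : PrimeSpectrum.comap (Ideal.Quotient.mk (Ideal.span {a.eqn₀})) P = origin ℂ) :
    HasLocalEquation (toBase a) (chart₀ a P)
      (MvPowerSeries.X 1 ^ n - MvPowerSeries.X 0 ^ n) := by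
  obtain ⟨e⟩ := exists_quotient_algEquiv_of_linear (show 0 < n by omega) n ht 1
  refine hasLocalEquation_of_chart (chart₀ a) (toBase a) Ideal.Quotient.mk_surjective
    (ker_mk_eqn₀ h₀) (chart₀_toBase a) P hP ?_ e
  simp only [map_sub, map_add, map_mul, map_pow, taylorHom_X, taylorHom_C_X, taylorHom_C_C,
    map_one]
  ring

end FirstChart

section SecondChart

variable (h₁ : a.eqn₁ = Polynomial.X ^ n -
  Polynomial.C (Polynomial.C t * Polynomial.X ^ n + Polynomial.X ^ (n - 1)))

include h₁

theorem ker_mk_eqn₁ : RingHom.ker (Ideal.Quotient.mk (Ideal.span {a.eqn₁})) =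
    Ideal.span {(Polynomial.X ^ n - Polynomial.C
      (Polynomial.C t * Polynomial.X ^ n + Polynomial.X ^ (n - 1)) : ℂ[X][X])} := by
  rw [Ideal.mk_ker, h₁]

include hn

theorem eqn₁_mem_origin : a.eqn₁ ∈ PrimeSpectrum.asIdeal (R := ℂ[X][X]) (origin ℂ) := by
  rw [origin_asIdeal, RingHom.mem_ker, h₁]
  simp [evalAt_C, evalAt_X, show n ≠ 0 by omega, show n - 1 ≠ 0 by omega]

/-- The chart with coordinates `x`, `y` covers all of the curve except for the origin of the chart
at infinity. -/
theorem exists_eq_chart₁_of_notMem_range {r : spectralCurve a} (hr : r ∉ Set.range (chart₀ a)) :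
    ∃ P, chart₁ a P = r ∧
      PrimeSpectrum.comap (Ideal.Quotient.mk (Ideal.span {a.eqn₁})) P = origin ℂ := by
  obtain ⟨P, hP⟩ := (pushout_mem_range_or _ _ r).resolve_left hr
  refine ⟨P, hP, ?_⟩
  refine comap_eq_origin_of_C_X_mem hn t (ker_mk_eqn₁ h₁) P ?_
  by_contra hX
  refine hr ((mem_range_chart₀_iff a _).2 ?_)
  have h := (Tot.chart₁_mem_range_chart₀_iff _).2 hX
  have hι : ι a r = _ := (congrArg (ι a) hP.symm).trans (ι_chart₁ a P)
  rw [hι]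
  exact h

theorem isSingularPoint_chart₁_iff (hprime : (Ideal.span {a.eqn₁}).IsPrime)
    (P : PrimeSpectrum (Coord₁ a))
    (hP : PrimeSpectrum.comap (Ideal.Quotient.mk (Ideal.span {a.eqn₁})) P = origin ℂ) :
    IsSingularPoint (spectralCurve a) (chart₁ a P) ↔ 3 ≤ n := by
  have : IsDomain (Coord₁ a) := Ideal.Quotient.isDomain _
  exact isSingularPoint_iff₁ (chart₁ a) (toBase a) Ideal.Quotient.mk_surjective
    (chart₁_toBase a) hn t (ker_mk_eqn₁ h₁) P hP

theorem hasLocalEquation_chart₁ (P : PrimeSpectrum (Coord₁ a))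
    (hP : PrimeSpectrum.comap (Ideal.Quotient.mk (Ideal.span {a.eqn₁})) P = origin ℂ) :
    HasLocalEquation (toBase a) (chart₁ a P)
      (MvPowerSeries.X 1 ^ n - MvPowerSeries.X 0 ^ (n - 1)) := by
  have hn0 : 0 < n := by omega
  obtain ⟨e⟩ := exists_quotient_algEquiv_of_linear hn0 (n - 1) (one_ne_zero (α := ℂ)) t
  refine hasLocalEquation_of_chart (chart₁ a) (toBase a) Ideal.Quotient.mk_surjective
    (ker_mk_eqn₁ h₁) (chart₁_toBase a) P hP ?_ e
  simp only [map_sub, map_add, map_mul, map_pow, taylorHom_X, taylorHom_C_X, taylorHom_C_C,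
    map_one]
  rw [add_mul, one_mul, mul_assoc, mul_pow_sub_one hn0.ne', add_comm]

end SecondChart

/-- The base change square for a spectral curve whose point of the Hitchin base is only
propositionally the image of `a`. -/
theorem exists_isPullback_of_map_eq {R S : Type} [CommRing R] [CommRing S] (f : R →+* S)
    (hf : Function.Surjective f) {a : HitchinBase n R} {b : HitchinBase n S} (h : a.map f = b) :
    ∃ j : spectralCurve b ⟶ spectralCurve a, j ≫ ι a = ι b ≫ Tot.baseChange f ∧
      IsPullback j (toBase b) (toBase a) (Spec.map (CommRingCat.ofHom f)) := by
  subst h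
  exact ⟨baseChange f a, baseChange_ι f a, isPullback_baseChange f a hf⟩

theorem exists_isPullback_planeCurve {R : Type} [CommRing R] {a : HitchinBase n R} {F : R[X][X]}
    (h : a.eqn₀ = F) : ∃ c, IsPullback c (planeCurve F) (ι a) (Tot.chart₀ R) := by
  subst h
  exact ⟨chart₀ a, isPullback_chart₀ a⟩

include hn in
/-- The points `q` and `p` are the origins of the two charts. A point of the first chart is treated
there; the only other point is `p`. -/
theorem exists_special_points (h₀ : a.eqn₀ = degenerationEqn n t)
    (h₁ : a.eqn₁ = Polynomial.X ^ n -
      Polynomial.C (Polynomial.C t * Polynomial.X ^ n + Polynomial.X ^ (n - 1))) :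
    ∃ p q : spectralCurve a, p ≠ q ∧
      ι a p = Tot.chart₁ ℂ (origin ℂ) ∧ ι a q = Tot.chart₀ ℂ (origin ℂ) ∧
      (∀ r : spectralCurve a, IsSingularPoint (spectralCurve a) r ↔ r = q ∨ (r = p ∧ 3 ≤ n)) ∧
      HasLocalEquation (toBase a) p (MvPowerSeries.X 1 ^ n - MvPowerSeries.X 0 ^ (n - 1)) ∧
      HasLocalEquation (toBase a) q (MvPowerSeries.X 1 ^ n -
        (MvPowerSeries.C t * MvPowerSeries.X 0 ^ n + MvPowerSeries.X 0 ^ (n + 1))) ∧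
      (t ≠ 0 → HasLocalEquation (toBase a) q
        (MvPowerSeries.X 1 ^ n - MvPowerSeries.X 0 ^ n)) := by
  have hprime₁ := isPrime_span_eqn₁ a (by omega) (isPrime_span_eqn₀ hn h₀)
  have hinj : Function.Injective (ι a) :=
    have := isClosedImmersion_ι a
    (ι a).isClosedEmbedding.injective
  obtain ⟨Q, hQ⟩ := exists_comap_mk_eq _ (eqn₀_mem_origin hn h₀)
  obtain ⟨P, hP⟩ := exists_comap_mk_eq _ (eqn₁_mem_origin hn h₁)
  have hιq : ι a (chart₀ a Q) = Tot.chart₀ ℂ (origin ℂ) :=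
    (ι_chart₀ a Q).trans (congrArg (Tot.chart₀ ℂ) hQ)
  have hιp : ι a (chart₁ a P) = Tot.chart₁ ℂ (origin ℂ) :=
    (ι_chart₁ a P).trans (congrArg (Tot.chart₁ ℂ) hP)
  have hp : chart₁ a P ∉ Set.range (chart₀ a) := by
    rw [mem_range_chart₀_iff, hιp]
    exact Tot.chart₁_origin_notMem_range ℂ
  refine ⟨chart₁ a P, chart₀ a Q, fun h => hp ⟨Q, h.symm⟩, hιp, hιq, fun r => ?_,
    hasLocalEquation_chart₁ hn h₁ P hP, hasLocalEquation_chart₀ h₀ Q hQ,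
    fun ht => hasLocalEquation_chart₀_of_ne_zero hn h₀ ht Q hQ⟩
  by_cases hr : r ∈ Set.range (chart₀ a)
  · have hrp : r ≠ chart₁ a P := fun h => hp (h ▸ hr)
    obtain ⟨W, rfl⟩ := hr
    refine (isSingularPoint_chart₀_iff hn h₀ W).trans ⟨fun hW => .inl (hinj ?_), fun h => ?_⟩
    · exact (ι_chart₀ a W).trans ((congrArg (Tot.chart₀ ℂ) hW).trans hιq.symm)
    · have h' := (ι_chart₀ a W).symm.trans
        ((congrArg (ι a) (h.resolve_right fun h => hrp h.1)).trans hιq)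
      exact (Tot.chart₀ ℂ).isOpenEmbedding.injective h'
  · obtain ⟨W, rfl, hW⟩ := exists_eq_chart₁_of_notMem_range hn h₁ hr
    have hWP : chart₁ a W = chart₁ a P :=
      hinj ((ι_chart₁ a W).trans ((congrArg (Tot.chart₁ ℂ) hW).trans hιp.symm))
    refine (isSingularPoint_chart₁_iff hn h₁ hprime₁ W hW).trans
      ⟨fun h => .inr ⟨hWP, h⟩, fun h => ?_⟩
    exact (h.resolve_left fun h => hr ⟨Q, h.symm⟩).2

end Curve

end

end SpectralFamily

theorem mainTheorem10 (n : ℕ) (hn : 2 ≤ n) :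
    ∃ a b : HitchinBase n ℂ, b ≠ 0 ∧
      -- the family `𝒞 ⟶ 𝔸¹ = Spec ℂ[t]` over the line `a + t b`
      IsClosedImmersion (spectralCurve.ι (HitchinBase.line a b)) ∧
      -- in the chart with coordinates `x`, `y` it is given by `y^n = t x^n + x^(n+1)`
      (∃ c, IsPullback c (planeCurve (degenerationEqn n (Polynomial.X : ℂ[X])))
        (spectralCurve.ι (HitchinBase.line a b)) (Tot.chart₀ ℂ[X])) ∧
      ∀ t : ℂ,
        -- the curve `C_t` over the point `a + t b`
        IsClosedImmersion (spectralCurve.ι (a + t • b)) ∧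
        AlgebraicGeometry.IsIntegral (spectralCurve (a + t • b)) ∧
        (∃ E : HiggsBundle n ℂ, E.hitchinMap = a + t • b) ∧
        -- `C_t` is the fibre of the family over `t`
        (∃ j : spectralCurve (a + t • b) ⟶ spectralCurve (HitchinBase.line a b),
          j ≫ spectralCurve.ι (HitchinBase.line a b) =
            spectralCurve.ι (a + t • b) ≫ Tot.baseChange (Polynomial.evalRingHom t) ∧
          IsPullback j (spectralCurve.toBase (a + t • b))
            (spectralCurve.toBase (HitchinBase.line a b))
            (Spec.map (CommRingCat.ofHom (Polynomial.evalRingHom t)))) ∧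
        -- the two special points and their local equations
        ∃ p q : spectralCurve (a + t • b),
          p ≠ q ∧
          spectralCurve.ι (a + t • b) p = Tot.chart₁ ℂ (origin ℂ) ∧
          spectralCurve.ι (a + t • b) q = Tot.chart₀ ℂ (origin ℂ) ∧
          (∀ r : spectralCurve (a + t • b),
            IsSingularPoint (spectralCurve (a + t • b)) r ↔ r = q ∨ (r = p ∧ 3 ≤ n)) ∧
          HasLocalEquation (spectralCurve.toBase (a + t • b)) p
            (MvPowerSeries.X 1 ^ n - MvPowerSeries.X 0 ^ (n - 1)) ∧
          HasLocalEquation (spectralCurve.toBase (a + t • b)) q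
            (MvPowerSeries.X 1 ^ n -
              (MvPowerSeries.C t * MvPowerSeries.X 0 ^ n + MvPowerSeries.X 0 ^ (n + 1))) ∧
          (t ≠ 0 → HasLocalEquation (spectralCurve.toBase (a + t • b)) q
            (MvPowerSeries.X 1 ^ n - MvPowerSeries.X 0 ^ n)) ∧
          (t = 0 → HasLocalEquation (spectralCurve.toBase (a + t • b)) q
            (MvPowerSeries.X 1 ^ n - MvPowerSeries.X 0 ^ (n + 1))) := by
  have hn0 : 0 < n := by omega
  -- `a` is `-x^(n+1)` and `b` is `-x^n`, both in degree `n`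
  refine ⟨binomialPoint hn0 1 0, binomialPoint hn0 0 1, binomialPoint_zero_one_ne_zero hn,
    spectralCurve.isClosedImmersion_ι _, ?_, fun t => ?_⟩
  · rw [line_binomialPoint hn0]
    exact exists_isPullback_planeCurve (eqn₀_binomialPoint hn _)
  rw [line_binomialPoint hn0, add_smul_binomialPoint hn0 t]
  have h₀ : (binomialPoint hn0 1 t).eqn₀ = degenerationEqn n t := eqn₀_binomialPoint hn t
  have h₁ := eqn₁_binomialPoint hn t
  have hmap : (binomialPoint hn0 1 Polynomial.X).map (Polynomial.evalRingHom t) =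
      binomialPoint hn0 1 t := by
    rw [map_binomialPoint, map_one, Polynomial.coe_evalRingHom, Polynomial.eval_X]
  obtain ⟨p, q, hpq, hp, hq, hsing, hlp, hlq, hlq'⟩ := exists_special_points hn h₀ h₁
  have hint := spectralCurve.isIntegral _ hn0 (isPrime_span_eqn₀ hn h₀)
  have hfib := exists_isPullback_of_map_eq (Polynomial.evalRingHom t)
    (fun c => ⟨Polynomial.C c, by simp⟩) hmap
  have hq₀ (ht : t = 0) : HasLocalEquation (spectralCurve.toBase (binomialPoint hn0 1 t)) q
      (MvPowerSeries.X 1 ^ n - MvPowerSeries.X 0 ^ (n + 1)) := by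
    have h := hlq
    rw [show (MvPowerSeries.C t : MvPowerSeries (Fin 2) ℂ) = 0 by rw [ht, map_zero], zero_mul,
      zero_add] at h
    exact h
  refine ⟨spectralCurve.isClosedImmersion_ι _, hint, ?_, hfib, p, q, hpq, hp, hq, hsing, hlp, hlq,
    hlq', hq₀⟩
  exact ⟨_, hitchinMap_cyclicHiggsBundle hn _⟩
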